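/- Let $p(\rho)=\rho^\gamma$ with $1\le\gamma<3$, let $\varepsilon$ be the internal energy, $p(r)=r^2\varepsilon'(r)$, i.e. $\varepsilon(\rho)=\rho^{\gamma-1}/(\gamma-1)$ if $\gamma>1$ and $\varepsilon(\rho)=\log\rho$ if $\gamma=1$, and consider on $\mathbb{R}^2\times[0,\infty)$ the isentropic Euler system $$\partial_t\rho+\mathrm{div}_x(\rho v)=0,\qquad \partial_t(\rho v)+\mathrm{div}_x(\rho v\otimes v)+\nabla_x p(\rho)=0,$$ with Riemann initial data $(\rho^0,v^0)(x)=(\rho_-,v_-)$ for $x_2<0$ and $(\rho_+,v_+)$ for $x_2>0$, where $\rho_\pm>0$ and $v_\pm\in\mathbb{R}^2$ are constant. Weak solutions are bounded solutions in the sense of distributions with $\rho\ge 0$ that take the initial data; a weak solution is admissible if in addition $$\partial_t\Big(\rho\varepsilon(\rho)+\rho\tfrac{|v|^2}{2}\Big)+\mathrm{div}_x\Big[\Big(\rho\varepsilon(\rho)+\rho\tfrac{|v|^2}{2}+p(\rho)\Big)v\Big]\le 0$$ in the sense of distributions (initial data included). For $L>0$ let $E_L[\rho,v](t)=\int_{(-L,L)^2}\big(\rho\varepsilon(\rho)+\rho\frac{|v|^2}{2}\big)(x,t)\,dx$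 and let $D_L[\rho,v](t)$ be its right derivative at $t$. A weak solution $(\rho,v)$ is called entropy rate admissible if there is $L^*>0$ such that there is no weak solution $(\bar\rho,\bar v)$ with the same initial data for which, for some $\tau\ge 0$, $(\bar\rho,\bar v)=(\rho,v)$ on $\mathbb{R}^2\times[0,\tau]$ and $D_L[\bar\rho,\bar v](\tau)<D_L[\rho,v](\tau)$ for all $L\ge L^*$. Theorem. For every $\gamma\in[1,3)$ there exist Riemann data with $v_{-1}=v_{+1}$ and $$v_{+2}-v_{-2}<-\sqrt{\frac{(\rho_--\rho_+)(p(\rho_-)-p(\rho_+))}{\rho_-\rho_+}}$$ for which the self-similar solution $(\rho_c,v_c)$, which consists of an admissible $1$-shock, a constant intermediate state and an admissible $3$-shock (there is exactly one such solution, and it is an admissible weak solution), is not entropy rate admissible. Moreover, for these data there are constants $\nu_-<\nu_+$, $\rho_1>0$, $C>0$ and infinitely many admissible weak solutions $(\rho_n,v_n)$, all with the same density and with velocities that are pairwise not a.e. equal, such that $(\rho_n,v_n)=(\rho_-,v_-)$ for $x_2<\nu_-t$, $\rho_n=\rho_1$ and $|v_n|^2=C$ for $\nu_-t<x_2<\nu_+t$,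 and $(\rho_n,v_n)=(\rho_+,v_+)$ for $x_2>\nu_+t$, and which dissipate more energy: for every $n$ and every $L>0$ there is $T>0$ with $D_L[\rho_n,v_n](t)<D_L[\rho_c,v_c](t)$ for all $0\le t<T$. -/

import Mathlib

open MeasureTheory Set Filter Topology
open scoped ContDiff

noncomputable section

namespace IsentropicEuler

/-- The physical plane `ℝ²` with its Euclidean norm. The coordinate `x₂` of the mathematics is
`x 1`, and `x₁` is `x 0`. -/
abbrev Plane : Type := EuclideanSpace ℝ (Fin 2)

/-- The pressure law `p(ρ) = ρ ^ γ`. -/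
def pressure (γ r : ℝ) : ℝ := r ^ γ

/-- The internal energy `ε` with `p(r) = r² ε'(r)`: `ε(r) = r ^ (γ - 1) / (γ - 1)` for `γ ≠ 1`
and `ε(r) = log r` for `γ = 1`. (It only enters through `r ε(r)`, which is `0` at vacuum.) -/
def internalEnergy (γ r : ℝ) : ℝ :=
  if γ = 1 then Real.log r else r ^ (γ - 1) / (γ - 1)

/-- The total energy density `ρ ε(ρ) + ρ |v|² / 2` of a state `(ρ, v)`. -/
def energyDensity (γ r : ℝ) (w : Plane) : ℝ :=
  r * internalEnergy γ r + r * ‖w‖ ^ 2 / 2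

/-- Time derivative at the space-time point `z = (x, t)`. -/
def dt {F : Type*} [NormedAddCommGroup F] [NormedSpace ℝ F] (f : Plane × ℝ → F)
    (z : Plane × ℝ) : F :=
  fderiv ℝ f z (0, 1)

/-- Spatial derivative in the direction `w` at `z = (x, t)`; for scalar `f` it is `w · ∇ₓ f`. -/
def dx {F : Type*} [NormedAddCommGroup F] [NormedSpace ℝ F] (f : Plane × ℝ → F)
    (z : Plane × ℝ) (w : Plane) : F :=
  fderiv ℝ f z (w, 0)

/-- Spatial divergence of a vector field. -/
def divx (f : Plane × ℝ → Plane) (z : Plane × ℝ) : ℝ :=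
  ∑ i : Fin 2, dx f z (EuclideanSpace.single i 1) i

/-- Test functions of class `C_c^∞(ℝ² × [0, ∞))`, given by their extensions to `ℝ² × ℝ`. -/
def IsTest {F : Type*} [NormedAddCommGroup F] [NormedSpace ℝ F] (f : Plane × ℝ → F) : Prop :=
  ContDiff ℝ ∞ f ∧ HasCompactSupport f

/-- The open upper half of space-time `ℝ² × (0, ∞)`. -/
def upperHalf : Set (Plane × ℝ) := {z | 0 < z.2}

/-- Bounded weak solutions on `ℝ² × [0, ∞)` of the isentropic Euler system with `p(ρ) = ρ ^ γ` and
initial data `(ρ₀, v₀)`. A class in `L^∞` is given by a bounded Borel representative, defined at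
every point, whose value at time `0` is the initial datum. (Values at negative times play no
role.) In the momentum equation `inner ℝ w (dx φ z w)` is `w ⊗ w : ∇ₓ φ`. -/
structure IsWeakSolution (γ : ℝ) (ρ₀ : Plane → ℝ) (v₀ : Plane → Plane)
    (ρ : Plane × ℝ → ℝ) (v : Plane × ℝ → Plane) : Prop where
  measurable_density : Measurable ρ
  measurable_velocity : Measurable v
  density_nonneg : ∀ z : Plane × ℝ, 0 ≤ z.2 → 0 ≤ ρ z
  bounded : ∃ M : ℝ, ∀ z : Plane × ℝ, 0 ≤ z.2 → |ρ z| ≤ M ∧ ‖v z‖ ≤ M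
  initial : ∀ᵐ x : Plane, ρ (x, 0) = ρ₀ x ∧ v (x, 0) = v₀ x
  mass : ∀ ψ : Plane × ℝ → ℝ, IsTest ψ →
    (∫ z in upperHalf, (ρ z * dt ψ z + ρ z * dx ψ z (v z)))
      + (∫ x : Plane, ρ₀ x * ψ (x, 0)) = 0
  momentum : ∀ φ : Plane × ℝ → Plane, IsTest φ →
    (∫ z in upperHalf, (ρ z * inner ℝ (v z) (dt φ z) + ρ z * inner ℝ (v z) (dx φ z (v z))
        + pressure γ (ρ z) * divx φ z))
      + (∫ x : Plane, ρ₀ x * inner ℝ (v₀ x) (φ (x, 0))) = 0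

/-- Admissible (entropy) solutions: weak solutions with the energy inequality in the sense of
distributions, initial data included. -/
structure IsAdmissibleSolution (γ : ℝ) (ρ₀ : Plane → ℝ) (v₀ : Plane → Plane)
    (ρ : Plane × ℝ → ℝ) (v : Plane × ℝ → Plane) : Prop
    extends IsWeakSolution γ ρ₀ v₀ ρ v where
  energy_ineq : ∀ φ : Plane × ℝ → ℝ, IsTest φ → (∀ z : Plane × ℝ, 0 ≤ z.2 → 0 ≤ φ z) →
    0 ≤ (∫ z in upperHalf, (energyDensity γ (ρ z) (v z) * dt φ z
          + (energyDensity γ (ρ z) (v z) + pressure γ (ρ z)) * dx φ z (v z)))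
      + (∫ x : Plane, energyDensity γ (ρ₀ x) (v₀ x) * φ (x, 0))

/-- The box `(-L, L)²`. -/
def box (L : ℝ) : Set Plane := {x | ∀ i, x i ∈ Ioo (-L) L}

/-- The energy `E_L[ρ, v](t)` in the box. -/
def energy (γ : ℝ) (ρ : Plane × ℝ → ℝ) (v : Plane × ℝ → Plane) (L t : ℝ) : ℝ :=
  ∫ x in box L, energyDensity γ (ρ (x, t)) (v (x, t))

/-- `D` is the energy dissipation rate `D_L[ρ, v](t)`: the right derivative of `E_L[ρ, v]` at `t`
exists and equals `D`. -/
def HasDissipationRate (γ : ℝ) (ρ : Plane × ℝ → ℝ) (v : Plane × ℝ → Plane) (L t D : ℝ) : Prop :=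
  HasDerivWithinAt (energy γ ρ v L) D (Ici t) t

/-- `D_L[ρ', v'](t) < D_L[ρ, v](t)`, where both dissipation rates exist. -/
def DissipatesMore (γ : ℝ) (ρ' : Plane × ℝ → ℝ) (v' : Plane × ℝ → Plane)
    (ρ : Plane × ℝ → ℝ) (v : Plane × ℝ → Plane) (L t : ℝ) : Prop :=
  ∃ D' D : ℝ, HasDissipationRate γ ρ' v' L t D' ∧ HasDissipationRate γ ρ v L t D ∧ D' < D

/-- The entropy rate admissibility criterion of Dafermos. -/
def IsEntropyRateAdmissible (γ : ℝ) (ρ₀ : Plane → ℝ) (v₀ : Plane → Plane)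
    (ρ : Plane × ℝ → ℝ) (v : Plane × ℝ → Plane) : Prop :=
  IsWeakSolution γ ρ₀ v₀ ρ v ∧
    ∃ Lstar : ℝ, 0 < Lstar ∧
      ¬ ∃ (ρ' : Plane × ℝ → ℝ) (v' : Plane × ℝ → Plane),
        IsWeakSolution γ ρ₀ v₀ ρ' v' ∧
        ∃ τ : ℝ, 0 ≤ τ ∧
          (∀ t ∈ Icc 0 τ, ∀ᵐ x : Plane, ρ' (x, t) = ρ (x, t) ∧ v' (x, t) = v (x, t)) ∧
          ∀ L : ℝ, Lstar ≤ L → DissipatesMore γ ρ' v' ρ v L τ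

/-- Riemann data: two constant states with positive densities, to the left (`x₂ < 0`) and to the
right (`x₂ > 0`). -/
structure RiemannData where
  ρL : ℝ
  ρR : ℝ
  vL : Plane
  vR : Plane
  ρL_pos : 0 < ρL
  ρR_pos : 0 < ρR

/-- The initial density. -/
def RiemannData.density (d : RiemannData) (x : Plane) : ℝ := if x 1 < 0 then d.ρL else d.ρR

/-- The initial velocity. -/
def RiemannData.velocity (d : RiemannData) (x : Plane) : Plane := if x 1 < 0 then d.vL else d.vR

/-- The two-shock condition on Riemann data. -/
def RiemannData.TwoShockCondition (d : RiemannData) (γ : ℝ) : Prop :=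
  d.vL 0 = d.vR 0 ∧
    d.vR 1 - d.vL 1 <
      -Real.sqrt ((d.ρL - d.ρR) * (pressure γ d.ρL - pressure γ d.ρR) / (d.ρL * d.ρR))

/-- A planar shock of speed `s` in direction `x₂` from the state `(ρl, vl)` on the left to
`(ρr, vr)` on the right, which is admissible: the Rankine-Hugoniot conditions for mass and for both
components of momentum, and the energy inequality across the shock. -/
structure IsAdmissibleShock (γ : ℝ) (ρl : ℝ) (vl : Plane) (ρr : ℝ) (vr : Plane) (s : ℝ) :
    Prop where
  mass : s * (ρr - ρl) = ρr * vr 1 - ρl * vl 1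
  momentum₁ : s * (ρr * vr 0 - ρl * vl 0) = ρr * vr 0 * vr 1 - ρl * vl 0 * vl 1
  momentum₂ : s * (ρr * vr 1 - ρl * vl 1)
    = ρr * vr 1 ^ 2 - ρl * vl 1 ^ 2 + pressure γ ρr - pressure γ ρl
  energy : (energyDensity γ ρr vr + pressure γ ρr) * vr 1
      - (energyDensity γ ρl vl + pressure γ ρl) * vl 1
    ≤ s * (energyDensity γ ρr vr - energyDensity γ ρl vl)

/-- The function with constant values `a`, `b`, `c` in the regions `x₂ < s₁ t`,
`s₁ t < x₂ < s₂ t` and `s₂ t < x₂` of space-time. -/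
def fan {α : Type*} (s₁ s₂ : ℝ) (a b c : α) (z : Plane × ℝ) : α :=
  if z.1 1 < s₁ * z.2 then a else if z.1 1 < s₂ * z.2 then b else c

/-- `(ρ, v)` is the self-similar function (it depends only on `x₂ / t` for `t > 0`) that consists of
an admissible `1`-shock (density increasing from left to right), a constant intermediate state, and
an admissible `3`-shock (density decreasing from left to right). -/
def IsTwoShockSolution (γ : ℝ) (d : RiemannData)
    (ρ : Plane × ℝ → ℝ) (v : Plane × ℝ → Plane) : Prop :=
  ∃ (ρm : ℝ) (vm : Plane) (s₁ s₃ : ℝ),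
    d.ρL < ρm ∧ d.ρR < ρm ∧ s₁ < s₃ ∧
    IsAdmissibleShock γ d.ρL d.vL ρm vm s₁ ∧
    IsAdmissibleShock γ ρm vm d.ρR d.vR s₃ ∧
    ρ = fan s₁ s₃ d.ρL ρm d.ρR ∧
    v = fan s₁ s₃ d.vL vm d.vR

/-- The form of the nonstandard solutions: in a fan `ν₁ t < x₂ < ν₂ t` the density and the modulus
of the velocity are constant, and outside of the fan the Riemann data persist. -/
def HasFanForm (d : RiemannData) (ν₁ ν₂ ρ₁ C : ℝ)
    (ρ : Plane × ℝ → ℝ) (v : Plane × ℝ → Plane) : Prop :=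
  ∀ z : Plane × ℝ, 0 < z.2 →
    (z.1 1 < ν₁ * z.2 → ρ z = d.ρL ∧ v z = d.vL) ∧
    (ν₁ * z.2 < z.1 1 → z.1 1 < ν₂ * z.2 → ρ z = ρ₁ ∧ ‖v z‖ ^ 2 = C) ∧
    (ν₂ * z.2 < z.1 1 → ρ z = d.ρR ∧ v z = d.vR)

end IsentropicEuler

end

/-! ### Potentials for the linearised system: divergence-free velocities with trace-free stresses -/

noncomputable section

namespace IsentropicEuler

/-! The data are symmetric: unit density on both sides and velocities `±V` in direction `x₂`
(`collision V`). The two-shock solution then has gas of some density `m` at rest between shocks of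
speeds `±V/(m-1)`. Its competitors are fans of density `r < m` bounded by `x₂ = ±νt`, in which the
velocity `w` has mean zero in the weak sense, constant modulus `|w|² = a₁ + a₂`, and mean tensor `w
⊗ w` equal to `A = diag(a₁, a₂)`.

Outside of the fan nothing moves away from the data, so only the averages in the fan matter for the
balance laws (`wedge_balance`). They reduce to the Rankine-Hugoniot relations `V = ν(r-1)` and `νV +
V² + 1 = p(r) + r a₂`, which determine `ν` and `a₂` from `r` and leave `a₁` free. The relation for
`a₂` gives `a₂ > 0` when `r < m` and `a₂ = 0` when `r = m` (`flux_lt`), so the two-shock solution is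
the degenerate fan with `w = 0`.

The energy in a box is affine in time as long as the fan stays in the box. Its slope is a positive
multiple of `V * fanDissipation γ V r + ν r a₁ / 2` (`energy_fan`, `fanDissipation_eq`). As `a₁` may
be small, it suffices to find `r` slightly below `m` with `fanDissipation γ V r < fanDissipation γ V
m`, that is, to make the derivative at `m` positive. After `V` is eliminated by the shock relation,
the leading term of the derivative has the coefficient `(3-γ)/2`; hence a large `m` works precisely
because `γ < 3` (`exists_shock_with_increasing_dissipation`). The fan loses energy faster than an
admissible solution with the same outer states, and so inherits the energy inequality.

The oscillating fields come from convex integration (`exists_exactSolution`). A strict subsolution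
is a velocity `w` and a trace-free stress `u` that solve the linear system `div w = 0`, `∂ₜw + div u
= 0`, with `A - w ⊗ w + u` positive definite; the defect is the trace `a₁ + a₂ - |w|²`. Starting
from zero, localised plane waves are added with amplitude proportional to the defect
(`exists_waveDir`), on disjoint balls that nearly exhaust the domain. Each step lowers the integral
of the defect by a fixed multiple of the integral of its square (`exists_step`), while the change of
`w` is almost orthogonal to all earlier velocities. The velocities are therefore Cauchy in weighted
`L²`, the defect tends to zero, and positivity forces `u = w ⊗ w - A` in the limit. Solutions that
are nearly orthogonal to all previous ones, but have the same norm, are distinct, whence infinitely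
many.

Entropy rate admissibility fails already at `τ = 0`, where all solutions agree. -/

/-- Space-time `ℝ² × ℝ`. -/
abbrev SpaceTime : Type := Plane × ℝ

/-- The directional derivative of `f` along `v`, as a function. -/
def dirDeriv (v : SpaceTime) (f : SpaceTime → ℝ) : SpaceTime → ℝ := fun z => fderiv ℝ f z v

/-- The first spatial direction. -/
def e₁ : SpaceTime := (EuclideanSpace.single 0 1, 0)

/-- The second spatial direction. -/
def e₂ : SpaceTime := (EuclideanSpace.single 1 1, 0)

/-- The time direction. -/
def eₜ : SpaceTime := (0, 1)

instance : (volume : Measure SpaceTime).IsAddHaarMeasure :=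
  inferInstanceAs ((volume : Measure Plane).prod (volume : Measure ℝ)).IsAddHaarMeasure

section Calculus

variable {f g : SpaceTime → ℝ} {u v : SpaceTime}

lemma contDiff_dirDeriv (hf : ContDiff ℝ ∞ f) (v : SpaceTime) : ContDiff ℝ ∞ (dirDeriv v f) :=
  (hf.fderiv_right (by norm_num)).clm_apply contDiff_const

lemma tsupport_dirDeriv_subset (v : SpaceTime) : tsupport (dirDeriv v f) ⊆ tsupport f := by
  refine closure_minimal (fun z hz => ?_) (isClosed_tsupport f)
  by_contra h
  refine hz ?_
  have : fderiv ℝ f z = 0 := by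
    by_contra h'
    exact h (support_fderiv_subset ℝ h')
  simp [dirDeriv, this]

lemma hasCompactSupport_dirDeriv (hf : HasCompactSupport f) (v : SpaceTime) :
    HasCompactSupport (dirDeriv v f) :=
  hf.of_isClosed_subset (isClosed_tsupport _) (tsupport_dirDeriv_subset v)

lemma differentiable_of_smooth (hf : ContDiff ℝ ∞ f) : Differentiable ℝ f :=
  hf.differentiable (by norm_num)

lemma dirDeriv_comm (hf : ContDiff ℝ ∞ f) (u v : SpaceTime) :
    dirDeriv u (dirDeriv v f) = dirDeriv v (dirDeriv u f) := by
  have hd : Differentiable ℝ (fderiv ℝ f) :=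
    (hf.fderiv_right (m := ∞) (by norm_num)).differentiable (by norm_num)
  have key : ∀ (a b z : SpaceTime), dirDeriv a (dirDeriv b f) z = fderiv ℝ (fderiv ℝ f) z a b := by
    intro a b z
    have h := ((hd z).hasFDerivAt.clm_apply (hasFDerivAt_const b z)).fderiv
    change fderiv ℝ (fun y => fderiv ℝ f y b) z a = _
    rw [h]
    simp
  funext z
  rw [key, key]
  have := (hf.contDiffAt (x := z)).isSymmSndFDerivAt (by
    rw [minSmoothness_of_isRCLikeNormedField]; exact ENat.LEInfty.out)
  exact this u v

lemma dirDeriv_add (hf : ContDiff ℝ ∞ f) (hg : ContDiff ℝ ∞ g) (v : SpaceTime) :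
    dirDeriv v (f + g) = dirDeriv v f + dirDeriv v g := by
  funext z
  simp [dirDeriv, fderiv_add (differentiable_of_smooth hf z) (differentiable_of_smooth hg z)]

lemma dirDeriv_sub (hf : ContDiff ℝ ∞ f) (hg : ContDiff ℝ ∞ g) (v : SpaceTime) :
    dirDeriv v (f - g) = dirDeriv v f - dirDeriv v g := by
  funext z
  simp [dirDeriv, fderiv_sub (differentiable_of_smooth hf z) (differentiable_of_smooth hg z)]

lemma contDiff_smul (hf : ContDiff ℝ ∞ f) (c : ℝ) : ContDiff ℝ ∞ (c • f) :=
  contDiff_const.smul hf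

lemma contDiff_add (hf : ContDiff ℝ ∞ f) (hg : ContDiff ℝ ∞ g) : ContDiff ℝ ∞ (f + g) :=
  hf.add hg

lemma dirDeriv_smul (hf : ContDiff ℝ ∞ f) (c : ℝ) (v : SpaceTime) :
    dirDeriv v (c • f) = c • dirDeriv v f := by
  funext z
  simp [dirDeriv, fderiv_const_smul (differentiable_of_smooth hf z) c]

lemma dirDeriv_mul (hf : ContDiff ℝ ∞ f) (hg : ContDiff ℝ ∞ g) (v : SpaceTime) :
    dirDeriv v (f * g) = dirDeriv v f * g + f * dirDeriv v g := by
  funext z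
  simp [dirDeriv, fderiv_mul (differentiable_of_smooth hf z) (differentiable_of_smooth hg z)]
  ring

lemma dirDeriv_congr {z : SpaceTime} (h : f =ᶠ[𝓝 z] g) (v : SpaceTime) :
    dirDeriv v f =ᶠ[𝓝 z] dirDeriv v g := by
  filter_upwards [h.fderiv (𝕜 := ℝ)] with y hy
  simp [dirDeriv, hy]

lemma integrable_of_smooth (hf : ContDiff ℝ ∞ f) (hf' : HasCompactSupport f) :
    Integrable f := hf.continuous.integrable_of_hasCompactSupport hf'

lemma integrable_mul_of_smooth (hf : ContDiff ℝ ∞ f) (hf' : HasCompactSupport f)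
    (hg : ContDiff ℝ ∞ g) : Integrable (fun z => f z * g z) :=
  (hf.continuous.mul hg.continuous).integrable_of_hasCompactSupport hf'.mul_right

lemma integral_add_add {α : Type*} [MeasurableSpace α] {μ : Measure α} {f g h : α → ℝ}
    (hf : Integrable f μ) (hg : Integrable g μ) (hh : Integrable h μ) :
    ∫ z, (f z + g z + h z) ∂μ = ∫ z, f z ∂μ + ∫ z, g z ∂μ + ∫ z, h z ∂μ := by
  rw [← integral_add hf hg]
  exact integral_add (hf.add hg) hh

lemma integral_dirDeriv_mul (hf : ContDiff ℝ ∞ f) (hf' : HasCompactSupport f)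
    (hg : ContDiff ℝ ∞ g) (v : SpaceTime) :
    ∫ z, dirDeriv v f z * g z = - ∫ z, f z * dirDeriv v g z := by
  have := integral_mul_fderiv_eq_neg_fderiv_mul_of_integrable (μ := (volume : Measure SpaceTime))
    (f := f) (g := g) (v := v)
    (integrable_mul_of_smooth (contDiff_dirDeriv hf v) (hasCompactSupport_dirDeriv hf' v) hg)
    (integrable_mul_of_smooth hf hf' (contDiff_dirDeriv hg v))
    (integrable_mul_of_smooth hf hf' hg)
    (fun x _ => differentiable_of_smooth hf x) (fun x _ => differentiable_of_smooth hg x)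
  simp only [dirDeriv]
  rw [this, neg_neg]

end Calculus

/-- First velocity component generated by the potential `φ`. -/
def vel₁ (φ : SpaceTime → ℝ) : SpaceTime → ℝ :=
  dirDeriv e₂ (dirDeriv e₁ (dirDeriv e₁ φ)) + dirDeriv e₂ (dirDeriv e₂ (dirDeriv e₂ φ))

/-- Second velocity component generated by the potential `φ`. -/
def vel₂ (φ : SpaceTime → ℝ) : SpaceTime → ℝ :=
  (-1 : ℝ) • (dirDeriv e₁ (dirDeriv e₁ (dirDeriv e₁ φ)) +
    dirDeriv e₁ (dirDeriv e₂ (dirDeriv e₂ φ)))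

/-- Diagonal entry of the trace-free stress generated by the potential `φ`. -/
def str₁ (φ : SpaceTime → ℝ) : SpaceTime → ℝ :=
  (-2 : ℝ) • dirDeriv eₜ (dirDeriv e₁ (dirDeriv e₂ φ))

/-- Off-diagonal entry of the trace-free stress generated by the potential `φ`. -/
def str₂ (φ : SpaceTime → ℝ) : SpaceTime → ℝ :=
  dirDeriv eₜ (dirDeriv e₁ (dirDeriv e₁ φ)) - dirDeriv eₜ (dirDeriv e₂ (dirDeriv e₂ φ))

section Potential

variable {φ ψ : SpaceTime → ℝ}

lemma contDiff_third (hφ : ContDiff ℝ ∞ φ) (a b c : SpaceTime) :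
    ContDiff ℝ ∞ (dirDeriv a (dirDeriv b (dirDeriv c φ))) :=
  contDiff_dirDeriv (contDiff_dirDeriv (contDiff_dirDeriv hφ c) b) a

lemma hasCompactSupport_third (hφ : HasCompactSupport φ) (a b c : SpaceTime) :
    HasCompactSupport (dirDeriv a (dirDeriv b (dirDeriv c φ))) :=
  hasCompactSupport_dirDeriv (hasCompactSupport_dirDeriv (hasCompactSupport_dirDeriv hφ c) b) a

lemma third_congr {z : SpaceTime} (h : φ =ᶠ[𝓝 z] ψ) (a b c : SpaceTime) :
    dirDeriv a (dirDeriv b (dirDeriv c φ)) z = dirDeriv a (dirDeriv b (dirDeriv c ψ)) z :=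
  (dirDeriv_congr (dirDeriv_congr (dirDeriv_congr h c) b) a).self_of_nhds

lemma third_add_smul (hφ : ContDiff ℝ ∞ φ) (hψ : ContDiff ℝ ∞ ψ) (c : ℝ) (a b d : SpaceTime) :
    dirDeriv a (dirDeriv b (dirDeriv d (φ + c • ψ))) =
      dirDeriv a (dirDeriv b (dirDeriv d φ)) + c • dirDeriv a (dirDeriv b (dirDeriv d ψ)) := by
  have h1 := contDiff_dirDeriv hφ d
  have h2 := contDiff_dirDeriv hψ d
  have h3 := contDiff_dirDeriv h1 b
  have h4 := contDiff_dirDeriv h2 b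
  rw [dirDeriv_add hφ (contDiff_smul hψ c), dirDeriv_smul hψ,
    dirDeriv_add h1 (contDiff_smul h2 c), dirDeriv_smul h2,
    dirDeriv_add h3 (contDiff_smul h4 c), dirDeriv_smul h4]

lemma contDiff_vel₁ (hφ : ContDiff ℝ ∞ φ) : ContDiff ℝ ∞ (vel₁ φ) :=
  (contDiff_third hφ _ _ _).add (contDiff_third hφ _ _ _)

lemma contDiff_vel₂ (hφ : ContDiff ℝ ∞ φ) : ContDiff ℝ ∞ (vel₂ φ) :=
  contDiff_const.smul ((contDiff_third hφ _ _ _).add (contDiff_third hφ _ _ _))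

lemma contDiff_str₁ (hφ : ContDiff ℝ ∞ φ) : ContDiff ℝ ∞ (str₁ φ) :=
  contDiff_const.smul (contDiff_third hφ _ _ _)

lemma contDiff_str₂ (hφ : ContDiff ℝ ∞ φ) : ContDiff ℝ ∞ (str₂ φ) :=
  (contDiff_third hφ _ _ _).sub (contDiff_third hφ _ _ _)

/-- The four fields generated by a potential. -/
def jet (φ : SpaceTime → ℝ) (z : SpaceTime) : ℝ × ℝ × ℝ × ℝ :=
  (vel₁ φ z, vel₂ φ z, str₁ φ z, str₂ φ z)

lemma continuous_jet (hφ : ContDiff ℝ ∞ φ) : Continuous (jet φ) :=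
  (contDiff_vel₁ hφ).continuous.prodMk ((contDiff_vel₂ hφ).continuous.prodMk
    ((contDiff_str₁ hφ).continuous.prodMk (contDiff_str₂ hφ).continuous))

lemma jet_congr {z : SpaceTime} (h : φ =ᶠ[𝓝 z] ψ) : jet φ z = jet ψ z := by
  simp only [jet, vel₁, vel₂, str₁, str₂, Pi.add_apply, Pi.smul_apply, Pi.sub_apply,
    third_congr h]

lemma jet_eq_zero {z : SpaceTime} (h : z ∉ tsupport φ) : jet φ z = 0 := by
  rw [jet_congr (notMem_tsupport_iff_eventuallyEq.1 h)]
  have : ∀ v, dirDeriv v (0 : SpaceTime → ℝ) = 0 := by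
    intro v; funext y; simp [dirDeriv]
  simp only [jet, vel₁, vel₂, str₁, str₂, this]
  simp

lemma jet_add_smul (hφ : ContDiff ℝ ∞ φ) (hψ : ContDiff ℝ ∞ ψ) (c : ℝ) (z : SpaceTime) :
    jet (φ + c • ψ) z = jet φ z + c • jet ψ z := by
  simp only [jet, vel₁, vel₂, str₁, str₂, third_add_smul hφ hψ, Pi.add_apply, Pi.smul_apply,
    Pi.sub_apply, smul_eq_mul, Prod.smul_mk, Prod.mk_add_mk, Prod.mk.injEq]
  refine ⟨?_, ?_, ?_, ?_⟩ <;> ring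

lemma hasCompactSupport_of_jet {F : SpaceTime → ℝ} (hφ : HasCompactSupport φ)
    (h : ∀ z, jet φ z = 0 → F z = 0) : HasCompactSupport F :=
  HasCompactSupport.intro hφ fun z hz => h z (jet_eq_zero hz)

lemma hasCompactSupport_vel₁ (hφ : HasCompactSupport φ) : HasCompactSupport (vel₁ φ) :=
  hasCompactSupport_of_jet hφ fun _ h => congrArg (fun p => p.1) h

lemma hasCompactSupport_vel₂ (hφ : HasCompactSupport φ) : HasCompactSupport (vel₂ φ) :=
  hasCompactSupport_of_jet hφ fun _ h => congrArg (fun p => p.2.1) h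

lemma hasCompactSupport_str₁ (hφ : HasCompactSupport φ) : HasCompactSupport (str₁ φ) :=
  hasCompactSupport_of_jet hφ fun _ h => congrArg (fun p => p.2.2.1) h

lemma hasCompactSupport_str₂ (hφ : HasCompactSupport φ) : HasCompactSupport (str₂ φ) :=
  hasCompactSupport_of_jet hφ fun _ h => congrArg (fun p => p.2.2.2) h

/-- The velocity is the rotated gradient `(∂₂, -∂₁)` of the spatial Laplacian of `φ`. -/
lemma div_vel_eq_zero (hφ : ContDiff ℝ ∞ φ) (z : SpaceTime) :
    dirDeriv e₁ (vel₁ φ) z + dirDeriv e₂ (vel₂ φ) z = 0 := by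
  have h1 : ∀ v, ContDiff ℝ ∞ (dirDeriv v φ) := contDiff_dirDeriv hφ
  have h2 : ∀ u v, ContDiff ℝ ∞ (dirDeriv u (dirDeriv v φ)) := fun u v => contDiff_dirDeriv (h1 v) u
  have h3 := contDiff_third hφ
  simp only [vel₁, vel₂, dirDeriv_add (h3 _ _ _) (h3 _ _ _),
    dirDeriv_smul (contDiff_add (h3 _ _ _) (h3 _ _ _))]
  rw [dirDeriv_comm (h2 e₁ e₁) e₂ e₁, dirDeriv_comm (h2 e₂ e₂) e₂ e₁]
  simp

/-- The stress solves `div u = -∂ₜ w` algebraically: in `-2∂₁∂₁∂₂ + ∂₂(∂₁² - ∂₂²)` the terms combine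
to `-∂₂(∂₁² + ∂₂²)`. The second component below works in the same way, with `-str₁` as the other
diagonal entry. -/
lemma momentum₁_eq_zero (hφ : ContDiff ℝ ∞ φ) (z : SpaceTime) :
    dirDeriv eₜ (vel₁ φ) z + dirDeriv e₁ (str₁ φ) z + dirDeriv e₂ (str₂ φ) z = 0 := by
  have h1 : ∀ v, ContDiff ℝ ∞ (dirDeriv v φ) := contDiff_dirDeriv hφ
  have h2 : ∀ u v, ContDiff ℝ ∞ (dirDeriv u (dirDeriv v φ)) := fun u v => contDiff_dirDeriv (h1 v) u
  have h3 := contDiff_third hφ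
  simp only [vel₁, str₁, str₂, dirDeriv_add (h3 _ _ _) (h3 _ _ _),
    dirDeriv_sub (h3 _ _ _) (h3 _ _ _), dirDeriv_smul (h3 _ _ _)]
  rw [dirDeriv_comm (h2 e₁ e₂) e₁ eₜ, dirDeriv_comm (h2 e₁ e₁) e₂ eₜ,
    dirDeriv_comm (h2 e₂ e₂) e₂ eₜ, dirDeriv_comm (h1 e₁) e₂ e₁, dirDeriv_comm hφ e₂ e₁]
  simp
  ring

lemma momentum₂_eq_zero (hφ : ContDiff ℝ ∞ φ) (z : SpaceTime) :
    dirDeriv eₜ (vel₂ φ) z + dirDeriv e₁ (str₂ φ) z - dirDeriv e₂ (str₁ φ) z = 0 := by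
  have h1 : ∀ v, ContDiff ℝ ∞ (dirDeriv v φ) := contDiff_dirDeriv hφ
  have h2 : ∀ u v, ContDiff ℝ ∞ (dirDeriv u (dirDeriv v φ)) := fun u v => contDiff_dirDeriv (h1 v) u
  have h3 := contDiff_third hφ
  simp only [vel₂, str₁, str₂, dirDeriv_smul (contDiff_add (h3 _ _ _) (h3 _ _ _)), dirDeriv_smul (h3 _ _ _),
    dirDeriv_add (h3 _ _ _) (h3 _ _ _), dirDeriv_sub (h3 _ _ _) (h3 _ _ _)]
  rw [dirDeriv_comm (h2 e₁ e₁) e₁ eₜ, dirDeriv_comm (h2 e₂ e₂) e₁ eₜ,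
    dirDeriv_comm (h2 e₁ e₂) e₂ eₜ, dirDeriv_comm (h1 e₂) e₂ e₁]
  simp
  ring

lemma integral_vel_mul_grad (hφ : ContDiff ℝ ∞ φ) (hφ' : HasCompactSupport φ)
    (hψ : ContDiff ℝ ∞ ψ) :
    ∫ z, (vel₁ φ z * dirDeriv e₁ ψ z + vel₂ φ z * dirDeriv e₂ ψ z) = 0 := by
  have c1 := contDiff_vel₁ hφ
  have c2 := contDiff_vel₂ hφ
  have s1 := hasCompactSupport_vel₁ hφ'
  have s2 := hasCompactSupport_vel₂ hφ'
  rw [integral_add (integrable_mul_of_smooth c1 s1 (contDiff_dirDeriv hψ _))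
    (integrable_mul_of_smooth c2 s2 (contDiff_dirDeriv hψ _))]
  have i1 := integral_dirDeriv_mul c1 s1 hψ e₁
  have i2 := integral_dirDeriv_mul c2 s2 hψ e₂
  have i3 : ∫ z, (dirDeriv e₁ (vel₁ φ) z * ψ z + dirDeriv e₂ (vel₂ φ) z * ψ z) = 0 := by
    simp_rw [← add_mul, div_vel_eq_zero hφ]
    simp
  rw [integral_add (integrable_mul_of_smooth (contDiff_dirDeriv c1 _)
      (hasCompactSupport_dirDeriv s1 _) hψ)
    (integrable_mul_of_smooth (contDiff_dirDeriv c2 _) (hasCompactSupport_dirDeriv s2 _) hψ)] at i3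
  linarith

lemma integral_momentum_of_eq_zero {f g h : SpaceTime → ℝ}
    (hf : ContDiff ℝ ∞ f) (hg : ContDiff ℝ ∞ g) (hh : ContDiff ℝ ∞ h)
    (hf' : HasCompactSupport f) (hg' : HasCompactSupport g) (hh' : HasCompactSupport h)
    (h0 : ∀ z, dirDeriv eₜ f z + dirDeriv e₁ g z + dirDeriv e₂ h z = 0)
    (hψ : ContDiff ℝ ∞ ψ) :
    ∫ z, (f z * dirDeriv eₜ ψ z + g z * dirDeriv e₁ ψ z + h z * dirDeriv e₂ ψ z) = 0 := by
  have a1 := integrable_mul_of_smooth hf hf' (contDiff_dirDeriv hψ eₜ)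
  have a2 := integrable_mul_of_smooth hg hg' (contDiff_dirDeriv hψ e₁)
  have a3 := integrable_mul_of_smooth hh hh' (contDiff_dirDeriv hψ e₂)
  have b1 := integrable_mul_of_smooth (contDiff_dirDeriv hf eₜ)
    (hasCompactSupport_dirDeriv hf' eₜ) hψ
  have b2 := integrable_mul_of_smooth (contDiff_dirDeriv hg e₁)
    (hasCompactSupport_dirDeriv hg' e₁) hψ
  have b3 := integrable_mul_of_smooth (contDiff_dirDeriv hh e₂)
    (hasCompactSupport_dirDeriv hh' e₂) hψ
  have i1 := integral_dirDeriv_mul hf hf' hψ eₜ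
  have i2 := integral_dirDeriv_mul hg hg' hψ e₁
  have i3 := integral_dirDeriv_mul hh hh' hψ e₂
  have i4 : ∫ z, (dirDeriv eₜ f z * ψ z + dirDeriv e₁ g z * ψ z + dirDeriv e₂ h z * ψ z) = 0 := by
    simp_rw [← add_mul, h0]
    simp
  rw [integral_add_add b1 b2 b3] at i4
  rw [integral_add_add a1 a2 a3]
  linarith

lemma integral_momentum₁ (hφ : ContDiff ℝ ∞ φ) (hφ' : HasCompactSupport φ)
    (hψ : ContDiff ℝ ∞ ψ) :
    ∫ z, (vel₁ φ z * dirDeriv eₜ ψ z + str₁ φ z * dirDeriv e₁ ψ z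
      + str₂ φ z * dirDeriv e₂ ψ z) = 0 :=
  integral_momentum_of_eq_zero (contDiff_vel₁ hφ) (contDiff_str₁ hφ) (contDiff_str₂ hφ)
    (hasCompactSupport_vel₁ hφ') (hasCompactSupport_str₁ hφ') (hasCompactSupport_str₂ hφ')
    (momentum₁_eq_zero hφ) hψ

lemma integral_momentum₂ (hφ : ContDiff ℝ ∞ φ) (hφ' : HasCompactSupport φ)
    (hψ : ContDiff ℝ ∞ ψ) :
    ∫ z, (vel₂ φ z * dirDeriv eₜ ψ z + str₂ φ z * dirDeriv e₁ ψ z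
      + (-str₁ φ z) * dirDeriv e₂ ψ z) = 0 := by
  refine integral_momentum_of_eq_zero (h := fun z => -str₁ φ z) (contDiff_vel₂ hφ)
    (contDiff_str₂ hφ) (contDiff_str₁ hφ).neg
    (hasCompactSupport_vel₂ hφ') (hasCompactSupport_str₂ hφ') (hasCompactSupport_str₁ hφ').neg
    (fun z => ?_) hψ
  have h := momentum₂_eq_zero hφ z
  have : dirDeriv e₂ (fun z => -str₁ φ z) z = - dirDeriv e₂ (str₁ φ) z := by
    simp [dirDeriv, fderiv_fun_neg]
  rw [this]
  linarith

end Potential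

end IsentropicEuler

end

/-! ### Localised plane waves of high frequency, and the Riemann-Lebesgue lemma -/

noncomputable section

namespace IsentropicEuler

section Wave

/-- The product of an amplitude and the sine of a linear phase. -/
def mulSin (l : SpaceTime →L[ℝ] ℝ) (N : ℝ) (a : SpaceTime → ℝ) : SpaceTime → ℝ :=
  a * fun z => Real.sin (N * l z)

/-- The product of an amplitude and the cosine of a linear phase. -/
def mulCos (l : SpaceTime →L[ℝ] ℝ) (N : ℝ) (a : SpaceTime → ℝ) : SpaceTime → ℝ :=
  a * fun z => Real.cos (N * l z)

variable {a χ : SpaceTime → ℝ} (l : SpaceTime →L[ℝ] ℝ) (N : ℝ)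

lemma contDiff_phase : ContDiff ℝ ∞ fun z => N * l z := contDiff_const.mul l.contDiff

lemma contDiff_mulSin (ha : ContDiff ℝ ∞ a) : ContDiff ℝ ∞ (mulSin l N a) :=
  ha.mul (Real.contDiff_sin.comp (contDiff_phase l N))

lemma contDiff_mulCos (ha : ContDiff ℝ ∞ a) : ContDiff ℝ ∞ (mulCos l N a) :=
  ha.mul (Real.contDiff_cos.comp (contDiff_phase l N))

lemma hasFDerivAt_phase (z : SpaceTime) : HasFDerivAt (fun z => N * l z) (N • l) z :=
  l.hasFDerivAt.const_mul N

lemma dirDeriv_mulSin (ha : ContDiff ℝ ∞ a) (v : SpaceTime) :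
    dirDeriv v (mulSin l N a) = mulSin l N (dirDeriv v a) + (N * l v) • mulCos l N a := by
  have hs : ContDiff ℝ ∞ fun z => Real.sin (N * l z) :=
    Real.contDiff_sin.comp (contDiff_phase l N)
  rw [mulSin, dirDeriv_mul ha hs]
  funext z
  have := ((hasFDerivAt_phase l N z).sin).fderiv
  simp only [Pi.add_apply, Pi.mul_apply, Pi.smul_apply, mulSin, mulCos, smul_eq_mul]
  rw [show dirDeriv v (fun z => Real.sin (N * l z)) z = Real.cos (N * l z) * (N * l v) by
    simp only [dirDeriv, this]; simp]
  ring

lemma dirDeriv_mulCos (ha : ContDiff ℝ ∞ a) (v : SpaceTime) :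
    dirDeriv v (mulCos l N a) = mulCos l N (dirDeriv v a) + (-(N * l v)) • mulSin l N a := by
  have hs : ContDiff ℝ ∞ fun z => Real.cos (N * l z) :=
    Real.contDiff_cos.comp (contDiff_phase l N)
  rw [mulCos, dirDeriv_mul ha hs]
  funext z
  have := ((hasFDerivAt_phase l N z).cos).fderiv
  simp only [Pi.add_apply, Pi.mul_apply, Pi.smul_apply, mulSin, mulCos, smul_eq_mul]
  rw [show dirDeriv v (fun z => Real.cos (N * l z)) z = -Real.sin (N * l z) * (N * l v) by
    simp only [dirDeriv, this]; simp]
  ring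

/-- The Leibniz rule sorted by powers of `N`. The only term of order `N ^ 3` is the one in which all
derivatives fall on the phase; the normalisation of `wave` turns it into the main term. -/
lemma third_mulSin (hχ : ContDiff ℝ ∞ χ) (a b c z : SpaceTime) :
    dirDeriv a (dirDeriv b (dirDeriv c (mulSin l N χ))) z =
      (dirDeriv a (dirDeriv b (dirDeriv c χ)) z
        - N ^ 2 * (l a * l b * dirDeriv c χ z + l a * l c * dirDeriv b χ z
          + l b * l c * dirDeriv a χ z)) * Real.sin (N * l z)
      + (N * (l a * dirDeriv b (dirDeriv c χ) z + l b * dirDeriv a (dirDeriv c χ) z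
          + l c * dirDeriv a (dirDeriv b χ) z)
        - N ^ 3 * (l a * l b * l c * χ z)) * Real.cos (N * l z) := by
  have h1 : ∀ v, ContDiff ℝ ∞ (dirDeriv v χ) := contDiff_dirDeriv hχ
  have h2 : ∀ u v, ContDiff ℝ ∞ (dirDeriv u (dirDeriv v χ)) := fun u v => contDiff_dirDeriv (h1 v) u
  have hS : ∀ {f : SpaceTime → ℝ}, ContDiff ℝ ∞ f → ContDiff ℝ ∞ (mulSin l N f) :=
    contDiff_mulSin l N
  have hC : ∀ {f : SpaceTime → ℝ}, ContDiff ℝ ∞ f → ContDiff ℝ ∞ (mulCos l N f) :=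
    contDiff_mulCos l N
  have e : dirDeriv b (dirDeriv c (mulSin l N χ)) =
      (mulSin l N (dirDeriv b (dirDeriv c χ)) + (N * l b) • mulCos l N (dirDeriv c χ)) +
      (N * l c) • (mulCos l N (dirDeriv b χ) + (-(N * l b)) • mulSin l N χ) := by
    rw [dirDeriv_mulSin l N hχ, dirDeriv_add (hS (h1 _)) (contDiff_smul (hC hχ) _),
      dirDeriv_smul (hC hχ), dirDeriv_mulSin l N (h1 c), dirDeriv_mulCos l N hχ]
  have s1 := contDiff_smul (hC (h1 c)) (N * l b)
  have s2 := contDiff_smul (hS hχ) (-(N * l b))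
  rw [e, dirDeriv_add (contDiff_add (hS (h2 _ _)) s1)
      (contDiff_smul (contDiff_add (hC (h1 _)) s2) _), dirDeriv_add (hS (h2 _ _)) s1,
    dirDeriv_smul (hC (h1 c)), dirDeriv_smul (contDiff_add (hC (h1 _)) s2),
    dirDeriv_add (hC (h1 _)) s2, dirDeriv_smul (hS hχ), dirDeriv_mulSin l N (h2 b c),
    dirDeriv_mulCos l N (h1 c), dirDeriv_mulCos l N (h1 b), dirDeriv_mulSin l N hχ]
  simp only [Pi.add_apply, Pi.smul_apply, smul_eq_mul, mulSin, mulCos, Pi.mul_apply]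
  ring

/-- The potential of a localised plane wave of frequency `N`. -/
def wave (l : SpaceTime →L[ℝ] ℝ) (χ : SpaceTime → ℝ) (N : ℝ) : SpaceTime → ℝ :=
  (-(N ^ 3)⁻¹) • mulSin l N χ

lemma contDiff_wave (hχ : ContDiff ℝ ∞ χ) : ContDiff ℝ ∞ (wave l χ N) :=
  contDiff_smul (contDiff_mulSin l N hχ) _

lemma tsupport_wave_subset : tsupport (wave l χ N) ⊆ tsupport χ := by
  refine closure_mono fun z hz => ?_
  contrapose! hz
  have : χ z = 0 := by simpa using hz
  simp [wave, mulSin, this]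

lemma exists_bound_of_smooth (hχ : ContDiff ℝ ∞ χ) (hχ' : HasCompactSupport χ) :
    ∃ B, ∀ z, |χ z| ≤ B := hχ'.exists_bound_of_continuous hχ.continuous

/-- Every derivative that falls on the cutoff instead of the phase costs a factor `N`, and the
derivatives of the cutoff are bounded. The error is thus `O(1/N)` uniformly in space-time. -/
lemma exists_bound_third_wave (hχ : ContDiff ℝ ∞ χ) (hχ' : HasCompactSupport χ)
    (a b c : SpaceTime) :
    ∃ K, ∀ N : ℝ, 1 ≤ N → ∀ z,
      |dirDeriv a (dirDeriv b (dirDeriv c (wave l χ N))) z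
        - l a * l b * l c * (χ z * Real.cos (N * l z))| ≤ K / N := by
  have h1 : ∀ v, ContDiff ℝ ∞ (dirDeriv v χ) := contDiff_dirDeriv hχ
  have h1' : ∀ v, HasCompactSupport (dirDeriv v χ) := hasCompactSupport_dirDeriv hχ'
  obtain ⟨B₁, hB₁⟩ := exists_bound_of_smooth
    (χ := (l a * l b) • dirDeriv c χ + (l a * l c) • dirDeriv b χ + (l b * l c) • dirDeriv a χ)
    (contDiff_add (contDiff_add (contDiff_smul (h1 c) _) (contDiff_smul (h1 b) _))
      (contDiff_smul (h1 a) _))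
    (((h1' c).smul_left.add (h1' b).smul_left).add (h1' a).smul_left)
  have h2 : ∀ u v, ContDiff ℝ ∞ (dirDeriv u (dirDeriv v χ)) := fun u v => contDiff_dirDeriv (h1 v) u
  have h2' : ∀ u v, HasCompactSupport (dirDeriv u (dirDeriv v χ)) :=
    fun u v => hasCompactSupport_dirDeriv (h1' v) u
  obtain ⟨B₂, hB₂⟩ := exists_bound_of_smooth
    (χ := l a • dirDeriv b (dirDeriv c χ) + l b • dirDeriv a (dirDeriv c χ)
      + l c • dirDeriv a (dirDeriv b χ))
    (contDiff_add (contDiff_add (contDiff_smul (h2 _ _) _) (contDiff_smul (h2 _ _) _))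
      (contDiff_smul (h2 _ _) _))
    (((h2' _ _).smul_left.add (h2' _ _).smul_left).add (h2' _ _).smul_left)
  obtain ⟨B₃, hB₃⟩ := exists_bound_of_smooth (contDiff_third hχ a b c)
    (hasCompactSupport_third hχ' a b c)
  refine ⟨B₁ + B₂ + B₃, fun N hN z => ?_⟩
  have hS := contDiff_mulSin l N hχ
  have hN0 : 0 < N := by linarith
  rw [wave, dirDeriv_smul hS, dirDeriv_smul (contDiff_dirDeriv hS _),
    dirDeriv_smul (contDiff_dirDeriv (contDiff_dirDeriv hS _) _), Pi.smul_apply,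
    third_mulSin l N hχ, smul_eq_mul]
  set X := dirDeriv a (dirDeriv b (dirDeriv c χ)) z
  have k1 := hB₁ z
  have k2 := hB₂ z
  have k3 := hB₃ z
  simp only [Pi.add_apply, Pi.smul_apply, smul_eq_mul] at k1 k2
  set Y := l a * l b * dirDeriv c χ z + l a * l c * dirDeriv b χ z + l b * l c * dirDeriv a χ z
  set W := l a * dirDeriv b (dirDeriv c χ) z + l b * dirDeriv a (dirDeriv c χ) z
    + l c * dirDeriv a (dirDeriv b χ) z
  have e : -(N ^ 3)⁻¹ * ((X - N ^ 2 * Y) * Real.sin (N * l z)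
      + (N * W - N ^ 3 * (l a * l b * l c * χ z)) * Real.cos (N * l z))
      - l a * l b * l c * (χ z * Real.cos (N * l z))
      = (Y * Real.sin (N * l z) - W * Real.cos (N * l z) * N⁻¹
        - X * Real.sin (N * l z) * (N⁻¹ * N⁻¹)) / N := by
    field_simp
    ring
  rw [e, abs_div, abs_of_pos hN0]
  gcongr
  have hi : N⁻¹ ≤ 1 := inv_le_one_of_one_le₀ hN
  have hi0 : 0 ≤ N⁻¹ := by positivity
  have s1 := Real.abs_sin_le_one (N * l z)
  have s2 := Real.abs_cos_le_one (N * l z)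
  have t1 : |Y * Real.sin (N * l z)| ≤ B₁ := by
    rw [abs_mul]; exact (mul_le_of_le_one_right (abs_nonneg _) s1).trans k1
  have t2 : |W * Real.cos (N * l z) * N⁻¹| ≤ B₂ := by
    rw [abs_mul, abs_mul, abs_of_nonneg hi0]
    exact (mul_le_of_le_one_right (by positivity) hi).trans
      ((mul_le_of_le_one_right (abs_nonneg _) s2).trans k2)
  have t3 : |X * Real.sin (N * l z) * (N⁻¹ * N⁻¹)| ≤ B₃ := by
    rw [abs_mul, abs_mul, abs_of_nonneg (mul_nonneg hi0 hi0)]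
    exact (mul_le_of_le_one_right (by positivity) (mul_le_one₀ hi hi0 hi)).trans
      ((mul_le_of_le_one_right (abs_nonneg _) s1).trans k3)
  calc _ ≤ |Y * Real.sin (N * l z)| + |W * Real.cos (N * l z) * N⁻¹|
        + |X * Real.sin (N * l z) * (N⁻¹ * N⁻¹)| :=
        (abs_sub _ _).trans (add_le_add_left (abs_sub _ _) _)
    _ ≤ _ := by linarith

/-- The linear phase with wave vector `(k₁, k₂)` and temporal frequency `τ`. -/
def phase (k₁ k₂ τ : ℝ) : SpaceTime →L[ℝ] ℝ :=
  k₁ • ((EuclideanSpace.proj (0 : Fin 2)).comp (ContinuousLinearMap.fst ℝ Plane ℝ)) +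
  k₂ • ((EuclideanSpace.proj (1 : Fin 2)).comp (ContinuousLinearMap.fst ℝ Plane ℝ)) +
  τ • ContinuousLinearMap.snd ℝ Plane ℝ

lemma phase_e₁ (k₁ k₂ τ : ℝ) : phase k₁ k₂ τ e₁ = k₁ := by simp [phase, e₁]
lemma phase_e₂ (k₁ k₂ τ : ℝ) : phase k₁ k₂ τ e₂ = k₂ := by simp [phase, e₂]
lemma phase_eₜ (k₁ k₂ τ : ℝ) : phase k₁ k₂ τ eₜ = τ := by simp [phase, eₜ]

/-- The direction in state space of a plane wave with wave vector `(k₁, k₂)` of unit length and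
temporal frequency `τ`. -/
def waveDir (k₁ k₂ τ : ℝ) : ℝ × ℝ × ℝ × ℝ :=
  (k₂, -k₁, -2 * τ * k₁ * k₂, τ * (k₁ ^ 2 - k₂ ^ 2))

/-- Each field is a combination of third derivatives, so its main term is the symbol evaluated at
`(k₁, k₂, τ)`. The Laplacian contributes the factor `k₁² + k₂² = 1`. -/
lemma exists_bound_jet_wave (hχ : ContDiff ℝ ∞ χ) (hχ' : HasCompactSupport χ) {k₁ k₂ : ℝ}
    (hk : k₁ ^ 2 + k₂ ^ 2 = 1) (τ : ℝ) :
    ∃ K, 0 ≤ K ∧ ∀ N : ℝ, 1 ≤ N → ∀ z,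
      ‖jet (wave (phase k₁ k₂ τ) χ N) z
        - (χ z * Real.cos (N * phase k₁ k₂ τ z)) • waveDir k₁ k₂ τ‖ ≤ K / N := by
  choose K hK using exists_bound_third_wave (phase k₁ k₂ τ) hχ hχ'
  have hK0 : ∀ a b c, 0 ≤ K a b c := fun a b c => by
    have := (abs_nonneg _).trans (hK a b c 1 le_rfl 0)
    simpa using this
  refine ⟨K e₂ e₁ e₁ + K e₂ e₂ e₂ + (K e₁ e₁ e₁ + K e₁ e₂ e₂) + 2 * K eₜ e₁ e₂
    + (K eₜ e₁ e₁ + K eₜ e₂ e₂), ?_, fun N hN z => ?_⟩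
  · have := hK0 e₂ e₁ e₁; have := hK0 e₂ e₂ e₂; have := hK0 e₁ e₁ e₁; have := hK0 e₁ e₂ e₂
    have := hK0 eₜ e₁ e₂; have := hK0 eₜ e₁ e₁; have := hK0 eₜ e₂ e₂
    linarith
  have hN0 : 0 < N := by linarith
  have hp : ∀ a b c, 0 ≤ K a b c / N := fun a b c => div_nonneg (hK0 a b c) hN0.le
  have h := fun a b c => hK a b c N hN z
  set w := wave (phase k₁ k₂ τ) χ N
  set m := χ z * Real.cos (N * phase k₁ k₂ τ z)
  have p1 := hp e₂ e₁ e₁; have p2 := hp e₂ e₂ e₂; have p3 := hp e₁ e₁ e₁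
  have p4 := hp e₁ e₂ e₂; have p5 := hp eₜ e₁ e₂; have p6 := hp eₜ e₁ e₁; have p7 := hp eₜ e₂ e₂
  have q1 := abs_le.1 (h e₂ e₁ e₁); have q2 := abs_le.1 (h e₂ e₂ e₂)
  have q3 := abs_le.1 (h e₁ e₁ e₁); have q4 := abs_le.1 (h e₁ e₂ e₂)
  have q5 := abs_le.1 (h eₜ e₁ e₂); have q6 := abs_le.1 (h eₜ e₁ e₁)
  have q7 := abs_le.1 (h eₜ e₂ e₂)
  simp only [phase_e₁, phase_e₂, phase_eₜ] at q1 q2 q3 q4 q5 q6 q7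
  have r1 : m * k₂ = k₂ * k₁ * k₁ * m + k₂ * k₂ * k₂ * m := by
    linear_combination -(m * k₂) * hk
  have r2 : m * k₁ = k₁ * k₁ * k₁ * m + k₁ * k₂ * k₂ * m := by
    linear_combination -(m * k₁) * hk
  simp only [add_div, mul_div_assoc]
  rw [Prod.norm_def, Prod.norm_def, Prod.norm_def]
  simp only [jet, waveDir, Prod.smul_mk, Prod.mk_sub_mk, smul_eq_mul, Real.norm_eq_abs, vel₁, vel₂,
    str₁, str₂, Pi.add_apply, Pi.smul_apply, Pi.sub_apply]
  refine max_le ?_ (max_le ?_ (max_le ?_ ?_)) <;> rw [abs_le]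
  · clear q3 q4 q5 q6 q7; constructor <;> linarith
  · clear q1 q2 q5 q6 q7; constructor <;> linarith
  · clear q1 q2 q3 q4 q6 q7; constructor <;> linarith
  · clear q1 q2 q3 q4 q5; constructor <;> linarith

end Wave

section RiemannLebesgue

/-- Riemann-Lebesgue along the ray `N • l` in the dual space, real part. The Fourier transform
carries a factor `2π`, whence the frequency `N / (2π)` in the proof. -/
lemma tendsto_integral_mul_cos {g : SpaceTime → ℝ} (hg : Integrable g)
    {l : SpaceTime →L[ℝ] ℝ} (hl : l ≠ 0) :
    Tendsto (fun N : ℝ => ∫ z, g z * Real.cos (N * l z)) atTop (𝓝 0) := by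
  have h := tendsto_integral_exp_smul_cocompact (V := SpaceTime) (E := ℂ)
    (fun z => (g z : ℂ)) volume
  have hc : Tendsto (fun N : ℝ => (N / (2 * Real.pi)) • l) atTop
      (cocompact (StrongDual ℝ SpaceTime)) := by
    rw [← Metric.cobounded_eq_cocompact, ← tendsto_norm_atTop_iff_cobounded]
    have : (fun N : ℝ => ‖(N / (2 * Real.pi)) • l‖) = fun N => |N| * (‖l‖ / (2 * Real.pi)) := by
      funext N
      rw [norm_smul, Real.norm_eq_abs, abs_div, abs_of_pos Real.two_pi_pos]
      ring
    rw [this]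
    exact tendsto_abs_atTop_atTop.atTop_mul_const
      (div_pos (norm_pos_iff.2 hl) Real.two_pi_pos)
  have h2 := (Complex.continuous_re.tendsto 0).comp (h.comp hc)
  refine (h2.congr fun N => ?_)
  simp only [Function.comp]
  have key : ∀ z, Real.fourierChar (-((N / (2 * Real.pi)) • l) z) • (g z : ℂ)
      = Complex.exp (-(N * l z : ℝ) * Complex.I) * g z := by
    intro z
    rw [Circle.smul_def, Real.fourierChar_apply, smul_eq_mul]
    congr 3
    simp only [smul_apply, smul_eq_mul]
    push_cast
    field_simp
  have hc : Continuous fun z : SpaceTime => Complex.exp (-(N * l z : ℝ) * Complex.I) := by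
    fun_prop
  have hint : Integrable (fun z => Complex.exp (-(N * l z : ℝ) * Complex.I) * (g z : ℂ)) := by
    refine hg.ofReal.bdd_mul (c := 1) hc.aestronglyMeasurable (ae_of_all _ fun z => ?_)
    rw [← Complex.ofReal_neg, Complex.norm_exp_ofReal_mul_I]
  simp_rw [key]
  rw [← Complex.reCLM_apply, ← Complex.reCLM.integral_comp_comm hint]
  refine integral_congr_ae (ae_of_all _ fun z => ?_)
  simp only [Complex.reCLM_apply]
  rw [← Complex.ofReal_neg, Complex.re_mul_ofReal, Complex.exp_ofReal_mul_I_re, Real.cos_neg,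
    mul_comm]

end RiemannLebesgue

end IsentropicEuler

end

/-! ### The set of strict subsolution states and its wave segments -/

noncomputable section

namespace IsentropicEuler

/-- The energy defect `tr A - |w|²` of a state `(w, u)`, where `A = diag(a₁, a₂)`. -/
def defect (a₁ a₂ : ℝ) (p : ℝ × ℝ × ℝ × ℝ) : ℝ := a₁ + a₂ - p.1 ^ 2 - p.2.1 ^ 2

/-- The determinant of `A - w ⊗ w + u`, where `A = diag(a₁, a₂)`. -/
def defectDet (a₁ a₂ : ℝ) (p : ℝ × ℝ × ℝ × ℝ) : ℝ :=
  (a₁ - p.1 ^ 2 + p.2.2.1) * (a₂ - p.2.1 ^ 2 - p.2.2.1) - (p.2.2.2 - p.1 * p.2.1) ^ 2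

/-- The strict subsolution states: `A - w ⊗ w + u` is positive definite. -/
def subsolutionSet (a₁ a₂ : ℝ) : Set (ℝ × ℝ × ℝ × ℝ) :=
  {p | 0 < defect a₁ a₂ p ∧ 0 < defectDet a₁ a₂ p}

variable {a₁ a₂ : ℝ} {p : ℝ × ℝ × ℝ × ℝ}

lemma continuous_defect : Continuous (defect a₁ a₂) := by
  unfold defect; fun_prop

lemma isOpen_subsolutionSet : IsOpen (subsolutionSet a₁ a₂) := by
  have h2 : Continuous (defectDet a₁ a₂) := by unfold defectDet; fun_prop
  exact (isOpen_lt continuous_const continuous_defect).inter (isOpen_lt continuous_const h2)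

lemma zero_mem_subsolutionSet (h₁ : 0 < a₁) (h₂ : 0 < a₂) : 0 ∈ subsolutionSet a₁ a₂ := by
  constructor
  · simp only [defect, Prod.fst_zero, Prod.snd_zero]; linarith
  · simp only [defectDet, Prod.fst_zero, Prod.snd_zero]; nlinarith [mul_pos h₁ h₂]

lemma diag_pos_of_mem (hp : p ∈ subsolutionSet a₁ a₂) :
    0 < a₁ - p.1 ^ 2 + p.2.2.1 ∧ 0 < a₂ - p.2.1 ^ 2 - p.2.2.1 := by
  obtain ⟨h1, h2⟩ := hp
  simp only [defect, defectDet] at h1 h2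
  set A := a₁ - p.1 ^ 2 + p.2.2.1
  set B := a₂ - p.2.1 ^ 2 - p.2.2.1
  have hs : 0 < A + B := by simp only [A, B]; linarith
  have hAB : 0 < A * B := by nlinarith [sq_nonneg (p.2.2.2 - p.1 * p.2.1)]
  constructor
  · by_contra h
    nlinarith [mul_nonneg_of_nonpos_of_nonpos (not_lt.1 h) (not_lt.1 h)]
  · by_contra h
    nlinarith [mul_nonneg_of_nonpos_of_nonpos (not_lt.1 h) (not_lt.1 h)]

/-- For the matrix `M` with diagonal `A`, `B` and off-diagonal `C`, take `(k₂, -k₁)` parallel to `M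
e₁ = (A, C)`. Then the quadratic form in the conclusion is `det M` times `A / (A² + C²) ≤ 1 / A`. -/
lemma exists_unit_of_posDef {A B C : ℝ} (hA : 0 < A) (hdet : 0 < A * B - C ^ 2) :
    ∃ k₁ k₂ : ℝ, k₁ ^ 2 + k₂ ^ 2 = 1 ∧
      ∀ q < A, q * (A * k₁ ^ 2 + 2 * C * k₁ * k₂ + B * k₂ ^ 2) < A * B - C ^ 2 := by
  set n := Real.sqrt (A ^ 2 + C ^ 2)
  have hn2 : n ^ 2 = A ^ 2 + C ^ 2 := Real.sq_sqrt (by positivity)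
  have hn : 0 < n := Real.sqrt_pos.2 (by positivity)
  refine ⟨-C / n, A / n, ?_, fun q hq => ?_⟩
  · field_simp; linarith
  have e : A * (-C / n) ^ 2 + 2 * C * (-C / n) * (A / n) + B * (A / n) ^ 2
      = A * (A * B - C ^ 2) / n ^ 2 := by
    field_simp; ring
  rw [e]
  have hn2' : 0 < n ^ 2 := by positivity
  rw [← mul_div_assoc, div_lt_iff₀ hn2', hn2]
  have : q * A < A ^ 2 + C ^ 2 := by nlinarith [sq_nonneg C]
  nlinarith

/-- From every strict subsolution state there is a segment in a wave direction, of length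
proportional to the energy defect, along which the state stays a strict subsolution. -/
lemma exists_waveDir {κ : ℝ} (hκ : 0 < κ) (hκ2 : κ ^ 2 = a₁ + a₂)
    (hp : p ∈ subsolutionSet a₁ a₂) :
    ∃ k₁ k₂ τ : ℝ, k₁ ^ 2 + k₂ ^ 2 = 1 ∧ ∀ s ∈ Icc (-1 : ℝ) 1,
      p + (s * (defect a₁ a₂ p / (8 * κ))) • waveDir k₁ k₂ τ ∈ subsolutionSet a₁ a₂ := by
  obtain ⟨hA, hB⟩ := diag_pos_of_mem hp
  obtain ⟨hd, hdet⟩ := hp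
  set d := defect a₁ a₂ p with hd_def
  obtain ⟨x, y, a, b⟩ := p
  simp only [defect, defectDet] at hd_def hdet hA hB
  set A := a₁ - x ^ 2 + a with hAd
  set B := a₂ - y ^ 2 - a with hBd
  set C := b - x * y with hCd
  have hAB : A + B = d := by rw [hd_def, hAd, hBd]; ring
  -- The larger diagonal entry is at least half of the trace `d`. If it is the second one, the roles
  -- of the coordinates are exchanged.
  obtain ⟨k₁, k₂, hk, hq⟩ : ∃ k₁ k₂ : ℝ, k₁ ^ 2 + k₂ ^ 2 = 1 ∧
      ∀ q < d / 2, q * (A * k₁ ^ 2 + 2 * C * k₁ * k₂ + B * k₂ ^ 2) < A * B - C ^ 2 := by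
    rcases le_total B A with h | h
    · obtain ⟨k₁, k₂, hk, hq⟩ := exists_unit_of_posDef hA hdet
      exact ⟨k₁, k₂, hk, fun q hq' => hq q (by linarith)⟩
    · obtain ⟨k₁, k₂, hk, hq⟩ := exists_unit_of_posDef (A := B) (B := A) (C := C) hB (by linarith)
      refine ⟨k₂, k₁, by linarith, fun q hq' => ?_⟩
      have := hq q (by linarith)
      nlinarith
  -- The frequency `τ = -(w · k)` makes the terms linear in the amplitude collapse: along the
  -- segment, `A - w ⊗ w + u` changes only by the rank-one matrix `-q (k₂, -k₁) ⊗ (k₂, -k₁)`, with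
  -- `q = t² + 2t(x k₂ - y k₁)`.
  refine ⟨k₁, k₂, -(x * k₁ + y * k₂), hk, fun s hs => ?_⟩
  set t := s * (d / (8 * κ)) with ht
  have hdκ : d ≤ κ ^ 2 := by rw [hκ2, hd_def]; nlinarith [sq_nonneg x, sq_nonneg y]
  have htabs : |t| ≤ d / (8 * κ) := by
    rw [ht, abs_mul, abs_of_pos (by positivity : 0 < d / (8 * κ))]
    exact mul_le_of_le_one_left (by positivity) (abs_le.2 hs)
  have hc : |x * k₂ - y * k₁| ≤ κ := by
    apply abs_le_of_sq_le_sq _ hκ.le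
    have : (x * k₂ - y * k₁) ^ 2 = (x ^ 2 + y ^ 2) - (x * k₁ + y * k₂) ^ 2 := by
      linear_combination (x ^ 2 + y ^ 2) * hk
    nlinarith [sq_nonneg (x * k₁ + y * k₂)]
  -- Since `d ≤ κ²` and the velocity is bounded by `κ`, the amplitude `d / (8κ)` gives at most
  -- `d/64` for the square and `d/4` for the linear term, together less than the threshold `d/2`.
  have hqlt : t ^ 2 + 2 * t * (x * k₂ - y * k₁) < d / 2 := by
    have h1 : t ^ 2 ≤ d / 64 := by
      rw [← sq_abs]
      calc |t| ^ 2 ≤ (d / (8 * κ)) ^ 2 := by gcongr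
        _ = d * (d / κ ^ 2) / 64 := by field_simp; norm_num
        _ ≤ d * 1 / 64 := by
          gcongr
          rw [div_le_one (by positivity)]; exact hdκ
        _ = d / 64 := by ring
    have h2 : t * (x * k₂ - y * k₁) ≤ d / 8 := by
      calc t * (x * k₂ - y * k₁) ≤ |t| * |x * k₂ - y * k₁| := by
            rw [← abs_mul]; exact le_abs_self _
        _ ≤ d / (8 * κ) * κ := by gcongr
        _ = d / 8 := by field_simp
    linarith
  set q := t ^ 2 + 2 * t * (x * k₂ - y * k₁) with hqd
  have hk1 : k₁ ^ 2 = 1 - k₂ ^ 2 := by linarith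
  constructor
  · simp only [defect, waveDir, Prod.smul_mk, Prod.mk_add_mk, smul_eq_mul]
    have : a₁ + a₂ - (x + t * k₂) ^ 2 - (y + t * -k₁) ^ 2 = d - q := by
      rw [hd_def, hqd]
      linear_combination -(t ^ 2) * hk
    rw [this]; linarith
  · simp only [defectDet, waveDir, Prod.smul_mk, Prod.mk_add_mk, smul_eq_mul]
    have e1 : a₁ - (x + t * k₂) ^ 2 + (a + t * (-2 * -(x * k₁ + y * k₂) * k₁ * k₂))
        = A - q * k₂ ^ 2 := by
      rw [hAd, hqd]
      linear_combination (2 * t * x * k₂) * hk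
    have e2 : a₂ - (y + t * -k₁) ^ 2 - (a + t * (-2 * -(x * k₁ + y * k₂) * k₁ * k₂))
        = B - q * k₁ ^ 2 := by
      rw [hBd, hqd]
      linear_combination (-2 * t * y * k₁) * hk
    have e3 : b + t * (-(x * k₁ + y * k₂) * (k₁ ^ 2 - k₂ ^ 2)) - (x + t * k₂) * (y + t * -k₁)
        = C + q * (k₁ * k₂) := by
      rw [hCd, hqd]
      linear_combination (-t * x * k₁ + t * y * k₂) * hk
    -- The new determinant is the old one minus `q` times the quadratic form controlled by `hq`; the
    -- terms in `q²` cancel because the perturbation has rank one.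
    rw [e1, e2, e3]
    have := hq q hqlt
    nlinarith

/-- A quantitative version of `exists_waveDir`. -/
lemma exists_waveDir_thickening {κ : ℝ} (hκ : 0 < κ) (hκ2 : κ ^ 2 = a₁ + a₂)
    (hp : p ∈ subsolutionSet a₁ a₂) :
    ∃ k₁ k₂ τ η : ℝ, k₁ ^ 2 + k₂ ^ 2 = 1 ∧ 0 < η ∧ ∀ s ∈ Icc (-1 : ℝ) 1, ∀ q,
      ‖q - (p + (s * (defect a₁ a₂ p / (8 * κ))) • waveDir k₁ k₂ τ)‖ < η →
        q ∈ subsolutionSet a₁ a₂ := by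
  obtain ⟨k₁, k₂, τ, hk, h⟩ := exists_waveDir hκ hκ2 hp
  have hcomp : IsCompact ((fun s : ℝ => p + (s * (defect a₁ a₂ p / (8 * κ))) • waveDir k₁ k₂ τ) ''
      Icc (-1 : ℝ) 1) := isCompact_Icc.image (by fun_prop)
  obtain ⟨η, hη, hsub⟩ := hcomp.exists_thickening_subset_open
    (isOpen_subsolutionSet (a₁ := a₁) (a₂ := a₂)) (by rintro _ ⟨s, hs, rfl⟩; exact h s hs)
  refine ⟨k₁, k₂, τ, η, hk, hη, fun s hs q hq => hsub ?_⟩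
  rw [Metric.mem_thickening_iff]
  exact ⟨_, ⟨s, hs, rfl⟩, by rwa [dist_eq_norm]⟩

end IsentropicEuler

end

/-! ### Subsolutions, and how integral quantities react to a wave -/

noncomputable section

namespace IsentropicEuler

/-- Potentials of smooth strict subsolutions with compact support in `Ω`. -/
structure IsSubsolution (a₁ a₂ : ℝ) (Ω : Set SpaceTime) (φ : SpaceTime → ℝ) : Prop where
  smooth : ContDiff ℝ ∞ φ
  compact : HasCompactSupport φ
  support : tsupport φ ⊆ Ω
  mem : ∀ z, jet φ z ∈ subsolutionSet a₁ a₂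

/-- The weighted total energy defect. -/
def defectIntegral (a₁ a₂ : ℝ) (wt : SpaceTime → ℝ) (φ : SpaceTime → ℝ) : ℝ :=
  ∫ z, defect a₁ a₂ (jet φ z) * wt z

/-- The weighted `L²` pairing of a velocity field with the velocity generated by a potential. -/
def pairing (wt : SpaceTime → ℝ) (φ : SpaceTime → ℝ) (g : SpaceTime → ℝ × ℝ) : ℝ :=
  ∫ z, (vel₁ φ z * ((g z).1 * wt z) + vel₂ φ z * ((g z).2 * wt z))

/-- Bounded measurable planar fields. -/
def IsBddField (g : SpaceTime → ℝ × ℝ) : Prop := Measurable g ∧ ∃ M, ∀ z, ‖g z‖ ≤ M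

section Perturbation

variable {wt : SpaceTime → ℝ} {φ ψ : SpaceTime → ℝ} {a₁ a₂ : ℝ}

lemma integrable_mul_of_bounded {α : Type*} [MeasurableSpace α] {μ : Measure α} {f h : α → ℝ}
    (hh : Integrable h μ)
    (hf : AEStronglyMeasurable f μ) {B : ℝ} (hB : ∀ z, |f z| ≤ B) :
    Integrable (fun z => f z * h z) μ :=
  hh.bdd_mul hf (ae_of_all _ hB)

lemma integrable_smooth_mul {f h : SpaceTime → ℝ} (hh : Integrable h)
    (hf : ContDiff ℝ ∞ f) (hf' : HasCompactSupport f) : Integrable (fun z => f z * h z) := by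
  obtain ⟨B, hB⟩ := exists_bound_of_smooth hf hf'
  exact integrable_mul_of_bounded hh hf.continuous.aestronglyMeasurable hB

lemma IsBddField.integrable_fst {g : SpaceTime → ℝ × ℝ} (hg : IsBddField g) (hw : Integrable wt) :
    Integrable (fun z => (g z).1 * wt z) := by
  obtain ⟨hm, M, hM⟩ := hg
  exact integrable_mul_of_bounded hw hm.fst.aestronglyMeasurable
    (fun z => (norm_fst_le (g z)).trans (hM z))

lemma IsBddField.integrable_snd {g : SpaceTime → ℝ × ℝ} (hg : IsBddField g) (hw : Integrable wt) :
    Integrable (fun z => (g z).2 * wt z) := by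
  obtain ⟨hm, M, hM⟩ := hg
  exact integrable_mul_of_bounded hw hm.snd.aestronglyMeasurable
    (fun z => (norm_snd_le (g z)).trans (hM z))

lemma tendsto_integral_of_close {f m : ℝ → SpaceTime → ℝ} {h : SpaceTime → ℝ} {K L : ℝ}
    (hh : Integrable h) (hf : ∀ N, Integrable fun z => f N z * h z)
    (hm : ∀ N, Integrable fun z => m N z * h z)
    (hclose : ∀ N, 1 ≤ N → ∀ z, |f N z - m N z| ≤ K / N)
    (hL : Tendsto (fun N => ∫ z, m N z * h z) atTop (𝓝 L)) :
    Tendsto (fun N => ∫ z, f N z * h z) atTop (𝓝 L) := by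
  have hdiff : Tendsto (fun N => (∫ z, f N z * h z) - ∫ z, m N z * h z) atTop (𝓝 0) := by
    have hb : Tendsto (fun N : ℝ => K / N * ∫ z, |h z|) atTop (𝓝 0) := by
      simpa using (tendsto_const_nhds.div_atTop tendsto_id).mul_const (∫ z, |h z|)
    refine squeeze_zero_norm' ?_ hb
    filter_upwards [eventually_ge_atTop 1] with N hN
    rw [← integral_sub (hf N) (hm N), ← integral_const_mul]
    refine norm_integral_le_of_norm_le (hh.abs.const_mul _) (ae_of_all _ fun z => ?_)
    rw [← sub_mul, norm_mul]
    exact mul_le_mul_of_nonneg_right (hclose N hN z) (norm_nonneg _)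
  simpa using hdiff.add hL

/-- By `cos² = (1 + cos 2·)/2`, the oscillating half vanishes by Riemann-Lebesgue. The surviving
mean `1/2` is the gain of energy in convex integration. -/
lemma tendsto_integral_sq_mul_cos_sq {h : SpaceTime → ℝ} (hh : Integrable h)
    {l : SpaceTime →L[ℝ] ℝ} (hl : l ≠ 0) :
    Tendsto (fun N : ℝ => ∫ z, h z * Real.cos (N * l z) ^ 2) atTop (𝓝 ((∫ z, h z) / 2)) := by
  have h1 := ((tendsto_integral_mul_cos hh hl).comp
    (tendsto_id.const_mul_atTop (two_pos : (0 : ℝ) < 2))).const_add (∫ z, h z)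
  have h2 := h1.div_const 2
  rw [add_zero] at h2
  refine h2.congr fun N => ?_
  simp only [Function.comp, id]
  have hi : Integrable fun z => h z * Real.cos (2 * N * l z) := by
    refine (integrable_mul_of_bounded hh (f := fun z => Real.cos (2 * N * l z)) (B := 1)
      (by fun_prop) (fun z => Real.abs_cos_le_one _)).congr (ae_of_all _ fun z => mul_comm _ _)
  rw [← integral_add hh hi, ← integral_div]
  refine integral_congr_ae (ae_of_all _ fun z => ?_)
  simp only
  rw [mul_assoc 2 N, Real.cos_two_mul]
  ring

lemma pairing_add_smul (hφ : ContDiff ℝ ∞ φ) (hφ' : HasCompactSupport φ)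
    (hψ : ContDiff ℝ ∞ ψ) (hψ' : HasCompactSupport ψ) (hw : Integrable wt)
    {g : SpaceTime → ℝ × ℝ} (hg : IsBddField g) (c : ℝ) :
    pairing wt (φ + c • ψ) g - pairing wt φ g =
      c * ((∫ z, vel₁ ψ z * ((g z).1 * wt z)) + ∫ z, vel₂ ψ z * ((g z).2 * wt z)) := by
  have i1 := hg.integrable_fst hw
  have i2 := hg.integrable_snd hw
  have j1 := integrable_smooth_mul i1 (contDiff_vel₁ hφ) (hasCompactSupport_vel₁ hφ')
  have j2 := integrable_smooth_mul i2 (contDiff_vel₂ hφ) (hasCompactSupport_vel₂ hφ')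
  have j3 := integrable_smooth_mul i1 (contDiff_vel₁ hψ) (hasCompactSupport_vel₁ hψ')
  have j4 := integrable_smooth_mul i2 (contDiff_vel₂ hψ) (hasCompactSupport_vel₂ hψ')
  have e : ∀ z, vel₁ (φ + c • ψ) z * ((g z).1 * wt z) + vel₂ (φ + c • ψ) z * ((g z).2 * wt z)
      = (vel₁ φ z * ((g z).1 * wt z) + vel₂ φ z * ((g z).2 * wt z))
        + c * (vel₁ ψ z * ((g z).1 * wt z) + vel₂ ψ z * ((g z).2 * wt z)) := by
    intro z
    have h := jet_add_smul hφ hψ c z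
    have h1 : vel₁ (φ + c • ψ) z = vel₁ φ z + c * vel₁ ψ z := congrArg (fun p => p.1) h
    have h2 : vel₂ (φ + c • ψ) z = vel₂ φ z + c * vel₂ ψ z := congrArg (fun p => p.2.1) h
    rw [h1, h2]; ring
  simp only [pairing, e]
  have j5 : Integrable fun z => vel₁ φ z * ((g z).1 * wt z) + vel₂ φ z * ((g z).2 * wt z) :=
    j1.add j2
  have j6 : Integrable fun z => c * (vel₁ ψ z * ((g z).1 * wt z) + vel₂ ψ z * ((g z).2 * wt z)) :=
    (j3.add j4).const_mul c
  rw [integral_add j5 j6, integral_const_mul, integral_add j3 j4]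
  ring

/-- The defect is quadratic in the velocity. The cross term vanishes in the limit of high frequency,
and the square term lowers the defect by a definite amount. -/
lemma defectIntegral_add_smul (hφ : ContDiff ℝ ∞ φ) (hφ' : HasCompactSupport φ)
    (hψ : ContDiff ℝ ∞ ψ) (hψ' : HasCompactSupport ψ) (hw : Integrable wt) (c : ℝ) :
    defectIntegral a₁ a₂ wt (φ + c • ψ) = defectIntegral a₁ a₂ wt φ
      - 2 * c * ((∫ z, vel₁ ψ z * (vel₁ φ z * wt z)) + ∫ z, vel₂ ψ z * (vel₂ φ z * wt z))
      - c ^ 2 * ∫ z, (vel₁ ψ z ^ 2 + vel₂ ψ z ^ 2) * wt z := by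
  have c1 := contDiff_vel₁ hφ
  have c2 := contDiff_vel₂ hφ
  have c3 := contDiff_vel₁ hψ
  have c4 := contDiff_vel₂ hψ
  have s1 := hasCompactSupport_vel₁ hφ'
  have s2 := hasCompactSupport_vel₂ hφ'
  have s3 := hasCompactSupport_vel₁ hψ'
  have s4 := hasCompactSupport_vel₂ hψ'
  have j1 := integrable_smooth_mul (integrable_smooth_mul hw c1 s1) c3 s3
  have j2 := integrable_smooth_mul (integrable_smooth_mul hw c2 s2) c4 s4
  have k1 := integrable_smooth_mul (integrable_smooth_mul hw c1 s1) c1 s1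
  have k2 := integrable_smooth_mul (integrable_smooth_mul hw c2 s2) c2 s2
  have l1 := integrable_smooth_mul (integrable_smooth_mul hw c3 s3) c3 s3
  have l2 := integrable_smooth_mul (integrable_smooth_mul hw c4 s4) c4 s4
  have q : Integrable fun z => (vel₁ ψ z ^ 2 + vel₂ ψ z ^ 2) * wt z :=
    (l1.add l2).congr (ae_of_all _ fun z => by simp only [Pi.add_apply]; ring)
  have d : Integrable fun z => defect a₁ a₂ (jet φ z) * wt z :=
    (((hw.const_mul (a₁ + a₂)).sub k1).sub k2).congr
      (ae_of_all _ fun z => by simp only [Pi.sub_apply, defect, jet]; ring)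
  have e : ∀ z, defect a₁ a₂ (jet (φ + c • ψ) z) * wt z = defect a₁ a₂ (jet φ z) * wt z
      - 2 * c * (vel₁ ψ z * (vel₁ φ z * wt z) + vel₂ ψ z * (vel₂ φ z * wt z))
      - c ^ 2 * ((vel₁ ψ z ^ 2 + vel₂ ψ z ^ 2) * wt z) := by
    intro z
    rw [jet_add_smul hφ hψ c z]
    simp only [defect, jet, Prod.smul_mk, Prod.mk_add_mk, smul_eq_mul]
    ring
  simp only [defectIntegral, e]
  have i1 : Integrable fun z => 2 * c * (vel₁ ψ z * (vel₁ φ z * wt z)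
    + vel₂ ψ z * (vel₂ φ z * wt z)) := (j1.add j2).const_mul (2 * c)
  have i2 : Integrable fun z => c ^ 2 * ((vel₁ ψ z ^ 2 + vel₂ ψ z ^ 2) * wt z) := q.const_mul _
  have i3 : Integrable fun z => defect a₁ a₂ (jet φ z) * wt z
      - 2 * c * (vel₁ ψ z * (vel₁ φ z * wt z) + vel₂ ψ z * (vel₂ φ z * wt z)) := d.sub i1
  rw [integral_sub i3 i2, integral_sub d i1, integral_const_mul, integral_const_mul,
    integral_add j1 j2]

lemma phase_ne_zero {k₁ k₂ : ℝ} (hk : k₁ ^ 2 + k₂ ^ 2 = 1) (τ : ℝ) : phase k₁ k₂ τ ≠ 0 := by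
  intro h
  have h1 := phase_e₁ k₁ k₂ τ
  have h2 := phase_e₂ k₁ k₂ τ
  rw [h] at h1 h2
  simp only [zero_apply] at h1 h2
  rw [← h1, ← h2] at hk
  norm_num at hk

section WaveLimits

variable {χ : SpaceTime → ℝ} {k₁ k₂ : ℝ}

lemma hasCompactSupport_wave (hχ' : HasCompactSupport χ) (l : SpaceTime →L[ℝ] ℝ) (N : ℝ) :
    HasCompactSupport (wave l χ N) :=
  hχ'.of_isClosed_subset (isClosed_tsupport _) (tsupport_wave_subset l N)

lemma exists_bound_vel_wave (hχ : ContDiff ℝ ∞ χ) (hχ' : HasCompactSupport χ)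
    (hk : k₁ ^ 2 + k₂ ^ 2 = 1) (τ : ℝ) :
    ∃ K, 0 ≤ K ∧ ∀ N : ℝ, 1 ≤ N → ∀ z,
      |vel₁ (wave (phase k₁ k₂ τ) χ N) z - χ z * Real.cos (N * phase k₁ k₂ τ z) * k₂| ≤ K / N ∧
      |vel₂ (wave (phase k₁ k₂ τ) χ N) z - χ z * Real.cos (N * phase k₁ k₂ τ z) * -k₁| ≤ K / N := by
  obtain ⟨K, hK0, hK⟩ := exists_bound_jet_wave hχ hχ' hk τ
  refine ⟨K, hK0, fun N hN z => ⟨?_, ?_⟩⟩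
  · exact (norm_fst_le _).trans (hK N hN z)
  · exact (norm_fst_le _).trans ((norm_snd_le _).trans (hK N hN z))

lemma tendsto_integral_vel₁_wave (hχ : ContDiff ℝ ∞ χ) (hχ' : HasCompactSupport χ)
    (hk : k₁ ^ 2 + k₂ ^ 2 = 1) (τ : ℝ)
    {h : SpaceTime → ℝ} (hh : Integrable h) :
    Tendsto (fun N => ∫ z, vel₁ (wave (phase k₁ k₂ τ) χ N) z * h z) atTop (𝓝 0) := by
  obtain ⟨K, hK0, hK⟩ := exists_bound_vel_wave hχ hχ' hk τ
  refine tendsto_integral_of_close hh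
    (fun N => integrable_smooth_mul hh (contDiff_vel₁ (contDiff_wave _ N hχ))
      (hasCompactSupport_vel₁ (hasCompactSupport_wave hχ' _ N)))
    (fun N => integrable_smooth_mul hh ((contDiff_mulCos (phase k₁ k₂ τ) N hχ).mul contDiff_const)
      hχ'.mul_right.mul_right) (fun N hN z => (hK N hN z).1) ?_
  refine (tendsto_integral_mul_cos
    ((integrable_smooth_mul hh hχ hχ').const_mul k₂) (phase_ne_zero hk τ)).congr fun N => ?_
  refine integral_congr_ae (ae_of_all _ fun z => ?_)
  simp only [mulCos, Pi.mul_apply]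
  ring

lemma tendsto_integral_vel₂_wave (hχ : ContDiff ℝ ∞ χ) (hχ' : HasCompactSupport χ)
    (hk : k₁ ^ 2 + k₂ ^ 2 = 1) (τ : ℝ)
    {h : SpaceTime → ℝ} (hh : Integrable h) :
    Tendsto (fun N => ∫ z, vel₂ (wave (phase k₁ k₂ τ) χ N) z * h z) atTop (𝓝 0) := by
  obtain ⟨K, hK0, hK⟩ := exists_bound_vel_wave hχ hχ' hk τ
  refine tendsto_integral_of_close hh
    (fun N => integrable_smooth_mul hh (contDiff_vel₂ (contDiff_wave _ N hχ))
      (hasCompactSupport_vel₂ (hasCompactSupport_wave hχ' _ N)))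
    (fun N => integrable_smooth_mul hh ((contDiff_mulCos (phase k₁ k₂ τ) N hχ).mul contDiff_const)
      hχ'.mul_right.mul_right) (fun N hN z => (hK N hN z).2) ?_
  refine (tendsto_integral_mul_cos
    ((integrable_smooth_mul hh hχ hχ').const_mul (-k₁)) (phase_ne_zero hk τ)).congr fun N => ?_
  refine integral_congr_ae (ae_of_all _ fun z => ?_)
  simp only [mulCos, Pi.mul_apply]
  ring

/-- The leading velocity is `χ cos` times the unit vector `(k₂, -k₁)`, so the squared modulus is `χ²
cos²` up to `O(1/N)`. -/
lemma tendsto_integral_vel_sq_wave (hχ : ContDiff ℝ ∞ χ) (hχ' : HasCompactSupport χ)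
    (hk : k₁ ^ 2 + k₂ ^ 2 = 1) (τ : ℝ)
    (hχ1 : ∀ z, |χ z| ≤ 1) {h : SpaceTime → ℝ}
    (hh : Integrable h) :
    Tendsto (fun N => ∫ z, (vel₁ (wave (phase k₁ k₂ τ) χ N) z ^ 2
      + vel₂ (wave (phase k₁ k₂ τ) χ N) z ^ 2) * h z) atTop (𝓝 ((∫ z, χ z ^ 2 * h z) / 2)) := by
  obtain ⟨K, hK0, hK⟩ := exists_bound_vel_wave hχ hχ' hk τ
  have cv := fun N => contDiff_vel₁ (contDiff_wave (phase k₁ k₂ τ) N hχ)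
  have cv' := fun N => contDiff_vel₂ (contDiff_wave (phase k₁ k₂ τ) N hχ)
  have sv := fun N => hasCompactSupport_vel₁ (hasCompactSupport_wave hχ' (phase k₁ k₂ τ) N)
  have sv' := fun N => hasCompactSupport_vel₂ (hasCompactSupport_wave hχ' (phase k₁ k₂ τ) N)
  refine tendsto_integral_of_close (K := 4 * K + 2 * K ^ 2)
    (m := fun N z => (mulCos (phase k₁ k₂ τ) N χ z) ^ 2) hh
    (fun N => integrable_smooth_mul hh (((cv N).pow 2).add ((cv' N).pow 2)) ?_)
    (fun N => integrable_smooth_mul hh ((contDiff_mulCos (phase k₁ k₂ τ) N hχ).pow 2) ?_)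
    (fun N hN z => ?_) ?_
  · refine hasCompactSupport_of_jet (hasCompactSupport_wave hχ' (phase k₁ k₂ τ) N) fun z hz => ?_
    have h1 : vel₁ (wave (phase k₁ k₂ τ) χ N) z = 0 := congrArg (fun p => p.1) hz
    have h2 : vel₂ (wave (phase k₁ k₂ τ) χ N) z = 0 := congrArg (fun p => p.2.1) hz
    simp [h1, h2]
  · exact HasCompactSupport.intro hχ' fun z hz => by
      simp [mulCos, image_eq_zero_of_notMem_tsupport hz]
  · obtain ⟨h1, h2⟩ := hK N hN z
    set m := χ z * Real.cos (N * phase k₁ k₂ τ z)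
    have hm : |m| ≤ 1 := by
      rw [abs_mul]; exact mul_le_one₀ (hχ1 z) (abs_nonneg _) (Real.abs_cos_le_one _)
    set v₁ := vel₁ (wave (phase k₁ k₂ τ) χ N) z
    set v₂ := vel₂ (wave (phase k₁ k₂ τ) χ N) z
    have hN0 : 0 < N := by linarith
    have hkk1 : |k₂| ≤ 1 := abs_le_one_iff_mul_self_le_one.2 (by nlinarith [sq_nonneg k₁])
    have hkk2 : |k₁| ≤ 1 := abs_le_one_iff_mul_self_le_one.2 (by nlinarith [sq_nonneg k₂])
    have hKN : K / N ≤ K := div_le_self hK0 hN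
    have hKN0 : 0 ≤ K / N := by positivity
    have e : v₁ ^ 2 + v₂ ^ 2 - (mulCos (phase k₁ k₂ τ) N χ z) ^ 2
        = 2 * (m * k₂ * (v₁ - m * k₂)) + 2 * (m * -k₁ * (v₂ - m * -k₁)) + (v₁ - m * k₂) ^ 2
          + (v₂ - m * -k₁) ^ 2 := by
      have : mulCos (phase k₁ k₂ τ) N χ z = m := rfl
      rw [this]
      linear_combination (m ^ 2) * hk
    rw [e]
    have t1 : |m * k₂ * (v₁ - m * k₂)| ≤ K / N := by
      rw [abs_mul, abs_mul]
      exact (mul_le_of_le_one_left (abs_nonneg _) (mul_le_one₀ hm (abs_nonneg _) hkk1)).trans h1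
    have t2 : |m * -k₁ * (v₂ - m * -k₁)| ≤ K / N := by
      rw [abs_mul, abs_mul, abs_neg]
      exact (mul_le_of_le_one_left (abs_nonneg _) (mul_le_one₀ hm (abs_nonneg _) hkk2)).trans h2
    have t3 : (v₁ - m * k₂) ^ 2 ≤ K * (K / N) := by
      rw [← sq_abs, sq]
      exact mul_le_mul (h1.trans hKN) h1 (abs_nonneg _) hK0
    have t4 : (v₂ - m * -k₁) ^ 2 ≤ K * (K / N) := by
      rw [← sq_abs, sq]
      exact mul_le_mul (h2.trans hKN) h2 (abs_nonneg _) hK0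
    have e2 : (4 * K + 2 * K ^ 2) / N = 4 * (K / N) + 2 * (K * (K / N)) := by ring
    rw [e2]
    have u1 := abs_le.1 t1
    have u2 := abs_le.1 t2
    have u3 := sq_nonneg (v₁ - m * k₂)
    have u4 := sq_nonneg (v₂ - m * -k₁)
    rw [abs_le]
    constructor
    · nlinarith
    · linarith
  · refine (tendsto_integral_sq_mul_cos_sq (integrable_smooth_mul hh (hχ.pow 2) ?_)
      (phase_ne_zero hk τ)).congr fun N => ?_
    · exact HasCompactSupport.intro hχ' fun z hz => by
        simp [image_eq_zero_of_notMem_tsupport hz]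
    · refine integral_congr_ae (ae_of_all _ fun z => ?_)
      simp only [mulCos, Pi.mul_apply]
      ring

end WaveLimits

end Perturbation

end IsentropicEuler

end

/-! ### Perturbation of a subsolution in disjoint balls -/

noncomputable section

namespace IsentropicEuler

section Step

variable {wt : SpaceTime → ℝ} {φ : SpaceTime → ℝ} {a₁ a₂ κ : ℝ} {Ω : Set SpaceTime}

/-- On the ball `closedBall y r` the state `J` oscillates so little around `J y` that a plane wave
of amplitude proportional to the defect can be added. -/
def AllowsWave (a₁ a₂ κ : ℝ) (J : SpaceTime → ℝ × ℝ × ℝ × ℝ) (y : SpaceTime) (r : ℝ) : Prop :=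
  ∃ k₁ k₂ τ η : ℝ, k₁ ^ 2 + k₂ ^ 2 = 1 ∧ 0 < η ∧
    (∀ s ∈ Icc (-1 : ℝ) 1, ∀ q,
      ‖q - (J y + (s * (defect a₁ a₂ (J y) / (8 * κ))) • waveDir k₁ k₂ τ)‖ < η →
        q ∈ subsolutionSet a₁ a₂) ∧
    ∀ z ∈ Metric.closedBall y r, ‖J z - J y‖ < η / 2

/-- The condition sees the state on the ball only. Waves already added in disjoint balls therefore
do not spoil it. -/
lemma AllowsWave.congr {J J' : SpaceTime → ℝ × ℝ × ℝ × ℝ} {y : SpaceTime} {r : ℝ} (hr : 0 ≤ r)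
    (h : AllowsWave a₁ a₂ κ J y r) (hJ : ∀ z ∈ Metric.closedBall y r, J' z = J z) :
    AllowsWave a₁ a₂ κ J' y r := by
  obtain ⟨k₁, k₂, τ, η, hk, hη, h1, h2⟩ := h
  have hy := hJ y (Metric.mem_closedBall_self hr)
  refine ⟨k₁, k₂, τ, η, hk, hη, by rwa [hy], fun z hz => ?_⟩
  rw [hy, hJ z hz]
  exact h2 z hz

/-- Adding a plane wave localised in one ball decreases the total defect by a definite amount, and
changes the velocity by as little as desired in the weak sense. -/
lemma exists_perturbation_ball (hκ : 0 < κ) (hw : Integrable wt) (hw0 : ∀ z, 0 ≤ wt z)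
    (hφ : IsSubsolution a₁ a₂ Ω φ) {y : SpaceTime} {r : ℝ} (hr : 0 < r)
    (hB : Metric.closedBall y r ⊆ Ω) (hJ : AllowsWave a₁ a₂ κ (jet φ) y r) {c : ℝ}
    (hc : ∀ z ∈ Metric.closedBall y (r / 2), c ≤ wt z)
    (G : Finset (SpaceTime → ℝ × ℝ)) (hG : ∀ g ∈ G, IsBddField g) {ε : ℝ} (hε : 0 < ε) :
    ∃ φ', IsSubsolution a₁ a₂ Ω φ' ∧ (∀ z ∉ Metric.closedBall y r, jet φ' z = jet φ z) ∧
      defectIntegral a₁ a₂ wt φ' ≤ defectIntegral a₁ a₂ wt φ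
        - (defect a₁ a₂ (jet φ y) / (8 * κ)) ^ 2 *
          (c * volume.real (Metric.closedBall y (r / 2)) / 2) + ε ∧
      ∀ g ∈ G, |pairing wt φ' g - pairing wt φ g| ≤ ε := by
  obtain ⟨k₁, k₂, τ, η, hk, hη, hmem, hosc⟩ := hJ
  -- The amplitude that `exists_waveDir` permits at the centre. The frequency `N` is chosen last,
  -- large enough for all requirements at once.
  set μ := defect a₁ a₂ (jet φ y) / (8 * κ) with hμ
  have hμ0 : 0 < μ := div_pos (hφ.mem y).1 (by positivity)
  let b : ContDiffBump y := ⟨r / 2, r, by positivity, by linarith⟩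
  set χ : SpaceTime → ℝ := fun z => b z with hχdef
  have hχ : ContDiff ℝ ∞ χ := b.contDiff
  have hχ' : HasCompactSupport χ := b.hasCompactSupport
  have hχs : tsupport χ = Metric.closedBall y r := b.tsupport_eq
  have hχ1 : ∀ z, |χ z| ≤ 1 := fun z => by
    rw [abs_of_nonneg b.nonneg]; exact b.le_one
  obtain ⟨K, hK0, hK⟩ := exists_bound_jet_wave hχ hχ' hk τ
  set w : ℝ → SpaceTime → ℝ := fun N => wave (phase k₁ k₂ τ) χ N with hwdef
  have cw : ∀ N, ContDiff ℝ ∞ (w N) := fun N => contDiff_wave _ N hχ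
  have sw : ∀ N, HasCompactSupport (w N) := fun N => hasCompactSupport_wave hχ' _ N
  have tw : ∀ N, tsupport (w N) ⊆ Metric.closedBall y r := fun N =>
    (tsupport_wave_subset _ N).trans hχs.subset
  have ev1 : ∀ᶠ N : ℝ in atTop, μ * (K / N) < η / 2 := by
    have : Tendsto (fun N : ℝ => μ * (K / N)) atTop (𝓝 0) := by
      simpa using (tendsto_const_nhds.div_atTop tendsto_id).const_mul μ
    exact this.eventually (gt_mem_nhds (by positivity))
  have ev2 : ∀ᶠ N : ℝ in atTop, ∀ g ∈ G, |pairing wt (φ + μ • w N) g - pairing wt φ g| ≤ ε := by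
    rw [Filter.eventually_all_finset]
    intro g hg
    have h1 := tendsto_integral_vel₁_wave hχ hχ' hk τ ((hG g hg).integrable_fst hw)
    have h2 := tendsto_integral_vel₂_wave hχ hχ' hk τ ((hG g hg).integrable_snd hw)
    have h3 := (((h1.add h2).const_mul μ).abs)
    simp only [add_zero, mul_zero, abs_zero] at h3
    filter_upwards [h3.eventually (gt_mem_nhds hε)] with N hN
    rw [pairing_add_smul hφ.smooth hφ.compact (cw N) (sw N) hw (hG g hg)]
    exact hN.le
  -- The bump equals `1` on the ball of half the radius, and only this part of the gain is kept.
  have hlow : c * volume.real (Metric.closedBall y (r / 2)) ≤ ∫ z, χ z ^ 2 * wt z := by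
    have hi : Integrable fun z => χ z ^ 2 * wt z := by
      refine integrable_mul_of_bounded hw (hχ.continuous.pow 2).aestronglyMeasurable (B := 1)
        fun z => ?_
      rw [abs_pow]; exact pow_le_one₀ (abs_nonneg _) (hχ1 z)
    calc c * volume.real (Metric.closedBall y (r / 2))
        = ∫ z in Metric.closedBall y (r / 2), c := by
          rw [setIntegral_const, smul_eq_mul, mul_comm]
      _ ≤ ∫ z in Metric.closedBall y (r / 2), χ z ^ 2 * wt z := by
          refine setIntegral_mono_on (integrableOn_const
            (isCompact_closedBall _ _).measure_lt_top.ne) hi.integrableOn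
            Metric.isClosed_closedBall.measurableSet fun z hz => ?_
          have : χ z = 1 := b.one_of_mem_closedBall hz
          rw [this, one_pow, one_mul]
          exact hc z hz
      _ ≤ _ := setIntegral_le_integral hi
          (ae_of_all _ fun z => mul_nonneg (sq_nonneg _) (hw0 z))
  have ev3 : ∀ᶠ N : ℝ in atTop, defectIntegral a₁ a₂ wt (φ + μ • w N)
      ≤ defectIntegral a₁ a₂ wt φ
        - μ ^ 2 * (c * volume.real (Metric.closedBall y (r / 2)) / 2) + ε := by
    have h1 := tendsto_integral_vel₁_wave hχ hχ' hk τ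
      (integrable_smooth_mul hw (contDiff_vel₁ hφ.smooth) (hasCompactSupport_vel₁ hφ.compact))
    have h2 := tendsto_integral_vel₂_wave hχ hχ' hk τ
      (integrable_smooth_mul hw (contDiff_vel₂ hφ.smooth) (hasCompactSupport_vel₂ hφ.compact))
    have h3 := tendsto_integral_vel_sq_wave hχ hχ' hk τ hχ1 hw
    have h4 := (((h1.add h2).const_mul (2 * μ)).const_sub (defectIntegral a₁ a₂ wt φ)).sub
      (h3.const_mul (μ ^ 2))
    have hlt : defectIntegral a₁ a₂ wt φ - 2 * μ * (0 + 0) - μ ^ 2 * ((∫ z, χ z ^ 2 * wt z) / 2)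
        < defectIntegral a₁ a₂ wt φ
        - μ ^ 2 * (c * volume.real (Metric.closedBall y (r / 2)) / 2) + ε := by
      have : μ ^ 2 * (c * volume.real (Metric.closedBall y (r / 2)) / 2)
          ≤ μ ^ 2 * ((∫ z, χ z ^ 2 * wt z) / 2) := by gcongr
      linarith
    filter_upwards [h4.eventually (gt_mem_nhds hlt)] with N hN
    rw [defectIntegral_add_smul hφ.smooth hφ.compact (cw N) (sw N) hw]
    exact hN.le
  obtain ⟨N, hN1, hN2, hN3, hN4⟩ := (ev1.and (ev2.and (ev3.and (eventually_ge_atTop 1)))).exists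
  have hout : ∀ z ∉ Metric.closedBall y r, jet (φ + μ • w N) z = jet φ z := by
    intro z hz
    rw [jet_add_smul hφ.smooth (cw N), jet_eq_zero (fun h => hz (tw N h)), smul_zero, add_zero]
  refine ⟨φ + μ • w N, ⟨contDiff_add hφ.smooth (contDiff_smul (cw N) μ),
    hφ.compact.add (sw N).smul_left, ?_, fun z => ?_⟩, hout, hN3, hN2⟩
  · refine (tsupport_add _ _).trans (union_subset hφ.support ?_)
    exact ((tsupport_smul_subset_right (fun _ => μ) _).trans (tw N)).trans hB
  -- Inside the ball the new state is within `η` of the admissible segment through the state at the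
  -- centre: half of the room is for the oscillation of the old state, half for the error of the
  -- wave. Outside nothing has changed.
  · by_cases hz : z ∈ Metric.closedBall y r
    · set s := χ z * Real.cos (N * phase k₁ k₂ τ z) with hs
      have hsm : s ∈ Icc (-1 : ℝ) 1 := by
        rw [mem_Icc, ← abs_le, hs, abs_mul]
        exact mul_le_one₀ (hχ1 z) (abs_nonneg _) (Real.abs_cos_le_one _)
      refine hmem s hsm _ ?_
      rw [jet_add_smul hφ.smooth (cw N)]
      have e : jet φ z + μ • jet (w N) z - (jet φ y + (s * μ) • waveDir k₁ k₂ τ)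
          = (jet φ z - jet φ y) + μ • (jet (w N) z - s • waveDir k₁ k₂ τ) := by
        rw [mul_comm s μ, mul_smul, smul_sub]
        abel
      rw [e]
      calc _ ≤ ‖jet φ z - jet φ y‖ + ‖μ • (jet (w N) z - s • waveDir k₁ k₂ τ)‖ := norm_add_le _ _
        _ ≤ ‖jet φ z - jet φ y‖ + μ * (K / N) := by
          rw [norm_smul, Real.norm_eq_abs, abs_of_pos hμ0]
          gcongr
          exact hK N hN4 z
        _ < η := by linarith [hosc z hz]
    · rw [hout z hz]; exact hφ.mem z

/-- Adding plane waves localised in finitely many disjoint balls. -/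
lemma exists_perturbation_balls (hκ : 0 < κ) (hw : Integrable wt) (hw0 : ∀ z, 0 ≤ wt z)
    (hφ : IsSubsolution a₁ a₂ Ω φ) (G : Finset (SpaceTime → ℝ × ℝ)) (hG : ∀ g ∈ G, IsBddField g)
    (r c : SpaceTime → ℝ) (F : Finset SpaceTime)
    (hr : ∀ y ∈ F, 0 < r y) (hB : ∀ y ∈ F, Metric.closedBall y (r y) ⊆ Ω)
    (hJ : ∀ y ∈ F, AllowsWave a₁ a₂ κ (jet φ) y (r y))
    (hc : ∀ y ∈ F, ∀ z ∈ Metric.closedBall y (r y / 2), c y ≤ wt z)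
    (hdisj : (F : Set SpaceTime).PairwiseDisjoint fun y => Metric.closedBall y (r y))
    {ε : ℝ} (hε : 0 < ε) :
    ∃ φ', IsSubsolution a₁ a₂ Ω φ' ∧
      (∀ z, (∀ y ∈ F, z ∉ Metric.closedBall y (r y)) → jet φ' z = jet φ z) ∧
      defectIntegral a₁ a₂ wt φ' ≤ defectIntegral a₁ a₂ wt φ
        - ∑ y ∈ F, (defect a₁ a₂ (jet φ y) / (8 * κ)) ^ 2 *
          (c y * volume.real (Metric.closedBall y (r y / 2)) / 2) + ε ∧
      ∀ g ∈ G, |pairing wt φ' g - pairing wt φ g| ≤ ε := by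
  classical
  induction F using Finset.induction_on generalizing ε with
  | empty => exact ⟨φ, hφ, fun _ _ => rfl, by simp [hε.le], by simp [hε.le]⟩
  | insert y F hy ih =>
    obtain ⟨φ₁, h1, h2, h3, h4⟩ := ih (fun z hz => hr z (Finset.mem_insert_of_mem hz))
      (fun z hz => hB z (Finset.mem_insert_of_mem hz))
      (fun z hz => hJ z (Finset.mem_insert_of_mem hz))
      (fun z hz => hc z (Finset.mem_insert_of_mem hz))
      (hdisj.subset (by simp)) (half_pos hε)
    have hyF := Finset.mem_insert_self y F
    -- By disjointness the state on the new ball is still the original one, in particular the defect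
    -- at its centre.
    have hball : ∀ z ∈ Metric.closedBall y (r y), jet φ₁ z = jet φ z := by
      refine fun z hz => h2 z fun x hx hzx => ?_
      have hne : y ≠ x := fun h => hy (h ▸ hx)
      exact disjoint_left.1 (hdisj (by simp) (by simp [hx]) hne) hz hzx
    obtain ⟨φ₂, k1, k2, k3, k4⟩ := exists_perturbation_ball hκ hw hw0 h1 (hr y hyF) (hB y hyF)
      ((hJ y hyF).congr (hr y hyF).le hball) (hc y hyF) G hG (half_pos hε)
    refine ⟨φ₂, k1, fun z hz => ?_, ?_, fun g hg => ?_⟩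
    · rw [k2 z (hz y hyF), h2 z fun x hx => hz x (Finset.mem_insert_of_mem hx)]
    · rw [Finset.sum_insert hy]
      rw [hball y (Metric.mem_closedBall_self (hr y hyF).le)] at k3
      linarith
    · have := abs_add_le (pairing wt φ₂ g - pairing wt φ₁ g) (pairing wt φ₁ g - pairing wt φ g)
      rw [sub_add_sub_cancel] at this
      linarith [h4 g hg, k4 g hg]

end Step

end IsentropicEuler

end

/-! ### One step of convex integration: a weight and a Besicovitch covering -/

noncomputable section

namespace IsentropicEuler

/-- A positive, continuous, integrable function on space-time. -/
def decay (z : SpaceTime) : ℝ := (1 + ‖z‖) ^ (-4 : ℝ)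

lemma continuous_decay : Continuous decay :=
  (continuous_const.add continuous_norm).rpow_const fun z => Or.inl (add_pos_of_pos_of_nonneg one_pos (norm_nonneg z)).ne'

lemma decay_pos (z : SpaceTime) : 0 < decay z := by unfold decay; positivity

lemma integrable_decay : Integrable decay := by
  refine integrable_one_add_norm ?_
  simp only [Module.finrank_prod, finrank_euclideanSpace, Fintype.card_fin, Module.finrank_self]
  norm_num

/-- A weight that is positive exactly on `Ω`. -/
def weight (Ω : Set SpaceTime) : SpaceTime → ℝ := Ω.indicator decay

section Weight

variable {Ω : Set SpaceTime}

lemma weight_nonneg (z : SpaceTime) : 0 ≤ weight Ω z :=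
  indicator_nonneg (fun z _ => (decay_pos z).le) z

lemma integrable_weight (hΩ : IsOpen Ω) : Integrable (weight Ω) :=
  integrable_decay.indicator hΩ.measurableSet

lemma weight_of_mem {z : SpaceTime} (hz : z ∈ Ω) : weight Ω z = decay z := indicator_of_mem hz _

lemma measurable_weight (hΩ : IsOpen Ω) : Measurable (weight Ω) :=
  continuous_decay.measurable.indicator hΩ.measurableSet

end Weight

section Step

variable {φ : SpaceTime → ℝ} {a₁ a₂ κ : ℝ} {Ω : Set SpaceTime}

/-- Space-time has dimension three, hence the factor `2 ^ 3`. -/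
lemma volume_real_closedBall (y : SpaceTime) {r : ℝ} (hr : 0 ≤ r) :
    volume.real (Metric.closedBall y r) = 8 * volume.real (Metric.closedBall y (r / 2)) := by
  rw [Measure.addHaar_real_closedBall' volume y hr,
    Measure.addHaar_real_closedBall' volume y (by positivity : 0 ≤ r / 2)]
  simp only [Module.finrank_prod, finrank_euclideanSpace, Fintype.card_fin, Module.finrank_self]
  ring

/-- All four properties hold near `y` by continuity, since the state at `y` satisfies strict
inequalities. They are needed for every smaller radius because the covering theorem chooses the
radii. -/
lemma exists_good_radius (hκ : 0 < κ) (hκ2 : κ ^ 2 = a₁ + a₂) (hΩ : IsOpen Ω)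
    (hφ : IsSubsolution a₁ a₂ Ω φ) {y : SpaceTime} (hy : y ∈ Ω) :
    ∃ R > 0, ∀ r, 0 < r → r ≤ R → Metric.closedBall y r ⊆ Ω ∧ AllowsWave a₁ a₂ κ (jet φ) y r ∧
      (∀ z ∈ Metric.closedBall y r, decay y / 2 ≤ decay z) ∧
      ∀ z ∈ Metric.closedBall y r, defect a₁ a₂ (jet φ z) ^ 2 * decay z
        ≤ 2 * (defect a₁ a₂ (jet φ y) ^ 2 * decay y) := by
  obtain ⟨k₁, k₂, τ, η, hk, hη, h⟩ := exists_waveDir_thickening hκ hκ2 (hφ.mem y)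
  have cJ := continuous_jet hφ.smooth
  have e1 : ∀ᶠ z in 𝓝 y, z ∈ Ω := hΩ.mem_nhds hy
  have e2 : ∀ᶠ z in 𝓝 y, ‖jet φ z - jet φ y‖ < η / 2 := by
    have : Tendsto (fun z => ‖jet φ z - jet φ y‖) (𝓝 y) (𝓝 ‖jet φ y - jet φ y‖) :=
      ((cJ.sub continuous_const).norm).tendsto y
    rw [sub_self, norm_zero] at this
    exact this.eventually (gt_mem_nhds (by positivity))
  have e3 : ∀ᶠ z in 𝓝 y, decay y / 2 < decay z :=
    (continuous_decay.tendsto y).eventually (lt_mem_nhds (by linarith [decay_pos y]))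
  have hd := (hφ.mem y).1
  have e4 : ∀ᶠ z in 𝓝 y, defect a₁ a₂ (jet φ z) ^ 2 * decay z
      < 2 * (defect a₁ a₂ (jet φ y) ^ 2 * decay y) := by
    have c : Continuous fun z => defect a₁ a₂ (jet φ z) ^ 2 * decay z :=
      ((continuous_defect.comp cJ).pow 2).mul continuous_decay
    have hp : 0 < defect a₁ a₂ (jet φ y) ^ 2 * decay y := mul_pos (by positivity) (decay_pos y)
    exact (c.tendsto y).eventually (gt_mem_nhds (by linarith))
  obtain ⟨R, hR, hR'⟩ := Metric.nhds_basis_closedBall.eventually_iff.1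
    (e1.and (e2.and (e3.and e4)))
  refine ⟨R, hR, fun r _ hr => ?_⟩
  have hsub := Metric.closedBall_subset_closedBall (x := y) hr
  exact ⟨fun z hz => (hR' (hsub hz)).1,
    ⟨k₁, k₂, τ, η, hk, hη, h, fun z hz => (hR' (hsub hz)).2.1⟩,
    fun z hz => (hR' (hsub hz)).2.2.1.le, fun z hz => (hR' (hsub hz)).2.2.2.le⟩

lemma defect_le (p : ℝ × ℝ × ℝ × ℝ) : defect a₁ a₂ p ≤ a₁ + a₂ := by
  simp only [defect]; nlinarith [sq_nonneg p.1, sq_nonneg p.2.1]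

lemma integrable_defect_sq (hΩ : IsOpen Ω) (hφ : IsSubsolution a₁ a₂ Ω φ) :
    Integrable fun z => defect a₁ a₂ (jet φ z) ^ 2 * weight Ω z := by
  refine integrable_mul_of_bounded (integrable_weight hΩ) (B := (a₁ + a₂) ^ 2)
    ((continuous_defect.comp (continuous_jet hφ.smooth)).pow 2).aestronglyMeasurable fun z => ?_
  rw [abs_of_nonneg (sq_nonneg _)]
  have := (hφ.mem z).1
  gcongr
  exact defect_le _

/-- One step of convex integration: the total defect decreases by a multiple of its square
integral. -/
lemma exists_step (hκ : 0 < κ) (hκ2 : κ ^ 2 = a₁ + a₂) (hΩ : IsOpen Ω)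
    (hφ : IsSubsolution a₁ a₂ Ω φ) (G : Finset (SpaceTime → ℝ × ℝ)) (hG : ∀ g ∈ G, IsBddField g)
    {ε : ℝ} (hε : 0 < ε) :
    ∃ φ', IsSubsolution a₁ a₂ Ω φ' ∧
      defectIntegral a₁ a₂ (weight Ω) φ' ≤ defectIntegral a₁ a₂ (weight Ω) φ
        - (4096 * κ ^ 2)⁻¹ * (∫ z, defect a₁ a₂ (jet φ z) ^ 2 * weight Ω z) + ε ∧
      ∀ g ∈ G, |pairing (weight Ω) φ' g - pairing (weight Ω) φ g| ≤ ε := by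
  classical
  choose! R hR0 hR using fun y (hy : y ∈ Ω) => exists_good_radius hκ hκ2 hΩ hφ hy
  -- Countably many disjoint good balls cover `Ω` up to a null set, so the integral of the squared
  -- defect is the sum over the balls.
  obtain ⟨t, r, htc, htΩ, htr, hcov, hdisj⟩ := Besicovitch.exists_disjoint_closedBall_covering_ae
    (volume : Measure SpaceTime) (fun _ => univ) Ω
    (fun x _ δ hδ => by simpa using hδ) R hR0
  have hr0 : ∀ y ∈ t, 0 < r y := fun y hy => (htr y hy).2.1
  have hgood := fun y (hy : y ∈ t) => hR y (htΩ hy) (r y) (hr0 y hy) (htr y hy).2.2.le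
  set f : SpaceTime → ℝ := fun z => defect a₁ a₂ (jet φ z) ^ 2 * weight Ω z with hf
  have hfi : Integrable f := integrable_defect_sq hΩ hφ
  have : Countable t := htc
  set U : Set SpaceTime := ⋃ y : t, Metric.closedBall y.1 (r y.1) with hU
  have hUsub : U ⊆ Ω := iUnion_subset fun y => (hgood y.1 y.2).1
  have hUae : (∫ z in U, f z) = ∫ z, f z := by
    have h1 : (∫ z in Ω, f z) = ∫ z, f z := setIntegral_eq_integral_of_forall_compl_eq_zero
      fun z hz => by simp [hf, weight, indicator_of_notMem hz]
    rw [← h1]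
    refine setIntegral_congr_set ?_
    refine (ae_eq_set).2 ⟨by simp [sdiff_eq_empty.2 hUsub], ?_⟩
    rw [hU, iUnion_coe_set]
    exact hcov
  have hsum : HasSum (fun y : t => ∫ z in Metric.closedBall y.1 (r y.1), f z) (∫ z, f z) := by
    rw [← hUae]
    refine hasSum_integral_iUnion (fun y => Metric.isClosed_closedBall.measurableSet) ?_
      hfi.integrableOn
    intro x y hxy
    exact hdisj x.2 y.2 fun h => hxy (Subtype.ext h)
  -- In `hball`, `4096 = 256 * 16`: the gain in a ball is the squared defect times `decay` at the
  -- centre, times the volume of the half ball, over `256 κ²` (`64` from the squared amplitude, `2`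
  -- from the lower bound of the weight, `2` from the mean of `cos²`). The integral over the full
  -- ball is at most `16 = 8 * 2` times the same product without `256 κ²`.
  set β := (4096 * κ ^ 2)⁻¹ with hβ
  have hβ0 : 0 < β := by positivity
  have hlt : (∫ z, f z) - ε / (2 * β) < ∫ z, f z := by
    have : 0 < ε / (2 * β) := by positivity
    linarith
  -- Finitely many of the balls already carry all but `ε / (2β)` of the integral; only these are
  -- perturbed, which keeps the support compact.
  obtain ⟨F, hF⟩ := (hsum.eventually (lt_mem_nhds hlt)).exists
  have hball : ∀ y ∈ t, β * (∫ z in Metric.closedBall y (r y), f z)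
      ≤ (defect a₁ a₂ (jet φ y) / (8 * κ)) ^ 2 *
          (decay y / 2 * volume.real (Metric.closedBall y (r y / 2)) / 2) := by
    intro y hy
    have hi : (∫ z in Metric.closedBall y (r y), f z)
        ≤ ∫ z in Metric.closedBall y (r y), 2 * (defect a₁ a₂ (jet φ y) ^ 2 * decay y) := by
      refine setIntegral_mono_on hfi.integrableOn (integrableOn_const
        (isCompact_closedBall _ _).measure_lt_top.ne)
        Metric.isClosed_closedBall.measurableSet fun z hz => ?_
      rw [hf]
      simp only [weight_of_mem ((hgood y hy).1 hz)]
      exact (hgood y hy).2.2.2 z hz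
    rw [setIntegral_const, smul_eq_mul, volume_real_closedBall y (hr0 y hy).le] at hi
    calc _ ≤ β * (8 * volume.real (Metric.closedBall y (r y / 2)) *
          (2 * (defect a₁ a₂ (jet φ y) ^ 2 * decay y))) := by gcongr
      _ = _ := by rw [hβ]; field_simp; norm_num
  have hFt : ∀ y ∈ F.map (Function.Embedding.subtype _), y ∈ t := by
    intro y hy
    obtain ⟨y, hyF, rfl⟩ := Finset.mem_map.1 hy
    exact y.2
  obtain ⟨φ', h1, -, h3, h4⟩ := exists_perturbation_balls (κ := κ) (c := fun y => decay y / 2)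
    (r := r) hκ (integrable_weight hΩ) weight_nonneg hφ G hG
    (F.map (Function.Embedding.subtype _))
    (fun y hy => hr0 y (hFt y hy)) (fun y hy => (hgood y (hFt y hy)).1)
    (fun y hy => (hgood y (hFt y hy)).2.1)
    (by
      intro y hy z hz
      obtain ⟨y, hyF, rfl⟩ := Finset.mem_map.1 hy
      have hz' := Metric.closedBall_subset_closedBall (half_le_self (hr0 y.1 y.2).le) hz
      rw [weight_of_mem ((hgood y.1 y.2).1 hz')]
      exact (hgood y.1 y.2).2.2.1 z hz')
    (hdisj.subset fun y hy => hFt y (Finset.mem_coe.1 hy)) (half_pos hε)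
  refine ⟨φ', h1, ?_, fun g hg => (h4 g hg).trans (by linarith)⟩
  rw [Finset.sum_map] at h3
  have h5 : β * ∑ y ∈ F, (∫ z in Metric.closedBall y.1 (r y.1), f z) ≤ ∑ y ∈ F,
      (defect a₁ a₂ (jet φ y.1) / (8 * κ)) ^ 2 *
          (decay y.1 / 2 * volume.real (Metric.closedBall y.1 (r y.1 / 2)) / 2) := by
    rw [Finset.mul_sum]
    exact Finset.sum_le_sum fun y _ => hball y.1 y.2
  have h6 : β * (∫ z, f z) - ε / 2 ≤
      β * ∑ y ∈ F, (∫ z in Metric.closedBall y.1 (r y.1), f z) := by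
    have := mul_le_mul_of_nonneg_left hF.le hβ0.le
    rw [mul_sub] at this
    have e : β * (ε / (2 * β)) = ε / 2 := by field_simp
    linarith
  simp only [Function.Embedding.subtype_apply] at h3
  linarith

end Step

end IsentropicEuler

end

/-! ### Iteration, and compactness in weighted `L²` -/

noncomputable section

namespace IsentropicEuler

/-- The velocity field generated by a potential. -/
def velField (φ : SpaceTime → ℝ) (z : SpaceTime) : ℝ × ℝ := (vel₁ φ z, vel₂ φ z)

section Iteration

variable {φ ψ : SpaceTime → ℝ} {a₁ a₂ κ : ℝ} {Ω : Set SpaceTime}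

lemma IsSubsolution.sq_vel_lt (hφ : IsSubsolution a₁ a₂ Ω φ) (z : SpaceTime) :
    vel₁ φ z ^ 2 + vel₂ φ z ^ 2 < a₁ + a₂ := by
  have := (hφ.mem z).1
  simp only [defect, jet] at this
  linarith

lemma measurable_velField (hφ : ContDiff ℝ ∞ φ) : Measurable (velField φ) :=
  (contDiff_vel₁ hφ).continuous.measurable.prodMk (contDiff_vel₂ hφ).continuous.measurable

lemma IsSubsolution.abs_vel_le (hφ : IsSubsolution a₁ a₂ Ω φ) (hκ : 0 < κ)
    (hκ2 : κ ^ 2 = a₁ + a₂) (z : SpaceTime) : |vel₁ φ z| ≤ κ ∧ |vel₂ φ z| ≤ κ := by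
  have := hφ.sq_vel_lt z
  constructor <;> refine abs_le_of_sq_le_sq ?_ hκ.le <;>
    nlinarith [sq_nonneg (vel₁ φ z), sq_nonneg (vel₂ φ z)]

lemma IsSubsolution.isBddField (hφ : IsSubsolution a₁ a₂ Ω φ) (hκ : 0 < κ)
    (hκ2 : κ ^ 2 = a₁ + a₂) : IsBddField (velField φ) :=
  ⟨measurable_velField hφ.smooth, κ, fun z => max_le (hφ.abs_vel_le hκ hκ2 z).1
    (hφ.abs_vel_le hκ hκ2 z).2⟩

lemma isSubsolution_zero (h₁ : 0 < a₁) (h₂ : 0 < a₂) : IsSubsolution a₁ a₂ Ω 0 := by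
  have ht : tsupport (0 : SpaceTime → ℝ) = ∅ := by simp [tsupport]
  refine ⟨contDiff_const, HasCompactSupport.zero, by simp [ht], fun z => ?_⟩
  rw [jet_eq_zero (by simp [ht])]
  exact zero_mem_subsolutionSet h₁ h₂

/-- The recursion carries a growing finite set of fields against which all later increments must be
nearly orthogonal: the given `G` and every velocity field constructed so far. The latter makes the
sequence Cauchy, the former makes the limit nearly orthogonal to `G`. -/
lemma exists_subsolution_seq (hκ : 0 < κ) (hκ2 : κ ^ 2 = a₁ + a₂) (hΩ : IsOpen Ω)
    (h₁ : 0 < a₁) (h₂ : 0 < a₂) (G : Finset (SpaceTime → ℝ × ℝ)) (hG : ∀ g ∈ G, IsBddField g)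
    {ε : ℝ} (hε : 0 < ε) :
    ∃ φ : ℕ → SpaceTime → ℝ, φ 0 = 0 ∧ (∀ k, IsSubsolution a₁ a₂ Ω (φ k)) ∧
      (∀ k, defectIntegral a₁ a₂ (weight Ω) (φ (k + 1)) ≤ defectIntegral a₁ a₂ (weight Ω) (φ k)
        - (4096 * κ ^ 2)⁻¹ * (∫ z, defect a₁ a₂ (jet (φ k) z) ^ 2 * weight Ω z)
        + ε / 2 ^ (k + 1)) ∧
      (∀ k, ∀ g ∈ G, |pairing (weight Ω) (φ (k + 1)) g - pairing (weight Ω) (φ k) g|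
        ≤ ε / 2 ^ (k + 1)) ∧
      ∀ j k, j ≤ k → |pairing (weight Ω) (φ (k + 1)) (velField (φ j))
        - pairing (weight Ω) (φ k) (velField (φ j))| ≤ ε / 2 ^ (k + 1) := by
  classical
  let S := {s : (SpaceTime → ℝ) × Finset (SpaceTime → ℝ × ℝ) //
    IsSubsolution a₁ a₂ Ω s.1 ∧ (∀ g ∈ s.2, IsBddField g) ∧ velField s.1 ∈ s.2}
  have step : ∀ (k : ℕ) (s : S), ∃ s' : S,
      defectIntegral a₁ a₂ (weight Ω) s'.1.1 ≤ defectIntegral a₁ a₂ (weight Ω) s.1.1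
        - (4096 * κ ^ 2)⁻¹ * (∫ z, defect a₁ a₂ (jet s.1.1 z) ^ 2 * weight Ω z)
        + ε / 2 ^ (k + 1) ∧
      (∀ g ∈ s.1.2, |pairing (weight Ω) s'.1.1 g - pairing (weight Ω) s.1.1 g|
        ≤ ε / 2 ^ (k + 1)) ∧ s.1.2 ⊆ s'.1.2 := by
    rintro k ⟨⟨φ, G'⟩, hφ, hG', -⟩
    obtain ⟨φ', h1, h2, h3⟩ := exists_step hκ hκ2 hΩ hφ G' hG'
      (by positivity : 0 < ε / 2 ^ (k + 1))
    refine ⟨⟨(φ', insert (velField φ') G'), h1, ?_, Finset.mem_insert_self _ _⟩, h2, h3,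
      Finset.subset_insert _ _⟩
    intro g hg
    rcases Finset.mem_insert.1 hg with rfl | hg
    · exact h1.isBddField hκ hκ2
    · exact hG' g hg
  choose next hn1 hn2 hn3 using step
  let s₀ : S := ⟨(0, insert (velField 0) G), isSubsolution_zero h₁ h₂, by
    intro g hg
    rcases Finset.mem_insert.1 hg with rfl | hg
    · exact (isSubsolution_zero (Ω := Ω) h₁ h₂).isBddField hκ hκ2
    · exact hG g hg, Finset.mem_insert_self _ _⟩
  let seq : ℕ → S := fun k => Nat.rec s₀ next k
  have hmono : Monotone fun k => (seq k).1.2 :=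
    monotone_nat_of_le_succ fun k => hn3 k (seq k)
  refine ⟨fun k => (seq k).1.1, rfl, fun k => (seq k).2.1, fun k => hn1 k (seq k),
    fun k g hg => hn2 k (seq k) g (hmono (Nat.zero_le k) (Finset.mem_insert_of_mem hg)),
    fun j k hjk => hn2 k (seq k) _ (hmono hjk (seq j).2.2.2)⟩

lemma abs_sub_le_of_step {x : ℕ → ℝ} {ε : ℝ} {i : ℕ}
    (h : ∀ k, i ≤ k → |x (k + 1) - x k| ≤ ε / 2 ^ (k + 1)) {m : ℕ} (hm : i ≤ m) :
    |x m - x i| ≤ ε / 2 ^ i - ε / 2 ^ m := by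
  induction m, hm using Nat.le_induction with
  | base => simp
  | succ m hm ih =>
    have := abs_add_le (x (m + 1) - x m) (x m - x i)
    rw [sub_add_sub_cancel] at this
    have e : ε / 2 ^ m = ε / 2 ^ (m + 1) + ε / 2 ^ (m + 1) := by rw [pow_succ]; field_simp; ring
    linarith [h m hm]

lemma integrable_vel_mul_vel (hΩ : IsOpen Ω) (hφ : IsSubsolution a₁ a₂ Ω φ)
    (hψ : IsSubsolution a₁ a₂ Ω ψ) :
    Integrable (fun z => vel₁ φ z * (vel₁ ψ z * weight Ω z)) ∧
      Integrable fun z => vel₂ φ z * (vel₂ ψ z * weight Ω z) :=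
  ⟨integrable_smooth_mul (integrable_smooth_mul (integrable_weight hΩ)
    (contDiff_vel₁ hψ.smooth) (hasCompactSupport_vel₁ hψ.compact))
    (contDiff_vel₁ hφ.smooth) (hasCompactSupport_vel₁ hφ.compact),
  integrable_smooth_mul (integrable_smooth_mul (integrable_weight hΩ)
    (contDiff_vel₂ hψ.smooth) (hasCompactSupport_vel₂ hψ.compact))
    (contDiff_vel₂ hφ.smooth) (hasCompactSupport_vel₂ hφ.compact)⟩

lemma pairing_self (hΩ : IsOpen Ω) (hφ : IsSubsolution a₁ a₂ Ω φ) :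
    pairing (weight Ω) φ (velField φ) =
      (a₁ + a₂) * (∫ z, weight Ω z) - defectIntegral a₁ a₂ (weight Ω) φ := by
  obtain ⟨i1, i2⟩ := integrable_vel_mul_vel hΩ hφ hφ
  rw [← integral_const_mul, defectIntegral, pairing, ← integral_sub]
  · refine integral_congr_ae (ae_of_all _ fun z => ?_)
    simp only [velField, defect, jet]; ring
  · exact (integrable_weight hΩ).const_mul _
  · refine (((integrable_weight hΩ).const_mul (a₁ + a₂)).sub (i1.add i2)).congr
      (ae_of_all _ fun z => ?_)
    simp only [Pi.sub_apply, Pi.add_apply, defect, jet]; ring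

lemma integral_sq_sub (hΩ : IsOpen Ω) (hφ : IsSubsolution a₁ a₂ Ω φ)
    (hψ : IsSubsolution a₁ a₂ Ω ψ) :
    Integrable (fun z => ((vel₁ φ z - vel₁ ψ z) ^ 2 + (vel₂ φ z - vel₂ ψ z) ^ 2) * weight Ω z) ∧
    ∫ z, ((vel₁ φ z - vel₁ ψ z) ^ 2 + (vel₂ φ z - vel₂ ψ z) ^ 2) * weight Ω z =
      pairing (weight Ω) φ (velField φ) + pairing (weight Ω) ψ (velField ψ)
        - 2 * pairing (weight Ω) φ (velField ψ) := by
  obtain ⟨i1, i2⟩ := integrable_vel_mul_vel hΩ hφ hφ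
  obtain ⟨j1, j2⟩ := integrable_vel_mul_vel hΩ hψ hψ
  obtain ⟨k1, k2⟩ := integrable_vel_mul_vel hΩ hφ hψ
  have i3 : Integrable fun z => vel₁ φ z * (vel₁ φ z * weight Ω z)
    + vel₂ φ z * (vel₂ φ z * weight Ω z) := i1.add i2
  have j3 : Integrable fun z => vel₁ ψ z * (vel₁ ψ z * weight Ω z)
    + vel₂ ψ z * (vel₂ ψ z * weight Ω z) := j1.add j2
  have k3 : Integrable fun z => 2 * (vel₁ φ z * (vel₁ ψ z * weight Ω z)
    + vel₂ φ z * (vel₂ ψ z * weight Ω z)) := (k1.add k2).const_mul 2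
  have l3 : Integrable fun z => (vel₁ φ z * (vel₁ φ z * weight Ω z)
    + vel₂ φ z * (vel₂ φ z * weight Ω z)) + (vel₁ ψ z * (vel₁ ψ z * weight Ω z)
    + vel₂ ψ z * (vel₂ ψ z * weight Ω z)) := i3.add j3
  have e : (fun z => ((vel₁ φ z - vel₁ ψ z) ^ 2 + (vel₂ φ z - vel₂ ψ z) ^ 2) * weight Ω z) =
      fun z => (vel₁ φ z * (vel₁ φ z * weight Ω z)
    + vel₂ φ z * (vel₂ φ z * weight Ω z)) + (vel₁ ψ z * (vel₁ ψ z * weight Ω z)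
    + vel₂ ψ z * (vel₂ ψ z * weight Ω z)) - 2 * (vel₁ φ z * (vel₁ ψ z * weight Ω z)
    + vel₂ φ z * (vel₂ ψ z * weight Ω z)) := by
    funext z; ring
  rw [e]
  refine ⟨l3.sub k3, ?_⟩
  rw [integral_sub l3 k3, integral_add i3 j3, integral_const_mul]
  rfl

/-- Almost everywhere convergence along a subsequence of a sequence of velocity fields whose
weighted `L²` distances are controlled by a null sequence. -/
lemma exists_subseq_tendsto_ae (hΩ : IsOpen Ω) (hκ : 0 < κ) (hκ2 : κ ^ 2 = a₁ + a₂)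
    {φ : ℕ → SpaceTime → ℝ} (hφ : ∀ k, IsSubsolution a₁ a₂ Ω (φ k)) {b : ℕ → ℝ}
    (hb : Tendsto b atTop (𝓝 0))
    (hdist : ∀ n m, n ≤ m → ∫ z, ((vel₁ (φ n) z - vel₁ (φ m) z) ^ 2
      + (vel₂ (φ n) z - vel₂ (φ m) z) ^ 2) * weight Ω z ≤ b n) :
    ∃ ns : ℕ → ℕ, StrictMono ns ∧ ∃ F : SpaceTime → ℝ × ℝ, Measurable F ∧
      ∀ᵐ z, z ∈ Ω → Tendsto (fun i => velField (φ (ns i)) z) atTop (𝓝 (F z)) := by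
  -- Multiplication by the square root of the weight moves the problem to unweighted `L²`; it is
  -- undone on `Ω`, where the weight is positive.
  set f : ℕ → SpaceTime → ℝ × ℝ := fun k z => Real.sqrt (weight Ω z) • velField (φ k) z with hf
  have hfm : ∀ k, Measurable (f k) := fun k =>
    (measurable_weight hΩ).sqrt.smul (measurable_velField (hφ k).smooth)
  have hsq : ∀ n m z, ‖f n z - f m z‖ ^ 2 ≤ ((vel₁ (φ n) z - vel₁ (φ m) z) ^ 2
      + (vel₂ (φ n) z - vel₂ (φ m) z) ^ 2) * weight Ω z := by
    intro n m z
    have hw := weight_nonneg (Ω := Ω) z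
    simp only [hf]
    rw [← smul_sub, norm_smul, mul_pow, Real.norm_eq_abs, sq_abs, Real.sq_sqrt hw, mul_comm]
    refine mul_le_mul_of_nonneg_right ?_ hw
    simp only [velField, Prod.mk_sub_mk, Prod.norm_mk, Real.norm_eq_abs]
    rcases max_choice |vel₁ (φ n) z - vel₁ (φ m) z| |vel₂ (φ n) z - vel₂ (φ m) z| with h | h <;>
      rw [h, sq_abs] <;> nlinarith [sq_nonneg (vel₁ (φ n) z - vel₁ (φ m) z),
        sq_nonneg (vel₂ (φ n) z - vel₂ (φ m) z)]
  have hLp : ∀ k, MemLp (f k) 2 volume := by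
    intro k
    rw [memLp_two_iff_integrable_sq_norm (hfm k).aestronglyMeasurable]
    refine ((integrable_weight hΩ).const_mul (κ ^ 2)).mono'
      ((hfm k).norm.pow_const 2).aestronglyMeasurable (ae_of_all _ fun z => ?_)
    have hw := weight_nonneg (Ω := Ω) z
    obtain ⟨h1, h2⟩ := (hφ k).abs_vel_le hκ hκ2 z
    rw [norm_pow, norm_norm]
    simp only [hf]
    rw [norm_smul, mul_pow, Real.norm_eq_abs, sq_abs, Real.sq_sqrt hw, mul_comm]
    refine mul_le_mul_of_nonneg_right ?_ hw
    exact pow_le_pow_left₀ (norm_nonneg _) (max_le h1 h2) 2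
  have hd : ∀ n m, n ≤ m → dist ((hLp n).toLp (f n)) ((hLp m).toLp (f m)) ≤ Real.sqrt (b n) := by
    intro n m hnm
    rw [dist_eq_norm, ← MemLp.toLp_sub, Lp.norm_toLp,
      ((hLp n).sub (hLp m)).eLpNorm_eq_integral_rpow_norm (by norm_num) (by norm_num),
      ENNReal.toReal_ofReal (by positivity)]
    simp only [ENNReal.toReal_ofNat, Real.rpow_ofNat, Pi.sub_apply]
    rw [← one_div, ← Real.sqrt_eq_rpow]
    refine Real.sqrt_le_sqrt (le_trans ?_ (hdist n m hnm))
    exact integral_mono_of_nonneg (ae_of_all _ fun z => by positivity)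
      (integral_sq_sub hΩ (hφ n) (hφ m)).1 (ae_of_all _ (hsq n m))
  have hb' : Tendsto (fun n => Real.sqrt (b n)) atTop (𝓝 0) := by
    simpa [Function.comp_def] using (Real.continuous_sqrt.tendsto 0).comp hb
  obtain ⟨g, hg⟩ := cauchySeq_tendsto_of_complete (cauchySeq_of_le_tendsto_0' _ hd hb')
  obtain ⟨ns, hns, hae⟩ := (tendstoInMeasure_of_tendsto_Lp hg).exists_seq_tendsto_ae
  refine ⟨ns, hns, fun z => (Real.sqrt (weight Ω z))⁻¹ • g z,
    (measurable_weight hΩ).sqrt.inv.smul (Lp.stronglyMeasurable g).measurable, ?_⟩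
  have hcoe : ∀ᵐ z, ∀ k, (hLp k).toLp (f k) z = f k z := ae_all_iff.2 fun k => (hLp k).coeFn_toLp
  filter_upwards [hae, hcoe] with z hz hc hzΩ
  have hs : Real.sqrt (weight Ω z) ≠ 0 := by
    rw [weight_of_mem hzΩ]; exact (Real.sqrt_pos.2 (decay_pos z)).ne'
  refine (hz.const_smul (Real.sqrt (weight Ω z))⁻¹).congr fun i => ?_
  rw [hc, hf]
  simp only
  rw [smul_smul, inv_mul_cancel₀ hs, one_smul]

end Iteration

end IsentropicEuler

end

/-! ### Passage to the limit: exact solutions, infinitely many -/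

noncomputable section

namespace IsentropicEuler

/-- Bounded fields `v` in `Ω`, extended by zero, with `|v|² = tr A`, `div v = 0` and
`∂ₜ v + div (v ⊗ v - A) = 0` in the sense of distributions on the whole space-time, where
`A = diag(a₁, a₂)` in `Ω` and `A = 0` elsewhere. -/
structure IsExactSolution (a₁ a₂ : ℝ) (Ω : Set SpaceTime) (v : SpaceTime → ℝ × ℝ) : Prop where
  measurable : Measurable v
  zero : ∀ z ∉ Ω, v z = 0
  speed : ∀ z ∈ Ω, (v z).1 ^ 2 + (v z).2 ^ 2 = a₁ + a₂
  div : ∀ ψ : SpaceTime → ℝ, ContDiff ℝ ∞ ψ → HasCompactSupport ψ →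
    ∫ z in Ω, ((v z).1 * dirDeriv e₁ ψ z + (v z).2 * dirDeriv e₂ ψ z) = 0
  momentum₁ : ∀ ψ : SpaceTime → ℝ, ContDiff ℝ ∞ ψ → HasCompactSupport ψ →
    ∫ z in Ω, ((v z).1 * dirDeriv eₜ ψ z + ((v z).1 ^ 2 - a₁) * dirDeriv e₁ ψ z
      + (v z).1 * (v z).2 * dirDeriv e₂ ψ z) = 0
  momentum₂ : ∀ ψ : SpaceTime → ℝ, ContDiff ℝ ∞ ψ → HasCompactSupport ψ →
    ∫ z in Ω, ((v z).2 * dirDeriv eₜ ψ z + (v z).1 * (v z).2 * dirDeriv e₁ ψ z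
      + ((v z).2 ^ 2 - a₂) * dirDeriv e₂ ψ z) = 0

section Limit

variable {a₁ a₂ κ : ℝ} {Ω : Set SpaceTime}

lemma tendsto_setIntegral_sum (hΩ : MeasurableSet Ω) {f₁ f₂ f₃ : ℕ → SpaceTime → ℝ}
    {F₁ F₂ F₃ h₁ h₂ h₃ : SpaceTime → ℝ} {B : ℝ}
    (m₁ : ∀ i, Measurable (f₁ i)) (m₂ : ∀ i, Measurable (f₂ i)) (m₃ : ∀ i, Measurable (f₃ i))
    (b₁ : ∀ i z, |f₁ i z| ≤ B) (b₂ : ∀ i z, |f₂ i z| ≤ B) (b₃ : ∀ i z, |f₃ i z| ≤ B)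
    (i₁ : Integrable h₁) (i₂ : Integrable h₂) (i₃ : Integrable h₃)
    (t : ∀ᵐ z, z ∈ Ω → Tendsto (fun i => f₁ i z) atTop (𝓝 (F₁ z)) ∧
      Tendsto (fun i => f₂ i z) atTop (𝓝 (F₂ z)) ∧ Tendsto (fun i => f₃ i z) atTop (𝓝 (F₃ z))) :
    Tendsto (fun i => ∫ z in Ω, (f₁ i z * h₁ z + f₂ i z * h₂ z + f₃ i z * h₃ z)) atTop
      (𝓝 (∫ z in Ω, (F₁ z * h₁ z + F₂ z * h₂ z + F₃ z * h₃ z))) := by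
  refine tendsto_integral_of_dominated_convergence
    (fun z => B * |h₁ z| + B * |h₂ z| + B * |h₃ z|) (fun i => ?_) ?_ (fun i => ?_) ?_
  · exact (((m₁ i).aestronglyMeasurable.mul i₁.1.restrict).add
      ((m₂ i).aestronglyMeasurable.mul i₂.1.restrict)).add
      ((m₃ i).aestronglyMeasurable.mul i₃.1.restrict)
  · exact (((i₁.abs.const_mul B).add (i₂.abs.const_mul B)).add (i₃.abs.const_mul B)).restrict
  · refine ae_of_all _ fun z => ?_
    refine (norm_add_le _ _).trans (add_le_add ((norm_add_le _ _).trans (add_le_add ?_ ?_)) ?_) <;>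
      rw [norm_mul]
    · exact mul_le_mul_of_nonneg_right (b₁ i z) (abs_nonneg _)
    · exact mul_le_mul_of_nonneg_right (b₂ i z) (abs_nonneg _)
    · exact mul_le_mul_of_nonneg_right (b₃ i z) (abs_nonneg _)
  · rw [ae_restrict_iff' hΩ]
    filter_upwards [t] with z hz hzΩ
    obtain ⟨h1, h2, h3⟩ := hz hzΩ
    exact ((h1.mul_const _).add (h2.mul_const _)).add (h3.mul_const _)

/-- The entries of a positive definite matrix are bounded by its trace. Applied to `A - w ⊗ w + u`,
this makes the stress nonlinear in the limit: zero defect forces `u = w ⊗ w - A`. -/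
lemma abs_stress_sub_le {p : ℝ × ℝ × ℝ × ℝ} (hp : p ∈ subsolutionSet a₁ a₂) :
    |p.2.2.1 - (p.1 ^ 2 - a₁)| ≤ defect a₁ a₂ p ∧ |p.2.2.2 - p.1 * p.2.1| ≤ defect a₁ a₂ p := by
  obtain ⟨hA, hB⟩ := diag_pos_of_mem hp
  have hd : defect a₁ a₂ p = (a₁ - p.1 ^ 2 + p.2.2.1) + (a₂ - p.2.1 ^ 2 - p.2.2.1) := by
    simp only [defect]; ring
  constructor
  · rw [abs_of_pos (by linarith), hd]; linarith
  · refine abs_le_of_sq_le_sq ?_ hp.1.le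
    have := hp.2
    simp only [defectDet] at this
    rw [hd]
    nlinarith [mul_pos hA hB, sq_nonneg (a₁ - p.1 ^ 2 + p.2.2.1),
      sq_nonneg (a₂ - p.2.1 ^ 2 - p.2.2.1)]

lemma IsSubsolution.abs_str_le {φ : SpaceTime → ℝ} (hφ : IsSubsolution a₁ a₂ Ω φ) (h₁ : 0 < a₁)
    (h₂ : 0 < a₂) (z : SpaceTime) :
    |str₁ φ z| ≤ 2 * (a₁ + a₂) ∧ |str₂ φ z| ≤ 2 * (a₁ + a₂) := by
  obtain ⟨h3, h4⟩ := abs_stress_sub_le (hφ.mem z)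
  have h5 := hφ.sq_vel_lt z
  have h6 : defect a₁ a₂ (jet φ z) ≤ a₁ + a₂ := defect_le _
  simp only [jet] at h3 h4 h6
  rw [abs_le] at h3 h4
  constructor <;> rw [abs_le] <;> constructor <;>
    nlinarith [sq_nonneg (vel₁ φ z), sq_nonneg (vel₂ φ z), sq_nonneg (vel₁ φ z - vel₂ φ z),
      sq_nonneg (vel₁ φ z + vel₂ φ z)]

lemma tendsto_stress {p : ℕ → ℝ × ℝ × ℝ × ℝ} (hp : ∀ i, p i ∈ subsolutionSet a₁ a₂) {x y : ℝ}
    (hx : Tendsto (fun i => (p i).1) atTop (𝓝 x)) (hy : Tendsto (fun i => (p i).2.1) atTop (𝓝 y))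
    (hxy : x ^ 2 + y ^ 2 = a₁ + a₂) :
    Tendsto (fun i => (p i).2.2.1) atTop (𝓝 (x ^ 2 - a₁)) ∧
      Tendsto (fun i => (p i).2.2.2) atTop (𝓝 (x * y)) := by
  have hd : Tendsto (fun i => defect a₁ a₂ (p i)) atTop (𝓝 0) := by
    have : Tendsto (fun i => a₁ + a₂ - (p i).1 ^ 2 - (p i).2.1 ^ 2) atTop
      (𝓝 (a₁ + a₂ - x ^ 2 - y ^ 2)) := (tendsto_const_nhds.sub (hx.pow 2)).sub (hy.pow 2)
    rwa [show a₁ + a₂ - x ^ 2 - y ^ 2 = 0 by linarith] at this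
  have t1 : Tendsto (fun i => (p i).2.2.1 - ((p i).1 ^ 2 - a₁)) atTop (𝓝 0) :=
    squeeze_zero_norm (fun i => (abs_stress_sub_le (hp i)).1) hd
  have t2 : Tendsto (fun i => (p i).2.2.2 - (p i).1 * (p i).2.1) atTop (𝓝 0) :=
    squeeze_zero_norm (fun i => (abs_stress_sub_le (hp i)).2) hd
  constructor
  · simpa using t1.add ((hx.pow 2).sub_const a₁)
  · simpa using t2.add (hx.mul hy)

/-- Convex integration: exact solutions exist, and they can be chosen almost orthogonal to
finitely many given fields. -/
theorem exists_exactSolution (hΩ : IsOpen Ω) (h₁ : 0 < a₁) (h₂ : 0 < a₂)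
    (G : Finset (SpaceTime → ℝ × ℝ)) (hG : ∀ g ∈ G, IsBddField g) {ε : ℝ} (hε : 0 < ε) :
    ∃ v, IsExactSolution a₁ a₂ Ω v ∧
      ∀ g ∈ G, |∫ z in Ω, ((v z).1 * (g z).1 + (v z).2 * (g z).2) * decay z| ≤ ε := by
  set κ := Real.sqrt (a₁ + a₂) with hκd
  have hκ : 0 < κ := Real.sqrt_pos.2 (by linarith)
  have hκ2 : κ ^ 2 = a₁ + a₂ := Real.sq_sqrt (by linarith)
  obtain ⟨φ, hφ0, hφ, hI, hP, hO⟩ := exists_subsolution_seq hκ hκ2 hΩ h₁ h₂ G hG hε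
  set I := fun k => defectIntegral a₁ a₂ (weight Ω) (φ k) with hId
  set J := fun k => ∫ z, defect a₁ a₂ (jet (φ k) z) ^ 2 * weight Ω z with hJd
  set β := (4096 * κ ^ 2)⁻¹ with hβ
  have hβ0 : 0 < β := by positivity
  have hJ0 : ∀ k, 0 ≤ J k := fun k =>
    integral_nonneg fun z => mul_nonneg (sq_nonneg _) (weight_nonneg z)
  have hI0 : ∀ k, 0 ≤ I k := fun k =>
    integral_nonneg fun z => mul_nonneg ((hφ k).mem z).1.le (weight_nonneg z)
  have hhalf : ∀ k, ε / 2 ^ k = ε / 2 ^ (k + 1) + ε / 2 ^ (k + 1) := fun k => by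
    rw [pow_succ]; field_simp; ring
  -- The geometric tail absorbs the errors `ε / 2 ^ (k + 1)` of the steps, so that `a` is monotone.
  set a := fun k => I k + ε / 2 ^ k with had
  have hstep : ∀ k, a (k + 1) ≤ a k - β * J k := fun k => by
    have := hI k
    simp only [had]
    rw [hhalf k]
    simp only [hId, hJd]
    linarith
  have hanti : Antitone a := antitone_nat_of_succ_le fun k => by
    have := mul_nonneg hβ0.le (hJ0 k)
    linarith [hstep k]
  have hbdd : BddBelow (range a) := ⟨0, by
    rintro _ ⟨k, rfl⟩
    exact add_nonneg (hI0 k) (by positivity)⟩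
  have hlim := tendsto_atTop_ciInf hanti hbdd
  set L := ⨅ k, a k with hL
  have hLle : ∀ k, L ≤ a k := fun k => ciInf_le hbdd k
  -- The integral of the squared defect is bounded by a multiple of the decrements of a convergent
  -- monotone sequence.
  have hJlim : Tendsto J atTop (𝓝 0) := by
    have h1 : Tendsto (fun k => (a k - a (k + 1)) / β) atTop (𝓝 0) := by
      simpa using (hlim.sub (hlim.comp (tendsto_add_atTop_nat 1))).div_const β
    refine squeeze_zero hJ0 (fun k => ?_) h1
    rw [le_div_iff₀ hβ0]
    linarith [hstep k]
  have hpow : Tendsto (fun n : ℕ => ε / 2 ^ n) atTop (𝓝 0) := by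
    have := (tendsto_pow_atTop_nhds_zero_of_lt_one (by norm_num : (0 : ℝ) ≤ 1 / 2)
      (by norm_num)).const_mul ε
    simpa [div_eq_mul_inv] using this
  have hb : Tendsto (fun n => a n - L + 3 * (ε / 2 ^ n)) atTop (𝓝 0) := by
    simpa using (hlim.sub_const L).add (hpow.const_mul 3)
  -- Since later increments are nearly orthogonal to the `n`-th velocity, the squared distance of
  -- the `n`-th and the `m`-th is the difference of their squared norms up to `2ε / 2 ^ n`. By
  -- `pairing_self` that difference is the decrease of the defect integral, which is controlled by
  -- `a n - L`.
  obtain ⟨ns, hns, F, hFm, hF⟩ := exists_subseq_tendsto_ae hΩ hκ hκ2 hφ hb (fun n m hnm => by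
    have e := (integral_sq_sub hΩ (hφ m) (hφ n)).2
    rw [pairing_self hΩ (hφ m), pairing_self hΩ (hφ n)] at e
    have e' := pairing_self hΩ (hφ n)
    have hp := abs_sub_le_of_step (x := fun k => pairing (weight Ω) (φ k) (velField (φ n)))
      (ε := ε) (i := n) (fun k hk => hO n k hk) hnm
    have hle : ε / 2 ^ m ≤ ε / 2 ^ n := by gcongr; norm_num
    have hm0 : 0 < ε / 2 ^ m := by positivity
    have hLm := hLle m
    simp only [had, hId] at hLm ⊢
    rw [abs_le] at hp
    simp_rw [sub_sq_comm (vel₁ (φ n) _), sub_sq_comm (vel₂ (φ n) _)]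
    rw [e]
    linarith [hp.1])
  -- The integral of the squared limiting defect is the limit of `J (ns i)`, hence zero.
  have hF1 : ∀ᵐ z, z ∈ Ω → (F z).1 ^ 2 + (F z).2 ^ 2 = a₁ + a₂ := by
    have hsupp : ∀ k, J k = ∫ z in Ω, defect a₁ a₂ (jet (φ k) z) ^ 2 * weight Ω z := fun k =>
      (setIntegral_eq_integral_of_forall_compl_eq_zero fun z hz => by
        simp [weight, indicator_of_notMem hz]).symm
    have h1 : Tendsto (fun i => J (ns i)) atTop
        (𝓝 (∫ z in Ω, (a₁ + a₂ - (F z).1 ^ 2 - (F z).2 ^ 2) ^ 2 * weight Ω z)) := by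
      simp_rw [hsupp]
      refine tendsto_integral_of_dominated_convergence (fun z => (a₁ + a₂) ^ 2 * weight Ω z)
        (fun i => (integrable_defect_sq hΩ (hφ (ns i))).1.restrict)
        ((integrable_weight hΩ).const_mul _).restrict (fun i => ae_of_all _ fun z => ?_) ?_
      · rw [Real.norm_of_nonneg (mul_nonneg (sq_nonneg _) (weight_nonneg z))]
        have := ((hφ (ns i)).mem z).1
        exact mul_le_mul_of_nonneg_right (pow_le_pow_left₀ this.le (defect_le _) 2)
          (weight_nonneg z)
      · rw [ae_restrict_iff' hΩ.measurableSet]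
        filter_upwards [hF] with z hz hzΩ
        have t := hz hzΩ
        have t1 := (continuous_fst.tendsto _).comp t
        have t2 := (continuous_snd.tendsto _).comp t
        exact (((tendsto_const_nhds.sub (t1.pow 2)).sub (t2.pow 2)).pow 2).mul_const _
    have h2 := tendsto_nhds_unique h1 (hJlim.comp hns.tendsto_atTop)
    rw [integral_eq_zero_iff_of_nonneg
      (fun z => mul_nonneg (sq_nonneg _) (weight_nonneg z)) ?_] at h2
    · have h3 := (ae_restrict_iff' hΩ.measurableSet).1 h2
      filter_upwards [h3] with z hz hzΩ
      have := hz hzΩ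
      simp only [Pi.zero_apply] at this
      rw [weight_of_mem hzΩ] at this
      have h4 := pow_eq_zero_iff (two_ne_zero) |>.1
        ((mul_eq_zero.1 this).resolve_right (decay_pos z).ne')
      linarith
    · refine ((integrable_weight hΩ).const_mul ((a₁ + a₂) ^ 2)).restrict.mono' ?_ ?_
      · exact ((((measurable_const.sub (hFm.fst.pow_const 2)).sub (hFm.snd.pow_const 2)).pow_const
          2).mul (measurable_weight hΩ)).aestronglyMeasurable
      · rw [ae_restrict_iff' hΩ.measurableSet]
        filter_upwards [hF] with z hz hzΩ
        have t := hz hzΩ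
        have t1 := (continuous_fst.tendsto _).comp t
        have t2 := (continuous_snd.tendsto _).comp t
        have t3 := (((tendsto_const_nhds (x := a₁ + a₂)).sub (t1.pow 2)).sub (t2.pow 2))
        rw [norm_mul, Real.norm_of_nonneg (weight_nonneg z), norm_pow]
        refine mul_le_mul_of_nonneg_right (pow_le_pow_left₀ (norm_nonneg _) ?_ 2)
          (weight_nonneg z)
        refine le_of_tendsto t3.norm (Eventually.of_forall fun i => ?_)
        have hm := ((hφ (ns i)).mem z).1
        have hm2 : defect a₁ a₂ (jet (φ (ns i)) z) ≤ a₁ + a₂ := defect_le _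
        simp only [defect, jet] at hm hm2
        simp only [Function.comp, velField]
        rw [Real.norm_of_nonneg hm.le]
        exact hm2
  -- The limit is changed on a null set so that the modulus is right at every point. This matters
  -- later: energies are integrals over single time slices, which are null sets of space-time.
  set T : Set SpaceTime := {z | (F z).1 ^ 2 + (F z).2 ^ 2 = a₁ + a₂} with hT
  have hTm : MeasurableSet T := measurableSet_eq_fun
    ((hFm.fst.pow_const 2).add (hFm.snd.pow_const 2)) measurable_const
  classical
  set v : SpaceTime → ℝ × ℝ := fun z => if z ∈ Ω then (if z ∈ T then F z else (κ, 0)) else 0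
    with hv
  have hvm : Measurable v := Measurable.ite hΩ.measurableSet
    (Measurable.ite hTm hFm measurable_const) measurable_const
  have hlimv : ∀ᵐ z, z ∈ Ω → (v z).1 ^ 2 + (v z).2 ^ 2 = a₁ + a₂ ∧
      Tendsto (fun i => vel₁ (φ (ns i)) z) atTop (𝓝 (v z).1) ∧
      Tendsto (fun i => vel₂ (φ (ns i)) z) atTop (𝓝 (v z).2) ∧
      Tendsto (fun i => str₁ (φ (ns i)) z) atTop (𝓝 ((v z).1 ^ 2 - a₁)) ∧
      Tendsto (fun i => str₂ (φ (ns i)) z) atTop (𝓝 ((v z).1 * (v z).2)) := by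
    filter_upwards [hF, hF1] with z hz hz1 hzΩ
    have hvz : v z = F z := by
      have : z ∈ T := hz1 hzΩ
      simp [hv, hzΩ, this]
    rw [hvz]
    have t1 : Tendsto (fun i => vel₁ (φ (ns i)) z) atTop (𝓝 (F z).1) :=
      (continuous_fst.tendsto _).comp (hz hzΩ)
    have t2 : Tendsto (fun i => vel₂ (φ (ns i)) z) atTop (𝓝 (F z).2) :=
      (continuous_snd.tendsto _).comp (hz hzΩ)
    obtain ⟨t3, t4⟩ := tendsto_stress (p := fun i => jet (φ (ns i)) z)
      (fun i => (hφ (ns i)).mem z) t1 t2 (hz1 hzΩ)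
    exact ⟨hz1 hzΩ, t1, t2, t3, t4⟩
  set B := κ + 2 * (a₁ + a₂) with hB
  have hB1 : ∀ i z, |vel₁ (φ (ns i)) z| ≤ B := fun i z =>
    ((hφ (ns i)).abs_vel_le hκ hκ2 z).1.trans (by linarith)
  have hB2 : ∀ i z, |vel₂ (φ (ns i)) z| ≤ B := fun i z =>
    ((hφ (ns i)).abs_vel_le hκ hκ2 z).2.trans (by linarith)
  have hB3 : ∀ i z, |str₁ (φ (ns i)) z| ≤ B := fun i z =>
    ((hφ (ns i)).abs_str_le h₁ h₂ z).1.trans (by linarith)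
  have hB4 : ∀ i z, |str₂ (φ (ns i)) z| ≤ B := fun i z =>
    ((hφ (ns i)).abs_str_le h₁ h₂ z).2.trans (by linarith)
  have hm1 : ∀ i, Measurable (vel₁ (φ (ns i))) := fun i =>
    (contDiff_vel₁ (hφ (ns i)).smooth).continuous.measurable
  have hm2 : ∀ i, Measurable (vel₂ (φ (ns i))) := fun i =>
    (contDiff_vel₂ (hφ (ns i)).smooth).continuous.measurable
  have hm3 : ∀ i, Measurable (str₁ (φ (ns i))) := fun i =>
    (contDiff_str₁ (hφ (ns i)).smooth).continuous.measurable
  have hm4 : ∀ i, Measurable (str₂ (φ (ns i))) := fun i =>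
    (contDiff_str₂ (hφ (ns i)).smooth).continuous.measurable
  have hout : ∀ i, ∀ z ∉ Ω, jet (φ (ns i)) z = 0 := fun i z hz =>
    jet_eq_zero fun h => hz ((hφ (ns i)).support h)
  have ho1 : ∀ i, ∀ z ∉ Ω, vel₁ (φ (ns i)) z = 0 := fun i z hz => congrArg (·.1) (hout i z hz)
  have ho2 : ∀ i, ∀ z ∉ Ω, vel₂ (φ (ns i)) z = 0 := fun i z hz => congrArg (·.2.1) (hout i z hz)
  have ho3 : ∀ i, ∀ z ∉ Ω, str₁ (φ (ns i)) z = 0 := fun i z hz => congrArg (·.2.2.1) (hout i z hz)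
  have ho4 : ∀ i, ∀ z ∉ Ω, str₂ (φ (ns i)) z = 0 := fun i z hz => congrArg (·.2.2.2) (hout i z hz)
  have hint : ∀ {ψ : SpaceTime → ℝ}, ContDiff ℝ ∞ ψ → HasCompactSupport ψ → ∀ u,
      Integrable (dirDeriv u ψ) := fun hψ hψ' u =>
    integrable_of_smooth (contDiff_dirDeriv hψ u) (hasCompactSupport_dirDeriv hψ' u)
  refine ⟨v, ⟨hvm, fun z hz => by simp [hv, hz], fun z hz => ?_, fun ψ hψ hψ' => ?_,
    fun ψ hψ hψ' => ?_, fun ψ hψ hψ' => ?_⟩, fun g hg => ?_⟩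
  · by_cases hzT : z ∈ T
    · simp only [hv, hz, hzT, if_true]; exact hzT
    · simp [hv, hz, hzT, hκ2]
  · have t := tendsto_setIntegral_sum hΩ.measurableSet hm1 hm2 (f₃ := fun _ _ => 0)
      (fun _ => measurable_const) hB1 hB2 (fun _ _ => by rw [abs_zero]; positivity)
      (hint hψ hψ' e₁) (hint hψ hψ' e₂) (integrable_zero SpaceTime ℝ volume)
      (F₁ := fun z => (v z).1) (F₂ := fun z => (v z).2) (F₃ := fun _ => 0)
      (hlimv.mono fun z h hz => ⟨(h hz).2.1, (h hz).2.2.1, tendsto_const_nhds⟩)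
    simp only [zero_mul, add_zero] at t
    refine tendsto_nhds_unique (t.congr fun i => ?_) tendsto_const_nhds
    rw [setIntegral_eq_integral_of_forall_compl_eq_zero fun z hz => by
      rw [ho1 i z hz, ho2 i z hz]; ring]
    exact integral_vel_mul_grad (hφ (ns i)).smooth (hφ (ns i)).compact hψ
  · have t := tendsto_setIntegral_sum hΩ.measurableSet hm1 hm3 hm4 hB1 hB3 hB4
      (hint hψ hψ' eₜ) (hint hψ hψ' e₁) (hint hψ hψ' e₂)
      (F₁ := fun z => (v z).1) (F₂ := fun z => (v z).1 ^ 2 - a₁) (F₃ := fun z => (v z).1 * (v z).2)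
      (hlimv.mono fun z h hz => ⟨(h hz).2.1, (h hz).2.2.2.1, (h hz).2.2.2.2⟩)
    refine tendsto_nhds_unique (t.congr fun i => ?_) tendsto_const_nhds
    rw [setIntegral_eq_integral_of_forall_compl_eq_zero fun z hz => by
      rw [ho1 i z hz, ho3 i z hz, ho4 i z hz]; ring]
    exact integral_momentum₁ (hφ (ns i)).smooth (hφ (ns i)).compact hψ
  · have t := tendsto_setIntegral_sum hΩ.measurableSet hm2 hm4 (fun i => (hm3 i).neg) hB2 hB4
      (fun i z => by simpa using hB3 i z)
      (hint hψ hψ' eₜ) (hint hψ hψ' e₁) (hint hψ hψ' e₂)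
      (F₁ := fun z => (v z).2) (F₂ := fun z => (v z).1 * (v z).2) (F₃ := fun z => (v z).2 ^ 2 - a₂)
      (hlimv.mono fun z h hz => ⟨(h hz).2.2.1, (h hz).2.2.2.2, by
        -- The stress is trace-free, and `|v|² = a₁ + a₂` identifies the limit of `-str₁` with `v₂²
        -- - a₂`.
        have := (h hz).2.2.2.1.neg
        rwa [show -((v z).1 ^ 2 - a₁) = (v z).2 ^ 2 - a₂ by linarith [(h hz).1]] at this⟩)
    refine tendsto_nhds_unique (t.congr fun i => ?_) tendsto_const_nhds
    rw [setIntegral_eq_integral_of_forall_compl_eq_zero fun z hz => by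
      simp only [Pi.neg_apply]
      rw [ho2 i z hz, ho3 i z hz, ho4 i z hz]; ring]
    exact integral_momentum₂ (hφ (ns i)).smooth (hφ (ns i)).compact hψ
  · have t := tendsto_setIntegral_sum hΩ.measurableSet hm1 hm2 (f₃ := fun _ _ => 0)
      (fun _ => measurable_const) hB1 hB2 (fun _ _ => by rw [abs_zero]; positivity)
      ((hG g hg).integrable_fst (integrable_weight hΩ))
      ((hG g hg).integrable_snd (integrable_weight hΩ)) (integrable_zero SpaceTime ℝ volume)
      (F₁ := fun z => (v z).1) (F₂ := fun z => (v z).2) (F₃ := fun _ => 0)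
      (hlimv.mono fun z h hz => ⟨(h hz).2.1, (h hz).2.2.1, tendsto_const_nhds⟩)
    simp only [zero_mul, add_zero] at t
    have e : ∫ z in Ω, ((v z).1 * (g z).1 + (v z).2 * (g z).2) * decay z
        = ∫ z in Ω, ((v z).1 * ((g z).1 * weight Ω z) + (v z).2 * ((g z).2 * weight Ω z)) := by
      refine setIntegral_congr_fun hΩ.measurableSet fun z hz => ?_
      simp only [weight_of_mem hz]; ring
    rw [e]
    refine le_of_tendsto t.abs (Eventually.of_forall fun i => ?_)
    rw [setIntegral_eq_integral_of_forall_compl_eq_zero fun z hz => by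
      rw [ho1 i z hz, ho2 i z hz]; ring]
    have hp := abs_sub_le_of_step (x := fun k => pairing (weight Ω) (φ k) g)
      (ε := ε) (i := 0) (fun k _ => hP k g hg) (Nat.zero_le (ns i))
    have h0 : pairing (weight Ω) (φ 0) g = 0 := by
      have hj : ∀ z, jet (0 : SpaceTime → ℝ) z = 0 := fun z => jet_eq_zero (by simp [tsupport])
      have hj1 : ∀ z, vel₁ (0 : SpaceTime → ℝ) z = 0 := fun z => congrArg (·.1) (hj z)
      have hj2 : ∀ z, vel₂ (0 : SpaceTime → ℝ) z = 0 := fun z => congrArg (·.2.1) (hj z)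
      simp [pairing, hφ0, hj1, hj2]
    rw [h0, sub_zero] at hp
    refine hp.trans ?_
    have : 0 < ε / 2 ^ ns i := by positivity
    simp only [pow_zero, div_one]
    linarith

/-- There are infinitely many exact solutions. -/
theorem exists_seq_exactSolution (hΩ : IsOpen Ω) (hne : Ω.Nonempty) (h₁ : 0 < a₁) (h₂ : 0 < a₂) :
    ∃ v : ℕ → SpaceTime → ℝ × ℝ, (∀ n, IsExactSolution a₁ a₂ Ω (v n)) ∧
      ∀ m n, m ≠ n → ¬ v m =ᵐ[volume.restrict Ω] v n := by
  -- All exact solutions have the squared weighted norm `S`. Each is chosen with pairing at most `S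
  -- / 2` with every earlier one, so it cannot coincide with one of them.
  set S := ∫ z in Ω, (a₁ + a₂) * decay z with hS
  have hSpos : 0 < S := by
    rw [hS, integral_const_mul]
    refine mul_pos (by linarith) ?_
    rw [setIntegral_pos_iff_support_of_nonneg_ae (ae_of_all _ fun z => (decay_pos z).le)
      integrable_decay.integrableOn]
    have : Function.support decay = univ := by
      ext z; simp [(decay_pos z).ne']
    rw [this, univ_inter]
    exact hΩ.measure_pos volume hne
  have hbd : ∀ v, IsExactSolution a₁ a₂ Ω v → IsBddField v := by
    refine fun v hv => ⟨hv.measurable, Real.sqrt (a₁ + a₂), fun z => ?_⟩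
    by_cases hz : z ∈ Ω
    · have := hv.speed z hz
      exact max_le (Real.abs_le_sqrt (by nlinarith [sq_nonneg (v z).2]))
        (Real.abs_le_sqrt (by nlinarith [sq_nonneg (v z).1]))
    · rw [hv.zero z hz, norm_zero]; positivity
  obtain ⟨v, hv1, hv2⟩ := exists_seq_of_forall_finset_exists (IsExactSolution a₁ a₂ Ω)
    (fun g v => |∫ z in Ω, ((v z).1 * (g z).1 + (v z).2 * (g z).2) * decay z| ≤ S / 2)
    (fun s hs => exists_exactSolution hΩ h₁ h₂ s (fun g hg => hbd g (hs g hg)) (half_pos hSpos))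
  have key : ∀ m n, m < n → ¬ v m =ᵐ[volume.restrict Ω] v n := by
    intro m n hmn heq
    have h := hv2 m n hmn
    have e : ∫ z in Ω, ((v n z).1 * (v m z).1 + (v n z).2 * (v m z).2) * decay z = S := by
      rw [hS]
      refine integral_congr_ae ?_
      filter_upwards [heq, ae_restrict_mem hΩ.measurableSet] with z hz hzΩ
      rw [hz, ← (hv1 n).speed z hzΩ]; ring
    rw [e, abs_of_pos hSpos] at h
    linarith
  refine ⟨v, hv1, fun m n hmn => ?_⟩
  rcases lt_or_gt_of_ne hmn with h | h
  · exact key m n h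
  · exact fun heq => key n m h heq.symm

end Limit

end IsentropicEuler

end

/-! ### Integrals over moving half-spaces and the Rankine-Hugoniot conditions -/

noncomputable section

namespace IsentropicEuler

/-- The part of the half-space `x₂ < s t` at positive times. -/
def halfSpace (s : ℝ) : Set SpaceTime := {z | z.1 1 < s * z.2} ∩ upperHalf

/-- The total flux of a test function through the hyperplane `x₂ = s t`, `t > 0`. -/
def interfaceIntegral (s : ℝ) (ψ : SpaceTime → ℝ) : ℝ := ∫ z in halfSpace s, dirDeriv e₂ ψ z

section HalfSpace

variable {ψ : SpaceTime → ℝ}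

lemma measurableSet_upperHalf : MeasurableSet upperHalf :=
  (isOpen_lt continuous_const continuous_snd).measurableSet

lemma continuous_coord (i : Fin 2) : Continuous fun z : SpaceTime => z.1 i := by fun_prop

lemma measurableSet_halfSpace (s : ℝ) : MeasurableSet (halfSpace s) :=
  (isOpen_lt (continuous_coord 1)
    (continuous_const.mul continuous_snd)).measurableSet.inter measurableSet_upperHalf

/-- Integration by parts against the indicator of `S`, whose line derivative along `v` is zero
because `S` is invariant under translations along `v`. -/
lemma setIntegral_dirDeriv_eq_zero (hψ : ContDiff ℝ ∞ ψ) (hψ' : HasCompactSupport ψ)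
    {S : Set SpaceTime} (hS : MeasurableSet S) {v : SpaceTime}
    (hinv : ∀ z, ∀ h : ℝ, z + h • v ∈ S ↔ z ∈ S) : ∫ z in S, dirDeriv v ψ z = 0 := by
  classical
  have i1 := (integrable_of_smooth (contDiff_dirDeriv hψ v)
    (hasCompactSupport_dirDeriv hψ' v)).indicator hS
  have i2 := (integrable_of_smooth hψ hψ').indicator hS
  have h := integral_bilinear_hasLineDerivAt_right_eq_neg_left_of_integrable
    (μ := (volume : Measure SpaceTime)) (B := ContinuousLinearMap.mul ℝ ℝ) (v := v)
    (f := S.indicator 1) (f' := 0) (g := ψ) (g' := dirDeriv v ψ) (by simp)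
    (i1.congr (ae_of_all _ fun z => by by_cases hz : z ∈ S <;> simp [hz]))
    (i2.congr (ae_of_all _ fun z => by by_cases hz : z ∈ S <;> simp [hz]))
    (fun z _ => by
      have : (fun t : ℝ => S.indicator (1 : SpaceTime → ℝ) (z + t • v))
          = fun _ => S.indicator 1 z := by
        funext t
        by_cases hz : z ∈ S
        · rw [indicator_of_mem hz, indicator_of_mem ((hinv z t).2 hz)]; rfl
        · rw [indicator_of_notMem hz, indicator_of_notMem (fun h => hz ((hinv z t).1 h))]
      rw [HasLineDerivAt, this]
      exact hasDerivAt_const _ _)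
    (fun z _ => (differentiable_of_smooth hψ z).hasFDerivAt.hasLineDerivAt v)
  rw [← integral_indicator hS]
  simp only [ContinuousLinearMap.mul_apply', Pi.zero_apply, zero_mul, integral_zero, neg_zero] at h
  rw [← h]
  refine integral_congr_ae (ae_of_all _ fun z => ?_)
  by_cases hz : z ∈ S <;> simp [hz]

lemma integral_upperHalf_e₁ (hψ : ContDiff ℝ ∞ ψ) (hψ' : HasCompactSupport ψ) :
    ∫ z in upperHalf, dirDeriv e₁ ψ z = 0 :=
  setIntegral_dirDeriv_eq_zero hψ hψ' measurableSet_upperHalf fun z h => by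
    simp [upperHalf, e₁]

lemma integral_upperHalf_e₂ (hψ : ContDiff ℝ ∞ ψ) (hψ' : HasCompactSupport ψ) :
    ∫ z in upperHalf, dirDeriv e₂ ψ z = 0 :=
  setIntegral_dirDeriv_eq_zero hψ hψ' measurableSet_upperHalf fun z h => by
    simp [upperHalf, e₂]

lemma integral_halfSpace_e₁ (hψ : ContDiff ℝ ∞ ψ) (hψ' : HasCompactSupport ψ) (s : ℝ) :
    ∫ z in halfSpace s, dirDeriv e₁ ψ z = 0 :=
  setIntegral_dirDeriv_eq_zero hψ hψ' (measurableSet_halfSpace s) fun z h => by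
    simp [halfSpace, upperHalf, e₁]

lemma hasCompactSupport_slice (hψ' : HasCompactSupport ψ) (x : Plane) :
    HasCompactSupport fun t => ψ (x, t) := by
  refine HasCompactSupport.intro (hψ'.image continuous_snd) fun t ht => ?_
  exact image_eq_zero_of_notMem_tsupport fun h => ht ⟨_, h, rfl⟩

lemma integral_time (hψ : ContDiff ℝ ∞ ψ) (hψ' : HasCompactSupport ψ) (A : Set Plane) :
    ∫ z in A ×ˢ Ioi (0 : ℝ), dirDeriv eₜ ψ z = - ∫ x in A, ψ (x, 0) := by
  have hi := integrable_of_smooth (contDiff_dirDeriv hψ eₜ) (hasCompactSupport_dirDeriv hψ' eₜ)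
  rw [Measure.volume_eq_prod] at hi ⊢
  rw [setIntegral_prod _ hi.integrableOn, ← integral_neg]
  refine integral_congr_ae (ae_of_all _ fun x => ?_)
  have h1 : ContDiff ℝ 1 fun t => ψ (x, t) :=
    (hψ.comp (contDiff_const.prodMk contDiff_id)).of_le (by exact_mod_cast le_top)
  have h2 := (hasCompactSupport_slice hψ' x).integral_Ioi_deriv_eq h1 0
  simp only at h2 ⊢
  rw [← h2]
  refine integral_congr_ae (ae_of_all _ fun t => ?_)
  have hd : HasDerivAt (fun t : ℝ => (x, t)) ((0 : Plane), (1 : ℝ)) t :=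
    (hasDerivAt_const t x).prodMk (hasDerivAt_id t)
  exact (((differentiable_of_smooth hψ (x, t)).hasFDerivAt.comp_hasDerivAt t hd).deriv).symm

lemma integral_upperHalf_eₜ (hψ : ContDiff ℝ ∞ ψ) (hψ' : HasCompactSupport ψ) :
    ∫ z in upperHalf, dirDeriv eₜ ψ z = - ∫ x, ψ (x, 0) := by
  have : upperHalf = (univ : Set Plane) ×ˢ Ioi (0 : ℝ) := by ext z; simp [upperHalf]
  rw [this, integral_time hψ hψ', setIntegral_univ]

/-- The Galilean shear `(x, t) ↦ (x + s t e₂, t)`. -/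
def shear (s : ℝ) : SpaceTime →L[ℝ] SpaceTime :=
  ContinuousLinearMap.id ℝ SpaceTime + (s • ContinuousLinearMap.snd ℝ Plane ℝ).smulRight e₂

lemma shear_apply (s : ℝ) (z : SpaceTime) : shear s z = z + (s * z.2) • e₂ := by
  simp [shear]

lemma shear_snd (s : ℝ) (z : SpaceTime) : (shear s z).2 = z.2 := by simp [shear_apply, e₂]

lemma shear_leftInverse (s : ℝ) : Function.LeftInverse (shear (-s)) (shear s) := fun z => by
  rw [shear_apply (-s), shear_snd, shear_apply, add_assoc, ← add_smul]
  simp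

/-- The shear as an equivalence. -/
def shearEquiv (s : ℝ) : SpaceTime ≃L[ℝ] SpaceTime :=
  ContinuousLinearEquiv.equivOfInverse (shear s) (shear (-s)) (shear_leftInverse s)
    (fun z => by have h := shear_leftInverse (-s) z; rwa [neg_neg] at h)

lemma shearEquiv_apply (s : ℝ) (z : SpaceTime) : shearEquiv s z = shear s z := rfl

lemma measurePreserving_shear (s : ℝ) : MeasurePreserving (shearEquiv s) := by
  have h1 : MeasurePreserving (fun p : ℝ × Plane => (p.1, p.2 + (s * p.1) • e₂.1))
      (volume.prod volume) (volume.prod volume) :=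
    (MeasurePreserving.id (volume : Measure ℝ)).skew_product
      (g := fun t x => x + (s * t) • e₂.1) (by fun_prop)
      (ae_of_all _ fun t => map_add_right_eq_self _ _)
  have h2 := (Measure.measurePreserving_swap.comp h1).comp
    (Measure.measurePreserving_swap (μ := (volume : Measure Plane)) (ν := (volume : Measure ℝ)))
  have e : (Prod.swap ∘ fun p : ℝ × Plane => (p.1, p.2 + (s * p.1) • e₂.1)) ∘ Prod.swap
      = shearEquiv s := by
    funext z
    simp [shearEquiv_apply, shear_apply, e₂, Prod.ext_iff]
  rw [e] at h2
  exact h2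

lemma preimage_halfSpace (s : ℝ) : shearEquiv s ⁻¹' halfSpace s = {x | x 1 < 0} ×ˢ Ioi 0 := by
  ext z
  simp [halfSpace, upperHalf, shearEquiv_apply, shear_apply, e₂]

lemma setIntegral_halfSpace (s : ℝ) (f : SpaceTime → ℝ) :
    ∫ z in halfSpace s, f z = ∫ z in {x : Plane | x 1 < 0} ×ˢ Ioi (0 : ℝ), f (shearEquiv s z) := by
  rw [← preimage_halfSpace s]
  exact ((measurePreserving_shear s).setIntegral_preimage_emb
    (shearEquiv s).toHomeomorph.measurableEmbedding f _).symm

lemma contDiff_comp_shear (hψ : ContDiff ℝ ∞ ψ) (s : ℝ) : ContDiff ℝ ∞ (ψ ∘ shearEquiv s) :=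
  hψ.comp (shearEquiv s).contDiff

lemma hasCompactSupport_comp_shear (hψ' : HasCompactSupport ψ) (s : ℝ) :
    HasCompactSupport (ψ ∘ shearEquiv s) := hψ'.comp_homeomorph (shearEquiv s).toHomeomorph

lemma dirDeriv_comp_shear (hψ : ContDiff ℝ ∞ ψ) (s : ℝ) (v z : SpaceTime) :
    dirDeriv v (ψ ∘ shearEquiv s) z = dirDeriv (shear s v) ψ (shearEquiv s z) := by
  have := ((differentiable_of_smooth hψ (shearEquiv s z)).hasFDerivAt.comp z
    (shearEquiv s).hasFDerivAt).fderiv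
  simp only [dirDeriv]
  rw [this]
  rfl

lemma dirDeriv_shear_eₜ (s : ℝ) (z : SpaceTime) :
    dirDeriv (shear s eₜ) ψ z = dirDeriv eₜ ψ z + s * dirDeriv e₂ ψ z := by
  rw [shear_apply]
  simp [dirDeriv, eₜ]

lemma dirDeriv_shear_e₂ (s : ℝ) : dirDeriv (shear s e₂) ψ = dirDeriv e₂ ψ := by
  rw [shear_apply]
  simp [e₂]

/-- The shear straightens the moving half-space to a product with `t > 0`, preserves volume, and
turns `∂ₜ` into `∂ₜ + s ∂₂`. The speed `s` in the Rankine-Hugoniot conditions originates here. -/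
lemma integral_halfSpace_eₜ (hψ : ContDiff ℝ ∞ ψ) (hψ' : HasCompactSupport ψ) (s : ℝ) :
    ∫ z in halfSpace s, dirDeriv eₜ ψ z
      = -(∫ x in {x : Plane | x 1 < 0}, ψ (x, 0)) - s * interfaceIntegral s ψ := by
  have i1 := integrable_of_smooth (contDiff_dirDeriv hψ eₜ) (hasCompactSupport_dirDeriv hψ' eₜ)
  have i2 := integrable_of_smooth (contDiff_dirDeriv hψ e₂) (hasCompactSupport_dirDeriv hψ' e₂)
  have h : ∫ z in halfSpace s, (dirDeriv eₜ ψ z + s * dirDeriv e₂ ψ z)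
      = -(∫ x in {x : Plane | x 1 < 0}, ψ (x, 0)) := by
    rw [setIntegral_halfSpace]
    simp_rw [← dirDeriv_shear_eₜ, ← dirDeriv_comp_shear hψ]
    rw [integral_time (contDiff_comp_shear hψ s) (hasCompactSupport_comp_shear hψ' s)]
    simp [shearEquiv_apply, shear_apply]
  rw [integral_add i1.integrableOn (i2.const_mul s).integrableOn, integral_const_mul] at h
  rw [interfaceIntegral]
  linarith

/-- Coordinates on the plane. -/
def planeEquiv : Plane ≃ᵐ ℝ × ℝ :=
  (MeasurableEquiv.toLp 2 (Fin 2 → ℝ)).symm.trans MeasurableEquiv.finTwoArrow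

lemma measurePreserving_planeEquiv : MeasurePreserving planeEquiv :=
  (volume_preserving_finTwoArrow ℝ).comp
    (EuclideanSpace.volume_preserving_symm_measurableEquiv_toLp (Fin 2))

lemma planeEquiv_apply (x : Plane) : planeEquiv x = (x 0, x 1) := rfl

lemma planeEquiv_symm_apply (p : ℝ × ℝ) : planeEquiv.symm p = !₂[p.1, p.2] := by
  apply planeEquiv.injective
  simp [planeEquiv_apply]

lemma setIntegral_plane_nonneg {g : Plane → ℝ} (hg : ContDiff ℝ 1 g) (hg' : HasCompactSupport g)
    (hg0 : ∀ x, 0 ≤ g x) :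
    0 ≤ ∫ x in {x : Plane | x 1 < 0}, fderiv ℝ g x (EuclideanSpace.single 1 1) := by
  set f := fun x => fderiv ℝ g x (EuclideanSpace.single 1 1) with hf
  have hfc : Continuous f := (hg.continuous_fderiv one_ne_zero).clm_apply continuous_const
  have hfi : Integrable f := hfc.integrable_of_hasCompactSupport
    ((hg'.fderiv (𝕜 := ℝ)).comp_left (g := fun L : Plane →L[ℝ] ℝ => L (EuclideanSpace.single 1 1))
      rfl)
  have e1 : ∫ x in {x : Plane | x 1 < 0}, f x = ∫ p in univ ×ˢ Iio (0 : ℝ), f (planeEquiv.symm p) :=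
    ((measurePreserving_planeEquiv.symm _).setIntegral_preimage_emb
      planeEquiv.symm.measurableEmbedding f {x : Plane | x 1 < 0}).symm.trans (by
        congr 2
        ext p
        simp [planeEquiv_symm_apply])
  have hfi2 : Integrable (fun p => f (planeEquiv.symm p)) :=
    ((measurePreserving_planeEquiv.symm _).integrable_comp_emb
      planeEquiv.symm.measurableEmbedding).2 hfi
  rw [e1]
  rw [Measure.volume_eq_prod] at hfi2 ⊢
  rw [setIntegral_prod _ hfi2.integrableOn]
  refine integral_nonneg fun a => ?_
  have hline : ∀ b : ℝ, HasDerivAt (fun b : ℝ => (!₂[a, b] : Plane))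
      (EuclideanSpace.single 1 1) b := by
    intro b
    have h : (fun b : ℝ => (!₂[a, b] : Plane))
        = fun b : ℝ => b • (EuclideanSpace.single 1 1 : Plane) + !₂[a, 0] := by
      funext b
      ext i
      fin_cases i <;> simp
    rw [h]
    simpa using ((hasDerivAt_id b).smul_const (EuclideanSpace.single 1 1 : Plane)).add_const
      (!₂[a, 0] : Plane)
  have hc : ContDiff ℝ 1 fun b : ℝ => (!₂[a, b] : Plane) := by
    rw [contDiff_euclidean]
    intro i
    fin_cases i
    · exact contDiff_const
    · exact contDiff_id
  have hcs : HasCompactSupport fun b : ℝ => g !₂[a, b] := by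
    refine HasCompactSupport.intro (hg'.image (f := fun x : Plane => x 1) (by fun_prop))
      fun b hb => ?_
    exact image_eq_zero_of_notMem_tsupport fun h => hb ⟨_, h, by simp⟩
  have h : ∫ b in Iic (0 : ℝ), deriv (g ∘ fun b : ℝ => (!₂[a, b] : Plane)) b = g !₂[a, 0] :=
    hcs.integral_Iic_deriv_eq (hg.comp hc) 0
  have e2 : ∫ b in Iio (0 : ℝ), f (planeEquiv.symm (a, b)) = g !₂[a, 0] := by
    rw [← h, integral_Iic_eq_integral_Iio]
    refine integral_congr_ae (ae_of_all _ fun b => ?_)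
    simp only [planeEquiv_symm_apply, hf]
    exact (((hg.differentiable one_ne_zero _).hasFDerivAt.comp_hasDerivAt b (hline b)).deriv).symm
  simp only [Pi.zero_apply]
  rw [e2]
  exact hg0 _

/-- After the shear and Fubini, the fundamental theorem of calculus in `x₂` leaves values of `ψ` on
the interface at positive times. This sign turns the jump inequality for the energy into its weak
form. -/
lemma interfaceIntegral_nonneg (hψ : ContDiff ℝ ∞ ψ) (hψ' : HasCompactSupport ψ)
    (hψ0 : ∀ z : SpaceTime, 0 ≤ z.2 → 0 ≤ ψ z) (s : ℝ) : 0 ≤ interfaceIntegral s ψ := by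
  have hG := contDiff_comp_shear hψ s
  have hG' := hasCompactSupport_comp_shear hψ' s
  have hi := integrable_of_smooth (contDiff_dirDeriv hG e₂) (hasCompactSupport_dirDeriv hG' e₂)
  rw [interfaceIntegral, setIntegral_halfSpace, ← dirDeriv_shear_e₂ (ψ := ψ) s]
  simp_rw [← dirDeriv_comp_shear hψ]
  set G := ψ ∘ shearEquiv s with hGd
  rw [Measure.volume_eq_prod] at hi ⊢
  rw [← setIntegral_prod_swap, setIntegral_prod (fun z : ℝ × Plane => dirDeriv e₂ G z.swap) hi.swap.integrableOn]
  refine setIntegral_nonneg measurableSet_Ioi fun t ht => ?_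
  have hd : ∀ x : Plane, dirDeriv e₂ G (x, t)
      = fderiv ℝ (fun x => G (x, t)) x (EuclideanSpace.single 1 1) := by
    intro x
    have h1 : HasFDerivAt (fun x : Plane => (x, t)) (ContinuousLinearMap.inl ℝ Plane ℝ) x :=
      hasFDerivAt_prodMk_left x t
    have h2 := ((differentiable_of_smooth hG (x, t)).hasFDerivAt.comp x h1).fderiv
    have h3 : fderiv ℝ (fun x => G (x, t)) x
        = (fderiv ℝ G (x, t)).comp (ContinuousLinearMap.inl ℝ Plane ℝ) := h2
    rw [h3]
    simp [dirDeriv, e₂]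
  simp only [Prod.swap, hd]
  refine setIntegral_plane_nonneg
    ((hG.comp (contDiff_id.prodMk contDiff_const)).of_le (by exact_mod_cast le_top)) ?_ fun x => ?_
  · refine HasCompactSupport.intro (hG'.image continuous_fst) fun x hx => ?_
    exact image_eq_zero_of_notMem_tsupport fun h => hx ⟨_, h, rfl⟩
  · refine hψ0 _ ?_
    rw [shearEquiv_apply, shear_snd]
    exact le_of_lt ht

end HalfSpace

section FanBalance

variable {ψ : SpaceTime → ℝ}

lemma fan_eq_of_pos {s₁ s₂ : ℝ} (hs : s₁ ≤ s₂) (a b c : ℝ) {z : SpaceTime} (hz : z ∈ upperHalf) :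
    fan s₁ s₂ a b c z = c + (b - c) * (halfSpace s₂).indicator 1 z
      + (a - b) * (halfSpace s₁).indicator 1 z := by
  have hz' : 0 < z.2 := hz
  have hle : s₁ * z.2 ≤ s₂ * z.2 := by gcongr
  unfold fan
  by_cases h1 : z.1 1 < s₁ * z.2
  · have m1 : z ∈ halfSpace s₁ := ⟨h1, hz⟩
    have m2 : z ∈ halfSpace s₂ := ⟨lt_of_lt_of_le h1 hle, hz⟩
    rw [if_pos h1, indicator_of_mem m1, indicator_of_mem m2]
    simp
  · have m1 : z ∉ halfSpace s₁ := fun h => h1 h.1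
    rw [if_neg h1, indicator_of_notMem m1]
    by_cases h2 : z.1 1 < s₂ * z.2
    · have m2 : z ∈ halfSpace s₂ := ⟨h2, hz⟩
      rw [if_pos h2, indicator_of_mem m2]; simp
    · have m2 : z ∉ halfSpace s₂ := fun h => h2 h.1
      rw [if_neg h2, indicator_of_notMem m2]; simp

lemma setIntegral_fan_mul {s₁ s₂ : ℝ} (hs : s₁ ≤ s₂) (a b c : ℝ) {f : SpaceTime → ℝ}
    (hf : Integrable f) :
    IntegrableOn (fun z => fan s₁ s₂ a b c z * f z) upperHalf ∧
    ∫ z in upperHalf, fan s₁ s₂ a b c z * f z = c * (∫ z in upperHalf, f z)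
      + (b - c) * (∫ z in halfSpace s₂, f z) + (a - b) * ∫ z in halfSpace s₁, f z := by
  have hsub : ∀ s, halfSpace s ⊆ upperHalf := fun s => inter_subset_right
  have i0 := (hf.const_mul c).integrableOn (s := upperHalf)
  have i1 := ((hf.indicator (measurableSet_halfSpace s₂)).const_mul (b - c)).integrableOn
    (s := upperHalf)
  have i2 := ((hf.indicator (measurableSet_halfSpace s₁)).const_mul (a - b)).integrableOn
    (s := upperHalf)
  have e : EqOn (fun z => fan s₁ s₂ a b c z * f z)
      (fun z => c * f z + (b - c) * (halfSpace s₂).indicator f z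
        + (a - b) * (halfSpace s₁).indicator f z) upperHalf := by
    intro z hz
    simp only [fan_eq_of_pos hs a b c hz]
    by_cases h1 : z ∈ halfSpace s₁ <;> by_cases h2 : z ∈ halfSpace s₂ <;> simp [h1, h2] <;> ring
  constructor
  · exact IntegrableOn.congr_fun ((i0.add i1).add i2) e.symm measurableSet_upperHalf
  · rw [setIntegral_congr_fun measurableSet_upperHalf e, integral_add_add i0 i1 i2,
      integral_const_mul, integral_const_mul, integral_const_mul,
      setIntegral_indicator (measurableSet_halfSpace _),
      setIntegral_indicator (measurableSet_halfSpace _), inter_eq_self_of_subset_right (hsub _),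
      inter_eq_self_of_subset_right (hsub _)]

/-- The weak form of a balance law for a piecewise constant fan of densities `a`, fluxes `b` in
direction `x₁` and `c` in direction `x₂` reduces to the Rankine-Hugoniot defects. -/
lemma fan_balance {s₁ s₂ : ℝ} (hs : s₁ ≤ s₂) (aL aM aR bL bM bR cL cM cR : ℝ)
    (hψ : ContDiff ℝ ∞ ψ) (hψ' : HasCompactSupport ψ) :
    IntegrableOn (fun z => fan s₁ s₂ aL aM aR z * dirDeriv eₜ ψ z
        + fan s₁ s₂ bL bM bR z * dirDeriv e₁ ψ z + fan s₁ s₂ cL cM cR z * dirDeriv e₂ ψ z)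
      upperHalf ∧
    (∫ z in upperHalf, (fan s₁ s₂ aL aM aR z * dirDeriv eₜ ψ z
        + fan s₁ s₂ bL bM bR z * dirDeriv e₁ ψ z + fan s₁ s₂ cL cM cR z * dirDeriv e₂ ψ z))
      + ∫ x : Plane, (if x 1 < 0 then aL else aR) * ψ (x, 0)
      = (cL - cM - s₁ * (aL - aM)) * interfaceIntegral s₁ ψ
        + (cM - cR - s₂ * (aM - aR)) * interfaceIntegral s₂ ψ := by
  have hi : ∀ v, Integrable (dirDeriv v ψ) := fun v =>
    integrable_of_smooth (contDiff_dirDeriv hψ v) (hasCompactSupport_dirDeriv hψ' v)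
  obtain ⟨i1, e1⟩ := setIntegral_fan_mul hs aL aM aR (hi eₜ)
  obtain ⟨i2, e2⟩ := setIntegral_fan_mul hs bL bM bR (hi e₁)
  obtain ⟨i3, e3⟩ := setIntegral_fan_mul hs cL cM cR (hi e₂)
  refine ⟨(i1.add i2).add i3, ?_⟩
  have h0 : Integrable fun x : Plane => ψ (x, 0) := by
    refine (hψ.continuous.comp (by fun_prop : Continuous fun x : Plane => (x, (0 : ℝ)))
      ).integrable_of_hasCompactSupport ?_
    refine HasCompactSupport.intro (hψ'.image continuous_fst) fun x hx => ?_
    have : (x, (0 : ℝ)) ∉ tsupport ψ := fun h => hx ⟨(x, 0), h, rfl⟩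
    exact image_eq_zero_of_notMem_tsupport (f := ψ) this
  have hA : MeasurableSet {x : Plane | x 1 < 0} :=
    (isOpen_lt (by fun_prop) continuous_const).measurableSet
  have e0 : ∫ x : Plane, (if x 1 < 0 then aL else aR) * ψ (x, 0)
      = aR * (∫ x : Plane, ψ (x, 0)) + (aL - aR) * ∫ x in {x : Plane | x 1 < 0}, ψ (x, 0) := by
    rw [← integral_indicator hA, ← integral_const_mul, ← integral_const_mul,
      ← integral_add (h0.const_mul _) ((h0.indicator hA).const_mul _)]
    refine integral_congr_ae (ae_of_all _ fun x => ?_)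
    by_cases hx : x 1 < 0
    · have : x ∈ {x : Plane | x 1 < 0} := hx
      simp only [hx, if_true, indicator_of_mem this]; ring
    · have : x ∉ {x : Plane | x 1 < 0} := hx
      simp only [hx, if_false, indicator_of_notMem this]; ring
  rw [integral_add_add i1 i2 i3, e1, e2, e3, e0, integral_upperHalf_e₁ hψ hψ',
    integral_upperHalf_e₂ hψ hψ', integral_upperHalf_eₜ hψ hψ', integral_halfSpace_e₁ hψ hψ',
    integral_halfSpace_e₁ hψ hψ', integral_halfSpace_eₜ hψ hψ', integral_halfSpace_eₜ hψ hψ']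
  simp only [interfaceIntegral]
  ring

end FanBalance

end IsentropicEuler

end

/-! ### Fans with an oscillating middle part -/

noncomputable section

namespace IsentropicEuler

/-- The wedge `-ν t < x₂ < ν t` in space-time. -/
def wedge (ν : ℝ) : Set SpaceTime := {z | -ν * z.2 < z.1 1 ∧ z.1 1 < ν * z.2}

/-- Fields `w` of constant modulus with `div w = 0` and `∂ₜ w + div (w ⊗ w - A) = 0` across the
wedge, where `A = diag(a₁, a₂)`. -/
structure IsWedgeField (a₁ a₂ ν : ℝ) (w : SpaceTime → ℝ × ℝ) : Prop where
  measurable : Measurable w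
  speed : ∀ z, (w z).1 ^ 2 + (w z).2 ^ 2 = a₁ + a₂
  div : ∀ ψ : SpaceTime → ℝ, ContDiff ℝ ∞ ψ → HasCompactSupport ψ →
    ∫ z in wedge ν, ((w z).1 * dirDeriv e₁ ψ z + (w z).2 * dirDeriv e₂ ψ z) = 0
  momentum₁ : ∀ ψ : SpaceTime → ℝ, ContDiff ℝ ∞ ψ → HasCompactSupport ψ →
    ∫ z in wedge ν, ((w z).1 * dirDeriv eₜ ψ z + ((w z).1 ^ 2 - a₁) * dirDeriv e₁ ψ z
      + (w z).1 * (w z).2 * dirDeriv e₂ ψ z) = 0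
  momentum₂ : ∀ ψ : SpaceTime → ℝ, ContDiff ℝ ∞ ψ → HasCompactSupport ψ →
    ∫ z in wedge ν, ((w z).2 * dirDeriv eₜ ψ z + (w z).1 * (w z).2 * dirDeriv e₁ ψ z
      + ((w z).2 ^ 2 - a₂) * dirDeriv e₂ ψ z) = 0

section Wedge

variable {a₁ a₂ ν : ℝ} {w : SpaceTime → ℝ × ℝ} {ψ : SpaceTime → ℝ}

lemma isOpen_wedge : IsOpen (wedge ν) :=
  (isOpen_lt (continuous_const.mul continuous_snd) (continuous_coord 1)).inter
    (isOpen_lt (continuous_coord 1) (continuous_const.mul continuous_snd))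

lemma wedge_subset (hν : 0 < ν) : wedge ν ⊆ upperHalf := by
  rintro z ⟨h1, h2⟩
  have : 0 < 2 * ν * z.2 := by linarith
  exact pos_of_mul_pos_right this (by positivity)

lemma wedge_nonempty (hν : 0 < ν) : (wedge ν).Nonempty :=
  ⟨(0, 1), by simp [wedge, hν]⟩

/-- With this choice the two-shock solution is a fan too, and one set of lemmas serves both kinds of
solutions. -/
lemma isWedgeField_zero : IsWedgeField 0 0 ν 0 := by
  refine ⟨measurable_const, ?_, ?_, ?_, ?_⟩ <;> simp

/-- The constant outside of the wedge keeps the modulus right everywhere, including the boundary `x₂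
= -νt`, which `fan` counts to the middle region. -/
lemma IsExactSolution.isWedgeField (h₁ : 0 < a₁) (h₂ : 0 < a₂) [DecidablePred (· ∈ wedge ν)]
    (hw : IsExactSolution a₁ a₂ (wedge ν) w) :
    IsWedgeField a₁ a₂ ν fun z => if z ∈ wedge ν then w z else (Real.sqrt (a₁ + a₂), 0) := by
  refine ⟨Measurable.ite isOpen_wedge.measurableSet hw.measurable measurable_const, fun z => ?_,
    fun ψ h h' => ?_, fun ψ h h' => ?_, fun ψ h h' => ?_⟩
  · by_cases hz : z ∈ wedge ν
    · simp only [hz, if_true]; exact hw.speed z hz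
    · simp only [hz, if_false]
      rw [Real.sq_sqrt (by linarith)]; ring
  · rw [← hw.div ψ h h']
    refine setIntegral_congr_fun isOpen_wedge.measurableSet fun z hz => ?_
    simp only [hz, if_true]
  · rw [← hw.momentum₁ ψ h h']
    refine setIntegral_congr_fun isOpen_wedge.measurableSet fun z hz => ?_
    simp only [hz, if_true]
  · rw [← hw.momentum₂ ψ h h']
    refine setIntegral_congr_fun isOpen_wedge.measurableSet fun z hz => ?_
    simp only [hz, if_true]

lemma IsWedgeField.abs_le (hw : IsWedgeField a₁ a₂ ν w) (z : SpaceTime) :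
    |(w z).1| ≤ Real.sqrt (a₁ + a₂) ∧ |(w z).2| ≤ Real.sqrt (a₁ + a₂) := by
  have := hw.speed z
  exact ⟨Real.abs_le_sqrt (by nlinarith [sq_nonneg (w z).2]),
    Real.abs_le_sqrt (by nlinarith [sq_nonneg (w z).1])⟩

lemma IsWedgeField.integrable_mul (hw : IsWedgeField a₁ a₂ ν w) {f : SpaceTime → ℝ}
    (hf : Integrable f) {P : ℝ × ℝ → ℝ} (hP : Continuous P) :
    Integrable fun z => P (w z) * f z := by
  set κ := Real.sqrt (a₁ + a₂)
  obtain ⟨B, hB⟩ := (isCompact_closedBall (0 : ℝ × ℝ) κ).exists_bound_of_continuousOn hP.continuousOn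
  refine integrable_mul_of_bounded hf (hP.measurable.comp hw.measurable).aestronglyMeasurable
    (B := B) fun z => hB _ ?_
  rw [mem_closedBall_zero_iff]
  exact max_le (hw.abs_le z).1 (hw.abs_le z).2

lemma measure_interface (s : ℝ) : volume {z : SpaceTime | z.1 1 = s * z.2} = 0 := by
  have h := Measure.addHaar_submodule (volume : Measure SpaceTime)
    (LinearMap.ker (phase 0 1 (-s)).toLinearMap) (by
      intro h
      have : e₂ ∈ LinearMap.ker (phase 0 1 (-s)).toLinearMap := by rw [h]; trivial
      rw [LinearMap.mem_ker] at this
      change phase 0 1 (-s) e₂ = 0 at this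
      rw [phase_e₂] at this
      norm_num at this)
  convert h using 2
  ext z
  simp only [mem_ofPred_eq, SetLike.mem_coe, LinearMap.mem_ker]
  change _ ↔ phase 0 1 (-s) z = 0
  simp only [phase, zero_smul, one_smul, zero_add]
  change _ ↔ z.1 1 + -s * z.2 = 0
  constructor <;> intro h <;> linarith

/-- A balance law for a function that is piecewise constant outside of the wedge and oscillates
inside of it with zero mean in the weak sense. -/
lemma wedge_balance (hν : 0 < ν) (aL aM aR bL bM bR cL cM cR : ℝ)
    (hψ : ContDiff ℝ ∞ ψ) (hψ' : HasCompactSupport ψ) {F q : SpaceTime → ℝ}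
    (hL : ∀ z ∈ upperHalf, z.1 1 < -ν * z.2 →
      F z = aL * dirDeriv eₜ ψ z + bL * dirDeriv e₁ ψ z + cL * dirDeriv e₂ ψ z)
    (hM : ∀ z ∈ wedge ν,
      F z = aM * dirDeriv eₜ ψ z + bM * dirDeriv e₁ ψ z + cM * dirDeriv e₂ ψ z + q z)
    (hR : ∀ z ∈ upperHalf, ν * z.2 ≤ z.1 1 →
      F z = aR * dirDeriv eₜ ψ z + bR * dirDeriv e₁ ψ z + cR * dirDeriv e₂ ψ z)
    (hq : Integrable q) (hq0 : ∫ z in wedge ν, q z = 0) :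
    IntegrableOn F upperHalf ∧
    (∫ z in upperHalf, F z) + ∫ x : Plane, (if x 1 < 0 then aL else aR) * ψ (x, 0)
      = (cL - cM + ν * (aL - aM)) * interfaceIntegral (-ν) ψ
        + (cM - cR - ν * (aM - aR)) * interfaceIntegral ν ψ := by
  obtain ⟨i1, h1⟩ := fan_balance (by linarith : -ν ≤ ν) aL aM aR bL bM bR cL cM cR hψ hψ'
  have i2 : IntegrableOn ((wedge ν).indicator q) upperHalf :=
    (hq.indicator isOpen_wedge.measurableSet).integrableOn
  -- The boundary plane lies in the middle region of `fan` but not in the open wedge; it is a null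
  -- set.
  have hne : ∀ᵐ z : SpaceTime, z.1 1 ≠ -ν * z.2 := by
    rw [ae_iff]; simpa using measure_interface (-ν)
  have e : F =ᵐ[volume.restrict upperHalf] fun z => (fan (-ν) ν aL aM aR z * dirDeriv eₜ ψ z
        + fan (-ν) ν bL bM bR z * dirDeriv e₁ ψ z + fan (-ν) ν cL cM cR z * dirDeriv e₂ ψ z)
        + (wedge ν).indicator q z := by
    filter_upwards [ae_restrict_mem measurableSet_upperHalf, ae_restrict_of_ae hne] with z hz hzn
    have hz' : 0 < z.2 := hz
    by_cases c1 : z.1 1 < -ν * z.2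
    · have : z ∉ wedge ν := fun h => lt_asymm c1 h.1
      simp only [fan, c1, if_true, indicator_of_notMem this, add_zero]
      exact hL z hz c1
    · by_cases c2 : z.1 1 < ν * z.2
      · have : z ∈ wedge ν := ⟨lt_of_le_of_ne (not_lt.1 c1) (Ne.symm hzn), c2⟩
        simp only [fan, c1, if_false, c2, if_true, indicator_of_mem this]
        exact hM z this
      · have : z ∉ wedge ν := fun h => c2 h.2
        simp only [fan, c1, if_false, c2, indicator_of_notMem this, add_zero]
        exact hR z hz (not_lt.1 c2)
  refine ⟨(i1.add i2).congr e.symm, ?_⟩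
  rw [integral_congr_ae e, integral_add i1 i2, setIntegral_indicator isOpen_wedge.measurableSet,
    inter_eq_self_of_subset_right (wedge_subset hν), hq0, add_zero, h1]
  ring

end Wedge

/-! ### Weak solutions, energy inequality and dissipation rate of a fan -/

section FanSolution

variable {a₁ a₂ ν γ V r : ℝ} {w : SpaceTime → ℝ × ℝ}

/-- Symmetric Riemann data: unit density and colliding velocities `±V` in direction `x₂`. -/
def collision (V : ℝ) : RiemannData := ⟨1, 1, !₂[0, V], !₂[0, -V], one_pos, one_pos⟩

/-- The velocity that equals the Riemann data outside of the fan and `w` inside of it. -/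
def fanVelocity (ν V : ℝ) (w : SpaceTime → ℝ × ℝ) (z : SpaceTime) : Plane :=
  fan (-ν) ν !₂[0, V] !₂[(w z).1, (w z).2] !₂[0, -V] z

/-- The energy density in a fan of density `r` and squared speed `C`. -/
def fanEnergy (γ r C : ℝ) : ℝ := r * internalEnergy γ r + r * C / 2

lemma norm_sq_vec (a b : ℝ) : ‖(!₂[a, b] : Plane)‖ ^ 2 = a ^ 2 + b ^ 2 := by
  simp [EuclideanSpace.norm_sq_eq, Fin.sum_univ_two]

lemma energyDensity_vec (γ r a b : ℝ) :
    energyDensity γ r !₂[a, b] = fanEnergy γ r (a ^ 2 + b ^ 2) := by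
  rw [energyDensity, norm_sq_vec, fanEnergy]

lemma pressure_one (γ : ℝ) : pressure γ 1 = 1 := Real.one_rpow γ

lemma dx_eq (ψ : SpaceTime → ℝ) (z : SpaceTime) (v : Plane) :
    dx ψ z v = v 0 * dirDeriv e₁ ψ z + v 1 * dirDeriv e₂ ψ z := by
  have : ((v, 0) : SpaceTime) = v 0 • e₁ + v 1 • e₂ := by
    refine Prod.ext ?_ (by simp [e₁, e₂])
    ext i
    fin_cases i <;> simp [e₁, e₂]
  simp only [dx, dirDeriv, this, map_add, map_smul, smul_eq_mul]

lemma fderiv_coord {φ : SpaceTime → Plane} (hφ : ContDiff ℝ ∞ φ) (z u : SpaceTime) (i : Fin 2) :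
    (fderiv ℝ φ z u) i = dirDeriv u (fun z => φ z i) z := by
  have h := ((EuclideanSpace.proj (𝕜 := ℝ) i).hasFDerivAt.comp z
    (hφ.differentiable (by norm_num) z).hasFDerivAt).fderiv
  have h' : fderiv ℝ (fun z => φ z i) z
      = (EuclideanSpace.proj (𝕜 := ℝ) i).comp (fderiv ℝ φ z) := h
  simp [dirDeriv, h']

lemma inner_plane (x y : Plane) : inner ℝ x y = x 0 * y 0 + x 1 * y 1 := by
  simp [PiLp.inner_apply, Fin.sum_univ_two, mul_comm]

lemma measurable_fan {α : Type*} [MeasurableSpace α] {s₁ s₂ : ℝ} {f g h : SpaceTime → α}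
    (hf : Measurable f) (hg : Measurable g) (hh : Measurable h) :
    Measurable fun z => fan s₁ s₂ (f z) (g z) (h z) z :=
  Measurable.ite (isOpen_lt (continuous_coord 1)
      (continuous_const.mul continuous_snd)).measurableSet hf
    (Measurable.ite (isOpen_lt (continuous_coord 1)
      (continuous_const.mul continuous_snd)).measurableSet hg hh)

lemma measurable_fanVelocity (hw : Measurable w) : Measurable (fanVelocity ν V w) := by
  refine measurable_fan measurable_const ?_ measurable_const
  have : (fun z => (!₂[(w z).1, (w z).2] : Plane))
      = fun z => planeEquiv.symm (w z) := by
    funext z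
    rw [planeEquiv_symm_apply]
  rw [this]
  exact planeEquiv.symm.measurable.comp hw

lemma fan_zero {α : Type*} (s₁ s₂ : ℝ) (a b c : α) (x : Plane) :
    fan s₁ s₂ a b c (x, 0) = if x 1 < 0 then a else c := by
  by_cases h : x 1 < 0 <;> simp [fan, h]

lemma fan_left {α : Type*} {s₁ s₂ : ℝ} (a b c : α) {z : SpaceTime} (h : z.1 1 < s₁ * z.2) :
    fan s₁ s₂ a b c z = a := if_pos h

lemma fan_middle {α : Type*} {s₁ s₂ : ℝ} (a b c : α) {z : SpaceTime} (h : s₁ * z.2 < z.1 1)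
    (h' : z.1 1 < s₂ * z.2) : fan s₁ s₂ a b c z = b := by
  rw [fan, if_neg h.not_gt, if_pos h']

lemma fan_right {α : Type*} {s₁ s₂ : ℝ} (hs : s₁ ≤ s₂) (a b c : α) {z : SpaceTime}
    (hz : 0 ≤ z.2) (h : s₂ * z.2 ≤ z.1 1) : fan s₁ s₂ a b c z = c := by
  have : s₁ * z.2 ≤ s₂ * z.2 := by gcongr
  rw [fan, if_neg (by linarith), if_neg (by linarith)]

/-- The averages in the fan are density `r`, momentum `0` and momentum flux `p(r) Id + r A`; what is
left after subtracting them integrates to zero by `IsWedgeField`. The two hypotheses on `V` are the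
Rankine-Hugoniot conditions of these averages with the outer states; by symmetry they are the same
at both interfaces. -/
lemma isWeakSolution_fan (hν : 0 < ν) (hr : 0 < r) (hmass : V = ν * (r - 1))
    (hmom : ν * V + V ^ 2 + 1 = pressure γ r + r * a₂) (hw : IsWedgeField a₁ a₂ ν w) :
    IsWeakSolution γ (collision V).density (collision V).velocity (fan (-ν) ν 1 r 1)
      (fanVelocity ν V w) := by
  have hνν : -ν ≤ ν := by linarith
  refine ⟨measurable_fan measurable_const measurable_const measurable_const,
    measurable_fanVelocity hw.measurable, fun z _ => ?_, ⟨1 + r + (V ^ 2 + (a₁ + a₂)), ?_⟩, ?_,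
    fun ψ hψ => ?_, fun φ hφ => ?_⟩
  · unfold fan; split_ifs <;> linarith
  · intro z _
    have hC : 0 ≤ a₁ + a₂ := by rw [← hw.speed z]; positivity
    have hsq : ∀ x : Plane, ‖x‖ ≤ 1 + ‖x‖ ^ 2 := fun x => by nlinarith [sq_nonneg (‖x‖ - 1)]
    constructor
    · unfold fan; split_ifs <;> rw [abs_of_pos (by linarith)] <;> nlinarith [sq_nonneg V]
    · refine (hsq _).trans ?_
      unfold fanVelocity fan
      split_ifs <;> rw [norm_sq_vec]
      · nlinarith
      · rw [hw.speed]; nlinarith [sq_nonneg V]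
      · nlinarith
  · refine ae_of_all _ fun x => ⟨?_, ?_⟩
    · rw [fan_zero]; rfl
    · rw [fanVelocity, fan_zero]; rfl
  · obtain ⟨hψ1, hψ2⟩ := hψ
    have hi : ∀ v, Integrable (dirDeriv v ψ) := fun v =>
      integrable_of_smooth (contDiff_dirDeriv hψ1 v) (hasCompactSupport_dirDeriv hψ2 v)
    have h := (wedge_balance hν 1 r 1 0 0 0 V 0 (-V) hψ1 hψ2
      (F := fun z => fan (-ν) ν 1 r 1 z * dt ψ z
        + fan (-ν) ν 1 r 1 z * dx ψ z (fanVelocity ν V w z))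
      (q := fun z => r * ((w z).1 * dirDeriv e₁ ψ z + (w z).2 * dirDeriv e₂ ψ z))
      (fun z hz hzL => ?_) (fun z hz => ?_) (fun z hz hzR => ?_)
      (((hw.integrable_mul (hi _) continuous_fst).add
        (hw.integrable_mul (hi _) continuous_snd)).const_mul r)
      (by rw [integral_const_mul, hw.div ψ hψ1 hψ2, mul_zero])).2
    · have e : ∀ x : Plane, (collision V).density x = if x 1 < 0 then 1 else 1 := fun x => rfl
      simp only [e]
      rw [h, hmass]
      ring
    · simp only [fanVelocity, fan_left _ _ _ hzL, dx_eq]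
      simp [dt, dirDeriv, eₜ]
    · simp only [fanVelocity, fan_middle _ _ _ hz.1 hz.2, dx_eq]
      simp [dt, dirDeriv, eₜ]
    · simp only [fanVelocity, fan_right hνν _ _ _ (le_of_lt hz) hzR, dx_eq]
      simp [dt, dirDeriv, eₜ]
  · obtain ⟨hφ1, hφ2⟩ := hφ
    have hc : ∀ i : Fin 2, ContDiff ℝ ∞ fun z => φ z i := fun i => contDiff_euclidean.1 hφ1 i
    have hs : ∀ i : Fin 2, HasCompactSupport fun z => φ z i := fun i =>
      hφ2.comp_left (g := fun x : Plane => x i) rfl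
    have hi : ∀ (i : Fin 2) v, Integrable (dirDeriv v fun z => φ z i) := fun i v =>
      integrable_of_smooth (contDiff_dirDeriv (hc i) v) (hasCompactSupport_dirDeriv (hs i) v)
    have hdx : ∀ z (v : Plane) (i : Fin 2), (dx φ z v) i
        = v 0 * dirDeriv e₁ (fun z => φ z i) z + v 1 * dirDeriv e₂ (fun z => φ z i) z := by
      intro z v i
      rw [← dx_eq (fun z => φ z i) z v]
      exact fderiv_coord hφ1 z _ i
    have hdt : ∀ z (i : Fin 2), (dt φ z) i = dirDeriv eₜ (fun z => φ z i) z := fun z i =>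
      fderiv_coord hφ1 z _ i
    have hdiv : ∀ z, divx φ z = dirDeriv e₁ (fun z => φ z 0) z + dirDeriv e₂ (fun z => φ z 1) z := by
      intro z
      rw [divx, Fin.sum_univ_two, hdx, hdx]
      simp
    set ρ := fan (α := ℝ) (-ν) ν 1 r 1 with hρ
    set v := fanVelocity ν V w with hv
    have split : ∀ z, ρ z * inner ℝ (v z) (dt φ z) + ρ z * inner ℝ (v z) (dx φ z (v z))
        + pressure γ (ρ z) * divx φ z
        = (ρ z * (v z 0 * dirDeriv eₜ (fun z => φ z 0) z + v z 0 * (v z 0 *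
            dirDeriv e₁ (fun z => φ z 0) z + v z 1 * dirDeriv e₂ (fun z => φ z 0) z))
            + pressure γ (ρ z) * dirDeriv e₁ (fun z => φ z 0) z)
          + (ρ z * (v z 1 * dirDeriv eₜ (fun z => φ z 1) z + v z 1 * (v z 0 *
            dirDeriv e₁ (fun z => φ z 1) z + v z 1 * dirDeriv e₂ (fun z => φ z 1) z))
            + pressure γ (ρ z) * dirDeriv e₂ (fun z => φ z 1) z) := by
      intro z
      rw [inner_plane, inner_plane, hdx, hdx, hdt, hdt, hdiv]
      ring
    -- In direction `x₁` neither the densities nor the fluxes through the interfaces jump, so `a₁`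
    -- is not constrained.
    have h0 := wedge_balance hν 0 0 0 1 (pressure γ r + r * a₁) 1 0 0 0 (hc 0) (hs 0)
      (F := fun z => ρ z * (v z 0 * dirDeriv eₜ (fun z => φ z 0) z + v z 0 * (v z 0 *
            dirDeriv e₁ (fun z => φ z 0) z + v z 1 * dirDeriv e₂ (fun z => φ z 0) z))
            + pressure γ (ρ z) * dirDeriv e₁ (fun z => φ z 0) z)
      (q := fun z => r * ((w z).1 * dirDeriv eₜ (fun z => φ z 0) z
        + ((w z).1 ^ 2 - a₁) * dirDeriv e₁ (fun z => φ z 0) z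
        + (w z).1 * (w z).2 * dirDeriv e₂ (fun z => φ z 0) z))
      (fun z hz hzL => by
        simp only [hρ, hv, fanVelocity, fan_left _ _ _ hzL, pressure_one]
        simp)
      (fun z hz => by
        simp only [hρ, hv, fanVelocity, fan_middle _ _ _ hz.1 hz.2]
        simp
        ring)
      (fun z hz hzR => by
        simp only [hρ, hv, fanVelocity, fan_right hνν _ _ _ (le_of_lt hz) hzR, pressure_one]
        simp)
      ((((hw.integrable_mul (hi 0 _) continuous_fst).add
        (hw.integrable_mul (hi 0 _) (P := fun p => p.1 ^ 2 - a₁) (by fun_prop))).add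
        (hw.integrable_mul (hi 0 _) (P := fun p => p.1 * p.2) (by fun_prop))).const_mul r)
      (by rw [integral_const_mul, hw.momentum₁ _ (hc 0) (hs 0), mul_zero])
    have h1 := wedge_balance hν V 0 (-V) 0 0 0 (V ^ 2 + 1) (pressure γ r + r * a₂) (V ^ 2 + 1)
      (hc 1) (hs 1)
      (F := fun z => ρ z * (v z 1 * dirDeriv eₜ (fun z => φ z 1) z + v z 1 * (v z 0 *
            dirDeriv e₁ (fun z => φ z 1) z + v z 1 * dirDeriv e₂ (fun z => φ z 1) z))
            + pressure γ (ρ z) * dirDeriv e₂ (fun z => φ z 1) z)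
      (q := fun z => r * ((w z).2 * dirDeriv eₜ (fun z => φ z 1) z
        + (w z).1 * (w z).2 * dirDeriv e₁ (fun z => φ z 1) z
        + ((w z).2 ^ 2 - a₂) * dirDeriv e₂ (fun z => φ z 1) z))
      (fun z hz hzL => by
        simp only [hρ, hv, fanVelocity, fan_left _ _ _ hzL, pressure_one]
        simp
        ring)
      (fun z hz => by
        simp only [hρ, hv, fanVelocity, fan_middle _ _ _ hz.1 hz.2]
        simp
        ring)
      (fun z hz hzR => by
        simp only [hρ, hv, fanVelocity, fan_right hνν _ _ _ (le_of_lt hz) hzR, pressure_one]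
        simp
        ring)
      ((((hw.integrable_mul (hi 1 _) continuous_snd).add
        (hw.integrable_mul (hi 1 _) (P := fun p => p.1 * p.2) (by fun_prop))).add
        (hw.integrable_mul (hi 1 _) (P := fun p => p.2 ^ 2 - a₂) (by fun_prop))).const_mul r)
      (by rw [integral_const_mul, hw.momentum₂ _ (hc 1) (hs 1), mul_zero])
    simp_rw [split]
    rw [integral_add h0.1 h1.1]
    have e : ∀ x : Plane, (collision V).density x * inner ℝ ((collision V).velocity x) (φ (x, 0))
        = (if x 1 < 0 then V else -V) * φ (x, 0) 1 := by
      intro x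
      rw [inner_plane]
      by_cases hx : x 1 < 0 <;> simp [collision, RiemannData.density, RiemannData.velocity, hx]
    simp_rw [e]
    have k0 := h0.2
    have k1 := h1.2
    simp only [ite_self, zero_mul, integral_zero, add_zero] at k0
    have z1 : V ^ 2 + 1 - (pressure γ r + r * a₂) + ν * (V - 0) = 0 := by linarith
    have z2 : pressure γ r + r * a₂ - (V ^ 2 + 1) - ν * (0 - -V) = 0 := by linarith
    rw [z1, z2] at k1
    linarith

/-- The energy density in the fan is constant and its flux is a constant times `w`, hence zero on
average. Only the jump inequality `hen`, the same at both interfaces, remains. -/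
lemma isAdmissibleSolution_fan (hν : 0 < ν) (hr : 0 < r) (hmass : V = ν * (r - 1))
    (hmom : ν * V + V ^ 2 + 1 = pressure γ r + r * a₂) (hw : IsWedgeField a₁ a₂ ν w)
    (hen : ν * (fanEnergy γ r (a₁ + a₂) - fanEnergy γ 1 (V ^ 2))
      ≤ (fanEnergy γ 1 (V ^ 2) + 1) * V) :
    IsAdmissibleSolution γ (collision V).density (collision V).velocity (fan (-ν) ν 1 r 1)
      (fanVelocity ν V w) := by
  have hνν : -ν ≤ ν := by linarith
  refine ⟨isWeakSolution_fan hν hr hmass hmom hw, fun ψ hψ hψ0 => ?_⟩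
  obtain ⟨hψ1, hψ2⟩ := hψ
  have hi : ∀ v, Integrable (dirDeriv v ψ) := fun v =>
    integrable_of_smooth (contDiff_dirDeriv hψ1 v) (hasCompactSupport_dirDeriv hψ2 v)
  set E := fanEnergy γ 1 (V ^ 2) with hE
  set E₁ := fanEnergy γ r (a₁ + a₂) with hE₁
  have eL : energyDensity γ 1 !₂[0, V] = E := by rw [energyDensity_vec, hE]; ring_nf
  have eR : energyDensity γ 1 !₂[0, -V] = E := by rw [energyDensity_vec, hE]; ring_nf
  have eM : ∀ z, energyDensity γ r !₂[(w z).1, (w z).2] = E₁ := fun z => by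
    rw [energyDensity_vec, hE₁, hw.speed]
  have h := (wedge_balance hν E E₁ E 0 0 0 ((E + 1) * V) 0 (-((E + 1) * V)) hψ1 hψ2
    (F := fun z => energyDensity γ (fan (-ν) ν 1 r 1 z) (fanVelocity ν V w z) * dt ψ z
      + (energyDensity γ (fan (-ν) ν 1 r 1 z) (fanVelocity ν V w z)
        + pressure γ (fan (-ν) ν 1 r 1 z)) * dx ψ z (fanVelocity ν V w z))
    (q := fun z => (E₁ + pressure γ r) * ((w z).1 * dirDeriv e₁ ψ z + (w z).2 * dirDeriv e₂ ψ z))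
    (fun z hz hzL => ?_) (fun z hz => ?_) (fun z hz hzR => ?_)
    (((hw.integrable_mul (hi _) continuous_fst).add
      (hw.integrable_mul (hi _) continuous_snd)).const_mul _)
    (by rw [integral_const_mul, hw.div ψ hψ1 hψ2, mul_zero])).2
  · have e : ∀ x : Plane, energyDensity γ ((collision V).density x) ((collision V).velocity x)
        = if x 1 < 0 then E else E := fun x => by
      by_cases hx : x 1 < 0 <;>
        simp [collision, RiemannData.density, RiemannData.velocity, hx, eL, eR]
    simp only [e]
    rw [h]
    have j1 := interfaceIntegral_nonneg hψ1 hψ2 hψ0 (-ν)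
    have j2 := interfaceIntegral_nonneg hψ1 hψ2 hψ0 ν
    exact add_nonneg (mul_nonneg (by linarith) j1) (mul_nonneg (by linarith) j2)
  · simp only [fanVelocity, fan_left _ _ _ hzL, dx_eq, eL, pressure_one]
    simp [dt, dirDeriv, eₜ]
    ring
  · simp only [fanVelocity, fan_middle _ _ _ hz.1 hz.2, dx_eq, eM]
    simp [dt, dirDeriv, eₜ]
  · simp only [fanVelocity, fan_right hνν _ _ _ (le_of_lt hz) hzR, dx_eq, eR, pressure_one]
    simp [dt, dirDeriv, eₜ]
    ring

lemma hasFanForm_fan (hν : 0 < ν) (hw : IsWedgeField a₁ a₂ ν w) :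
    HasFanForm (collision V) (-ν) ν r (a₁ + a₂) (fan (-ν) ν 1 r 1) (fanVelocity ν V w) := by
  have hνν : -ν ≤ ν := by linarith
  intro z hz
  refine ⟨fun h => ?_, fun h h' => ?_, fun h => ?_⟩
  · simp only [fanVelocity, fan_left _ _ _ h]; exact ⟨rfl, rfl⟩
  · simp only [fanVelocity, fan_middle _ _ _ h h', norm_sq_vec, hw.speed, true_and]
  · simp only [fanVelocity, fan_right hνν _ _ _ hz.le h.le]; exact ⟨rfl, rfl⟩

lemma measurableSet_box (L : ℝ) : MeasurableSet (box L) := by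
  have : box L = ⋂ i, {x : Plane | x i ∈ Ioo (-L) L} := by ext x; simp [box]
  rw [this]
  exact MeasurableSet.iInter fun i =>
    (isOpen_Ioo.preimage (by fun_prop : Continuous fun x : Plane => x i)).measurableSet

lemma volume_strip {L c : ℝ} (hc1 : -L ≤ c) (hc2 : c ≤ L) :
    volume (box L ∩ {x : Plane | x 1 < c}) = ENNReal.ofReal (2 * L * (L + c)) := by
  have e : box L ∩ {x : Plane | x 1 < c} = planeEquiv ⁻¹' (Ioo (-L) L ×ˢ Ioo (-L) c) := by
    ext x
    simp only [box, mem_inter_iff, mem_ofPred_eq, Fin.forall_fin_two, mem_preimage,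
      planeEquiv_apply, mem_prod, mem_Ioo]
    constructor
    · rintro ⟨⟨h1, h2, h3⟩, h4⟩; exact ⟨h1, h2, h4⟩
    · rintro ⟨h1, h2, h4⟩; exact ⟨⟨h1, h2, by linarith⟩, h4⟩
  rw [e, measurePreserving_planeEquiv.measure_preimage_emb planeEquiv.measurableEmbedding,
    Measure.volume_eq_prod, Measure.prod_prod, Real.volume_Ioo, Real.volume_Ioo,
    ← ENNReal.ofReal_mul (by linarith)]
  congr 1
  ring

lemma integral_box_strip {L c : ℝ} (hc1 : -L ≤ c) (hc2 : c ≤ L) (k : ℝ) :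
    IntegrableOn ({x : Plane | x 1 < c}.indicator fun _ => k) (box L) ∧
    ∫ x in box L, {x : Plane | x 1 < c}.indicator (fun _ => k) x = 2 * L * (L + c) * k := by
  have hm : MeasurableSet {x : Plane | x 1 < c} :=
    (isOpen_lt (by fun_prop) continuous_const).measurableSet
  have hv := volume_strip hc1 hc2
  constructor
  · rw [IntegrableOn, integrable_indicator_iff hm, IntegrableOn, Measure.restrict_restrict hm,
      inter_comm]
    exact integrableOn_const (by rw [hv]; exact ENNReal.ofReal_ne_top)
  · rw [setIntegral_indicator hm, setIntegral_const, measureReal_def, hv,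
      ENNReal.toReal_ofReal (mul_nonneg (by linarith) (by linarith)), smul_eq_mul]

/-- At a fixed time the energy density is constant on three strips, and the middle one has width
`2νt`. The bound on `νt` keeps the fan in the box. Here the modulus of `w` is needed at every point.
-/
lemma energy_fan (hν : 0 < ν) (hw : IsWedgeField a₁ a₂ ν w) {L t : ℝ} (ht : 0 ≤ t)
    (htL : ν * t ≤ L) :
    energy γ (fan (-ν) ν 1 r 1) (fanVelocity ν V w) L t
      = 4 * L ^ 2 * fanEnergy γ 1 (V ^ 2)
        + 4 * L * (ν * (fanEnergy γ r (a₁ + a₂) - fanEnergy γ 1 (V ^ 2))) * t := by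
  set E := fanEnergy γ 1 (V ^ 2) with hE
  set E₁ := fanEnergy γ r (a₁ + a₂) with hE₁
  have hνt : 0 ≤ ν * t := by positivity
  obtain ⟨i0, e0⟩ := integral_box_strip (by linarith : -L ≤ L) le_rfl E
  obtain ⟨i1, e1⟩ := integral_box_strip (by linarith : -L ≤ ν * t) htL (E₁ - E)
  obtain ⟨i2, e2⟩ := integral_box_strip (by linarith : -L ≤ -ν * t) (by linarith : -ν * t ≤ L)
    (E - E₁)
  have e : energy γ (fan (-ν) ν 1 r 1) (fanVelocity ν V w) L t
      = ∫ x in box L, ({x : Plane | x 1 < L}.indicator (fun _ => E) x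
        + {x : Plane | x 1 < ν * t}.indicator (fun _ => E₁ - E) x
        + {x : Plane | x 1 < -ν * t}.indicator (fun _ => E - E₁) x) := by
    refine setIntegral_congr_fun (measurableSet_box L) fun x hx => ?_
    have hxL : x 1 < L := (hx 1).2
    have eL : energyDensity γ 1 !₂[0, V] = E := by rw [energyDensity_vec, hE]; ring_nf
    have eR : energyDensity γ 1 !₂[0, -V] = E := by rw [energyDensity_vec, hE]; ring_nf
    have eM : energyDensity γ r !₂[(w (x, t)).1, (w (x, t)).2] = E₁ := by
      rw [energyDensity_vec, hE₁, hw.speed]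
    simp only [indicator, mem_ofPred_eq, hxL, if_true, fanVelocity, fan]
    by_cases h1 : x 1 < -ν * t
    · have h2 : x 1 < ν * t := by linarith
      simp only [h1, h2, if_true, eL]; ring
    · by_cases h2 : x 1 < ν * t
      · simp only [h1, h2, if_true, if_false, eM]; ring
      · simp only [h1, h2, if_false, eR]; ring
  rw [e, integral_add_add i0 i1 i2, e0, e1, e2]
  ring

lemma hasDissipationRate_fan (hν : 0 < ν) (hw : IsWedgeField a₁ a₂ ν w) {L t : ℝ} (ht : 0 ≤ t)
    (htL : ν * t < L) :
    HasDissipationRate γ (fan (-ν) ν 1 r 1) (fanVelocity ν V w) L t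
      (4 * L * (ν * (fanEnergy γ r (a₁ + a₂) - fanEnergy γ 1 (V ^ 2)))) := by
  set D := 4 * L * (ν * (fanEnergy γ r (a₁ + a₂) - fanEnergy γ 1 (V ^ 2)))
  have h : HasDerivWithinAt (fun t => 4 * L ^ 2 * fanEnergy γ 1 (V ^ 2) + D * t) D (Ici t) t := by
    simpa using ((hasDerivAt_id t).const_mul D).hasDerivWithinAt.const_add
      (4 * L ^ 2 * fanEnergy γ 1 (V ^ 2))
  refine h.congr_of_eventuallyEq ?_ (energy_fan hν hw ht htL.le)
  have hev : ∀ᶠ s in 𝓝[Ici t] t, ν * s < L :=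
    nhdsWithin_le_nhds ((continuous_const.mul continuous_id).continuousAt.eventually
      (gt_mem_nhds htL))
  filter_upwards [hev, self_mem_nhdsWithin] with s hs hs'
  exact energy_fan hν hw (ht.trans hs') hs.le

end FanSolution

end IsentropicEuler

end

/-! ### Thermodynamic inequalities -/

noncomputable section

namespace IsentropicEuler

section Thermodynamics

variable {γ : ℝ}

lemma hasDerivAt_internalEnergy (γ : ℝ) {r : ℝ} (hr : 0 < r) :
    HasDerivAt (internalEnergy γ) (r ^ γ / r ^ 2) r := by
  by_cases h : γ = 1
  · have e : internalEnergy γ = Real.log := by funext r; simp [internalEnergy, h]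
    rw [e, h, Real.rpow_one]
    refine (Real.hasDerivAt_log hr.ne').congr_deriv ?_
    field_simp
  · have e : internalEnergy γ = fun r => r ^ (γ - 1) / (γ - 1) := by
      funext r; simp [internalEnergy, h]
    have h' : γ - 1 ≠ 0 := sub_ne_zero.2 h
    rw [e]
    refine ((Real.hasDerivAt_rpow_const (p := γ - 1) (Or.inl hr.ne')).div_const
      (γ - 1)).congr_deriv ?_
    rw [mul_div_cancel_left₀ _ h', sub_sub, Real.rpow_sub hr, ← Real.rpow_natCast r 2]
    norm_num

/-- From `1 - 1/x ≤ log x` with `x = m ^ (γ - 1)`. The bound is uniform down to `γ = 1`, where it is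
an equality. -/
lemma internalEnergy_sub_le (hγ : 1 ≤ γ) {m : ℝ} (hm : 1 ≤ m) :
    internalEnergy γ m - internalEnergy γ 1 ≤ m ^ (γ - 1) * Real.log m := by
  have hm0 : 0 < m := by linarith
  rcases hγ.eq_or_lt with h | h
  · simp [internalEnergy, ← h]
  · have h1 : γ ≠ 1 := h.ne'
    have h2 : 0 < γ - 1 := by linarith
    have h3 : 0 < m ^ (γ - 1) := Real.rpow_pos_of_pos hm0 _
    have h4 := Real.one_sub_inv_le_log_of_pos h3
    rw [Real.log_rpow hm0] at h4
    simp only [internalEnergy, h1, if_false, Real.one_rpow]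
    rw [← sub_div, div_le_iff₀ h2]
    have h5 : m ^ (γ - 1) * (1 - (m ^ (γ - 1))⁻¹) ≤ m ^ (γ - 1) * ((γ - 1) * Real.log m) := by
      gcongr
    rw [mul_sub, mul_inv_cancel₀ h3.ne'] at h5
    linarith

/-- Bernoulli's inequality at `1/r` gives the sharper factor `1 - 1/r`; it is relaxed to `r - 1`. -/
lemma rpow_sub_one_le (hγ : 1 ≤ γ) {r : ℝ} (hr : 1 ≤ r) : r ^ γ - 1 ≤ γ * r ^ γ * (r - 1) := by
  have hr0 : 0 < r := by linarith
  have hi : (0 : ℝ) < r⁻¹ := by positivity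
  have h := one_add_mul_self_le_rpow_one_add (s := r⁻¹ - 1) (by linarith) hγ
  rw [add_sub_cancel, Real.inv_rpow hr0.le] at h
  have hp : 0 < r ^ γ := Real.rpow_pos_of_pos hr0 _
  have h2 : r ^ γ * (1 + γ * (r⁻¹ - 1)) ≤ 1 := by
    calc _ ≤ r ^ γ * (r ^ γ)⁻¹ := by gcongr
      _ = 1 := mul_inv_cancel₀ hp.ne'
  have h3 : (1 - r⁻¹) ≤ r - 1 := by
    have : 1 - r⁻¹ = (r - 1) / r := by field_simp
    rw [this]
    exact div_le_self (by linarith) hr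
  have h4 : γ * r ^ γ * (1 - r⁻¹) ≤ γ * r ^ γ * (r - 1) := by gcongr
  nlinarith

/-- The energy inequality for a shock that compresses gas of unit density. -/
lemma shock_energy_le (hγ : 1 ≤ γ) {m : ℝ} (hm : 1 ≤ m) :
    m * (internalEnergy γ m - internalEnergy γ 1) ≤ (m - 1) * (m ^ γ + 1) / 2 := by
  -- In terms of the specific volume `1/r`, the energy is an integral of the convex function `p`,
  -- and the claim is the trapezoid bound. The excess of the trapezoid vanishes at `1` and increases
  -- by `rpow_sub_one_le`.
  have hd : ∀ r : ℝ, 1 ≤ r → HasDerivAt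
      (fun r => (1 - r⁻¹) * (r ^ γ + 1) / 2 - internalEnergy γ r)
      ((γ * r ^ γ * (r - 1) - (r ^ γ - 1)) / (2 * r ^ 2)) r := by
    intro r hr
    have hr0 : 0 < r := by linarith
    refine (((((hasDerivAt_inv hr0.ne').const_sub 1).mul
      ((Real.hasDerivAt_rpow_const (p := γ) (Or.inl hr0.ne')).add_const 1)).div_const 2).sub
      (hasDerivAt_internalEnergy γ hr0)).congr_deriv ?_
    rw [Real.rpow_sub_one hr0.ne']
    field_simp
    ring
  have hmono : MonotoneOn (fun r => (1 - r⁻¹) * (r ^ γ + 1) / 2 - internalEnergy γ r)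
      (Ici 1) := by
    refine monotoneOn_of_hasDerivWithinAt_nonneg (convex_Ici 1)
      (fun r hr => (hd r hr).continuousAt.continuousWithinAt)
      (fun r hr => (hd r (interior_subset hr)).hasDerivWithinAt) fun r hr => ?_
    have := rpow_sub_one_le hγ (interior_subset hr : (1 : ℝ) ≤ r)
    exact div_nonneg (by linarith) (by positivity)
  have h := hmono (mem_Ici.2 le_rfl) (mem_Ici.2 hm) hm
  simp only [inv_one, sub_self, zero_mul, zero_div, zero_sub] at h
  have hm0 : 0 < m := by linarith
  have h2 : m * (internalEnergy γ m - internalEnergy γ 1) ≤ m * ((1 - m⁻¹) * (m ^ γ + 1) / 2) := by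
    gcongr; linarith
  refine h2.trans_eq ?_
  field_simp

end Thermodynamics

/-! ### Choice of the collision speed and of the fan -/

section Parameters

variable {γ V : ℝ}

/-- The Rankine-Hugoniot relation between the collision speed and the density between the shocks. -/
def IsShockDensity (γ V m : ℝ) : Prop := V ^ 2 * m / (m - 1) = m ^ γ - 1

/-- In `r` the pressure jump increases while `V² r / (r - 1)` decreases. The relation of
`IsShockDensity` thus has at most one root above `1`, and below it the excess is the room for `a₂ >
0`. -/
lemma flux_lt (hγ : 1 ≤ γ) {m r : ℝ} (hr : 1 < r) (hrm : r < m)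
    (hm : IsShockDensity γ V m) : r ^ γ - 1 < V ^ 2 * r / (r - 1) := by
  have h1 : r ^ γ < m ^ γ := Real.rpow_lt_rpow (by linarith) hrm (by linarith)
  have h2 : V ^ 2 * m / (m - 1) ≤ V ^ 2 * r / (r - 1) := by
    rw [div_le_div_iff₀ (by linarith) (by linarith)]
    nlinarith [sq_nonneg V]
  rw [IsShockDensity] at hm
  linarith

lemma IsShockDensity.unique (hγ : 1 ≤ γ) {m r : ℝ} (hr : 1 < r) (hm : 1 < m)
    (h : IsShockDensity γ V r) (h' : IsShockDensity γ V m) : r = m := by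
  rcases lt_trichotomy r m with c | c | c
  · exact absurd h (flux_lt hγ hr c h').ne'
  · exact c
  · exact absurd h' (flux_lt hγ hm c h).ne'

/-- The dissipation rate, per unit of momentum, of fans of density `r` with the least energy. -/
def fanDissipation (γ V r : ℝ) : ℝ :=
  (r * internalEnergy γ r - internalEnergy γ 1 - (r ^ γ - 1) / 2) / (r - 1)
    + V ^ 2 / (2 * (r - 1) ^ 2)

/-- The mass and momentum conditions eliminate `ν` and `a₂`, which leaves `a₁` as the only cost
beyond `fanDissipation`. At the shock both `a₁` and `a₂` are zero. -/
lemma fanDissipation_eq {r ν a₁ a₂ : ℝ} (hr : 1 < r) (hmass : V = ν * (r - 1))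
    (hmom : ν * V + V ^ 2 + 1 = pressure γ r + r * a₂) :
    ν * (fanEnergy γ r (a₁ + a₂) - fanEnergy γ 1 (V ^ 2))
      = V * fanDissipation γ V r + ν * r * a₁ / 2 := by
  have h1 : r - 1 ≠ 0 := by linarith
  have e : r * a₂ = ν * V + V ^ 2 + 1 - r ^ γ := by rw [pressure] at hmom; linarith
  have e' : r * (a₁ + a₂) / 2 = r * a₁ / 2 + (ν * V + V ^ 2 + 1 - r ^ γ) / 2 := by
    rw [← e]; ring
  simp only [fanEnergy, fanDissipation, e']
  rw [hmass]
  field_simp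
  ring

/-- The derivative is taken with `V` fixed; only afterwards is `V²` replaced by its value from the
shock relation at `m`. -/
lemma hasDerivAt_fanDissipation {m : ℝ} (hm : 1 < m) (hs : IsShockDensity γ V m) :
    HasDerivAt (fanDissipation γ V)
      (((3 - γ) / 2 * m ^ γ - (2 - γ / 2) * (m ^ γ / m) - 1 / 2 + 1 / m
        - (internalEnergy γ m - internalEnergy γ 1)) / (m - 1) ^ 2) m := by
  have hm0 : 0 < m := by linarith
  have h1 : m - 1 ≠ 0 := by linarith
  have hid := hasDerivAt_id m
  have hp := Real.hasDerivAt_rpow_const (p := γ) (Or.inl hm0.ne')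
  have hV : V ^ 2 = (m ^ γ - 1) * (m - 1) / m := by
    rw [← hs]; field_simp
  have h := ((((hid.mul (hasDerivAt_internalEnergy γ hm0)).sub_const (internalEnergy γ 1)).sub
    ((hp.sub_const 1).div_const 2)).div (hid.sub_const 1) h1).add
    ((hasDerivAt_const m (V ^ 2)).div (((hid.sub_const 1).pow 2).const_mul 2)
      (mul_ne_zero two_ne_zero (pow_ne_zero 2 h1)))
  refine HasDerivAt.congr_deriv (f := fanDissipation γ V) h ?_
  rw [Real.rpow_sub_one hm0.ne', hV]
  simp
  field_simp
  ring

/-- For strong shocks the term `(3 - γ)/2 * m ^ γ` dominates, because the internal energy grows at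
most like `m ^ (γ - 1) log m`. -/
lemma exists_shock_with_increasing_dissipation (hγ₁ : 1 ≤ γ) (hγ₃ : γ < 3) :
    ∃ m : ℝ, 1 < m ∧ 0 < (3 - γ) / 2 * m ^ γ - (2 - γ / 2) * (m ^ γ / m) - 1 / 2 + 1 / m
        - (internalEnergy γ m - internalEnergy γ 1) := by
  -- With `m = (5/c)²` the product `c m` is `5 * (5/c)`, while `log m ≤ 2 (5/c - 1)`; the difference
  -- outweighs the remaining constants.
  set c := (3 - γ) / 2 with hc
  have hc0 : 0 < c := by linarith
  have hc1 : c ≤ 1 := by linarith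
  have h5 : 5 ≤ 5 / c := by rw [le_div_iff₀ hc0]; linarith
  have hm : 1 < (5 / c) ^ 2 := by nlinarith
  have hlog : Real.log ((5 / c) ^ 2) ≤ 2 * (5 / c - 1) := by
    rw [Real.log_pow]
    push_cast
    gcongr
    exact Real.log_le_sub_one_of_pos (by linarith)
  have hcm : c * (5 / c) ^ 2 = 5 * (5 / c) := by field_simp
  refine ⟨(5 / c) ^ 2, hm, ?_⟩
  set m := (5 / c) ^ 2
  have hm0 : 0 < m := by linarith
  have hi := internalEnergy_sub_le hγ₁ hm.le
  have hp : 1 ≤ m ^ (γ - 1) := Real.one_le_rpow hm.le (by linarith)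
  have e : m ^ γ = m ^ (γ - 1) * m := by rw [Real.rpow_sub_one hm0.ne']; field_simp
  have e' : m ^ γ / m = m ^ (γ - 1) := by rw [e]; field_simp
  rw [e', e]
  set P := m ^ (γ - 1)
  have hpos : 0 < P * (c * m - (2 - γ / 2) - 1 / 2 - Real.log m) := by
    apply mul_pos (by linarith)
    rw [hcm]; linarith
  have : 0 < 1 / m := by positivity
  nlinarith

/-- Colliding states for which some fan with a non-constant middle part dissipates more energy than
the two shocks. -/
lemma exists_fan_parameters (hγ₁ : 1 ≤ γ) (hγ₃ : γ < 3) :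
    ∃ m V : ℝ, 1 < m ∧ 0 < V ∧ IsShockDensity γ V m ∧
      ∃ r ν a₁ a₂ : ℝ, 1 < r ∧ V / (m - 1) < ν ∧ 0 < a₁ ∧ 0 < a₂ ∧ V = ν * (r - 1) ∧
        ν * V + V ^ 2 + 1 = pressure γ r + r * a₂ ∧
        ν * (fanEnergy γ r (a₁ + a₂) - fanEnergy γ 1 (V ^ 2)) < V * fanDissipation γ V m := by
  obtain ⟨m, hm, hpos⟩ := exists_shock_with_increasing_dissipation hγ₁ hγ₃
  have hm1 : 0 < m - 1 := by linarith
  have hmγ : 1 < m ^ γ := Real.one_lt_rpow hm (by linarith)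
  -- The density `m` is prescribed and the speed `V` is fitted to it by the shock relation.
  set W := (m ^ γ - 1) * (m - 1) / m with hW
  have hW0 : 0 < W := by
    apply div_pos (mul_pos (by linarith) hm1) (by linarith)
  obtain ⟨V, hV, hVW⟩ : ∃ V : ℝ, 0 < V ∧ V ^ 2 = W :=
    ⟨Real.sqrt W, Real.sqrt_pos.2 hW0, Real.sq_sqrt hW0.le⟩
  have hs : IsShockDensity γ V m := by
    rw [IsShockDensity, hVW, hW]; field_simp
  refine ⟨m, V, hm, hV, hs, ?_⟩
  have hd := hasDerivAt_fanDissipation hm hs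
  have hslope : ∀ᶠ r in 𝓝[≠] m, 0 < slope (fanDissipation γ V) m r :=
    (hasDerivAt_iff_tendsto_slope.1 hd).eventually (lt_mem_nhds (div_pos hpos (by positivity)))
  -- Only `r < m` is useful: there `a₂ > 0`, and a positive derivative makes `fanDissipation`
  -- smaller, which means that more energy is dissipated.
  have hslope' : ∀ᶠ r in 𝓝[<] m, 0 < slope (fanDissipation γ V) m r :=
    hslope.filter_mono (nhdsWithin_mono _ fun r hr => ne_of_lt hr)
  obtain ⟨r, hr, hr1, hrm⟩ := (hslope'.and (Ioo_mem_nhdsLT hm)).exists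
  have hlt : fanDissipation γ V r < fanDissipation γ V m := by
    rw [slope_def_field, div_pos_iff] at hr
    rcases hr with h | h <;> linarith [h.1, h.2]
  have hr0 : 0 < r - 1 := by linarith
  have hmass : V = V / (r - 1) * (r - 1) := by field_simp
  have hν : 0 < V / (r - 1) := by positivity
  have hfl := flux_lt hγ₁ hr1 hrm hs
  have hmom : V / (r - 1) * V + V ^ 2 + 1
      = pressure γ r + r * ((V ^ 2 * r / (r - 1) - (r ^ γ - 1)) / r) := by
    have : r ≠ 0 := by linarith
    rw [pressure]
    field_simp
    ring
  set ν := V / (r - 1)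
  -- The choice of `a₁` spends half of the gap in dissipation, since it enters as `ν r a₁ / 2`; `a₂`
  -- is forced by the momentum condition.
  refine ⟨r, ν, (V * fanDissipation γ V m - V * fanDissipation γ V r) / (ν * r),
    (V ^ 2 * r / (r - 1) - (r ^ γ - 1)) / r, hr1, ?_, ?_, ?_, hmass, hmom, ?_⟩
  · exact div_lt_div_of_pos_left hV hr0 (by linarith)
  · have := mul_lt_mul_of_pos_left hlt hV
    exact div_pos (by linarith) (by positivity)
  · exact div_pos (by linarith) (by linarith)
  · rw [fanDissipation_eq hr1 hmass hmom]
    have : ν * r * ((V * fanDissipation γ V m - V * fanDissipation γ V r) / (ν * r))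
        = V * fanDissipation γ V m - V * fanDissipation γ V r := by
      field_simp
    rw [this]
    have := mul_lt_mul_of_pos_left hlt hV
    linarith

end Parameters

/-! ### The two-shock solution and its uniqueness -/

section TwoShocks

variable {γ V m : ℝ}

lemma IsShockDensity.momentum (hm : 1 < m) (hs : IsShockDensity γ V m) :
    V / (m - 1) * V + V ^ 2 + 1 = pressure γ m + m * 0 := by
  have h1 : m - 1 ≠ 0 := by linarith
  rw [pressure, mul_zero, add_zero, sub_eq_iff_eq_add.1 hs.symm]
  field_simp
  ring

/-- This is `shock_energy_le` after `m ^ γ` is expressed through `V` by the shock relation. -/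
lemma IsShockDensity.energy_le (hγ : 1 ≤ γ) (hV : 0 < V) (hm : 1 < m)
    (hs : IsShockDensity γ V m) :
    V / (m - 1) * (fanEnergy γ m (0 + 0) - fanEnergy γ 1 (V ^ 2))
      ≤ (fanEnergy γ 1 (V ^ 2) + 1) * V := by
  have h := shock_energy_le hγ hm.le
  have h1 : 0 < m - 1 := by linarith
  have e : m ^ γ = V ^ 2 * m / (m - 1) + 1 := sub_eq_iff_eq_add.1 hs.symm
  have e' : (m - 1) * (m ^ γ + 1) / 2 = V ^ 2 * m / 2 + (m - 1) := by
    rw [e]; field_simp; ring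
  rw [e'] at h
  rw [div_mul_eq_mul_div, div_le_iff₀ h1, mul_right_comm, mul_comm V]
  gcongr
  simp only [fanEnergy]
  nlinarith

lemma isTwoShockSolution_collision (hγ : 1 ≤ γ) (hV : 0 < V) (hm : 1 < m)
    (hs : IsShockDensity γ V m) :
    IsTwoShockSolution γ (collision V) (fan (-(V / (m - 1))) (V / (m - 1)) 1 m 1)
      (fanVelocity (V / (m - 1)) V 0) := by
  have hmom := hs.momentum hm
  have hen := hs.energy_le hγ hV hm
  have hmass : V = V / (m - 1) * (m - 1) := by
    have : m - 1 ≠ 0 := by linarith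
    field_simp
  have hσ : 0 < V / (m - 1) := div_pos hV (by linarith)
  set σ := V / (m - 1)
  have e1 : energyDensity γ 1 !₂[0, V] = fanEnergy γ 1 (V ^ 2) := by
    rw [energyDensity_vec]; ring_nf
  have e2 : energyDensity γ 1 !₂[0, -V] = fanEnergy γ 1 (V ^ 2) := by
    rw [energyDensity_vec]; ring_nf
  have e3 : energyDensity γ m !₂[0, 0] = fanEnergy γ m (0 + 0) := by
    rw [energyDensity_vec]; norm_num
  refine ⟨m, !₂[0, 0], -σ, σ, hm, hm, by linarith, ⟨?_, ?_, ?_, ?_⟩, ⟨?_, ?_, ?_, ?_⟩, rfl, rfl⟩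
  all_goals simp only [collision, e1, e2, e3, pressure_one, PiLp.toLp_apply,
    Matrix.cons_val_zero, Matrix.cons_val_one]
  all_goals nlinarith

lemma IsTwoShockSolution.unique (hγ : 1 ≤ γ) (hV : 0 < V) (hm : 1 < m)
    (hs : IsShockDensity γ V m) {ρ : SpaceTime → ℝ} {v : SpaceTime → Plane}
    (h : IsTwoShockSolution γ (collision V) ρ v) :
    ρ = fan (-(V / (m - 1))) (V / (m - 1)) 1 m 1 ∧ v = fanVelocity (V / (m - 1)) V 0 := by
  obtain ⟨r, u, s₁, s₃, hr, -, hlt, hL, hR, rfl, rfl⟩ := h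
  have hmL := hL.mass
  have hpL := hL.momentum₁
  have hqL := hL.momentum₂
  have hmR := hR.mass
  have hpR := hR.momentum₁
  have hqR := hR.momentum₂
  simp only [collision, pressure, Real.one_rpow, PiLp.toLp_apply, Matrix.cons_val_zero,
    Matrix.cons_val_one] at hmL hpL hqL hmR hpR hqR hr
  have hr0 : 0 < r := by linarith
  have hr1 : 0 < r - 1 := by linarith
  -- A tangential velocity in the middle would force both shocks to move with the gas, at the same
  -- speed.
  have hu0 : u 0 = 0 := by
    by_contra hu
    have hk : r * u 0 ≠ 0 := mul_ne_zero hr0.ne' hu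
    have h1 : s₁ = u 1 := mul_left_cancel₀ hk (by linarith)
    have h3 : s₃ = u 1 := mul_left_cancel₀ hk (by linarith)
    linarith
  -- Eliminating the shock speeds yields the same right-hand side on both sides, so `(u₂ - V)² = (u₂
  -- + V)²` and `u₂ = 0`.
  have jL : r * (u 1 - V) ^ 2 = (r ^ γ - 1) * (r - 1) := by
    linear_combination (r - 1) * hqL - (r * u 1 - V) * hmL
  have jR : r * (u 1 + V) ^ 2 = (r ^ γ - 1) * (r - 1) := by
    linear_combination (1 - r) * hqR + (r * u 1 + V) * hmR
  have hu1 : u 1 = 0 := by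
    have : (4 * r * V) * u 1 = 0 := by linarith
    exact (mul_eq_zero.1 this).resolve_left (by positivity)
  have hrm : r = m := by
    refine IsShockDensity.unique hγ hr hm ?_ hs
    rw [IsShockDensity, div_eq_iff hr1.ne', ← jL, hu1]
    ring
  have hs₁ : s₁ = -(V / (m - 1)) := by
    rw [← hrm, ← neg_div, eq_div_iff hr1.ne']
    linear_combination hmL + r * hu1
  have hs₃ : s₃ = V / (m - 1) := by
    rw [← hrm, eq_div_iff hr1.ne']
    linear_combination -hmR + r * hu1
  have hu : u = !₂[0, 0] := by
    ext i; fin_cases i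
    · simpa using hu0
    · simpa using hu1
  rw [hs₁, hs₃, hu, hrm]
  exact ⟨rfl, rfl⟩

/-- With equal densities the square root is zero, and `-2V < 0`. -/
lemma twoShockCondition_collision (hV : 0 < V) : (collision V).TwoShockCondition γ := by
  refine ⟨rfl, ?_⟩
  simp [collision]
  linarith

end TwoShocks

end IsentropicEuler

end

/-! ### Conclusion -/

noncomputable section

namespace IsentropicEuler

lemma not_fanVelocity_ae_eq {ν V : ℝ} (hν : 0 < ν) {f g w w' : SpaceTime → ℝ × ℝ}
    (hf : ∀ z ∈ wedge ν, f z = w z) (hg : ∀ z ∈ wedge ν, g z = w' z)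
    (hne : ¬ w =ᵐ[volume.restrict (wedge ν)] w') :
    ¬ fanVelocity ν V f =ᵐ[volume.restrict upperHalf] fanVelocity ν V g := by
  intro h
  refine hne ?_
  filter_upwards [ae_restrict_of_ae_restrict_of_subset (wedge_subset hν) h,
    ae_restrict_mem isOpen_wedge.measurableSet] with z hz hzw
  simp only [fanVelocity, fan_middle _ _ _ hzw.1 hzw.2, hf z hzw, hg z hzw] at hz
  have h0 := congrFun (congrArg WithLp.ofLp hz) 0
  have h1 := congrFun (congrArg WithLp.ofLp hz) 1
  exact Prod.ext (by simpa using h0) (by simpa using h1)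

end IsentropicEuler

end

open IsentropicEuler in
theorem theorem2 (γ : ℝ) (hγ₁ : 1 ≤ γ) (hγ₃ : γ < 3) :
    ∃ d : RiemannData, d.TwoShockCondition γ ∧
      ∃ (ρc : Plane × ℝ → ℝ) (vc : Plane × ℝ → Plane),
        IsTwoShockSolution γ d ρc vc ∧
        (∀ ρ v, IsTwoShockSolution γ d ρ v → ρ = ρc ∧ v = vc) ∧
        IsAdmissibleSolution γ d.density d.velocity ρc vc ∧
        ¬ IsEntropyRateAdmissible γ d.density d.velocity ρc vc ∧
        ∃ (ν₁ ν₂ ρ₁ C : ℝ) (ρn : Plane × ℝ → ℝ) (vn : ℕ → Plane × ℝ → Plane),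
          ν₁ < ν₂ ∧ 0 < ρ₁ ∧ 0 < C ∧
          (∀ n, IsAdmissibleSolution γ d.density d.velocity ρn (vn n)) ∧
          (∀ n, HasFanForm d ν₁ ν₂ ρ₁ C ρn (vn n)) ∧
          (∀ m n, m ≠ n → ¬ vn m =ᵐ[MeasureTheory.volume.restrict upperHalf] vn n) ∧
          (∀ n, ∀ L : ℝ, 0 < L → ∃ T : ℝ, 0 < T ∧
            ∀ t ∈ Set.Ico 0 T, DissipatesMore γ ρn (vn n) ρc vc L t) := by
  classical
  obtain ⟨m, V, hm, hV, hs, r, ν, a₁, a₂, hr, hσν, ha₁, ha₂, hmass, hmom, hdiss⟩ :=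
    exists_fan_parameters hγ₁ hγ₃
  have hσ : 0 < V / (m - 1) := div_pos hV (by linarith)
  have hν : 0 < ν := hσ.trans hσν
  have hmassc : V = V / (m - 1) * (m - 1) := by
    have : m - 1 ≠ 0 := by linarith
    field_simp
  have henc := hs.energy_le hγ₁ hV hm
  -- The right-hand side is `V * fanDissipation γ V m`, as `a₁ = 0` for the two shocks.
  have hlt : ν * (fanEnergy γ r (a₁ + a₂) - fanEnergy γ 1 (V ^ 2))
      < V / (m - 1) * (fanEnergy γ m (0 + 0) - fanEnergy γ 1 (V ^ 2)) := by
    rwa [fanDissipation_eq hm hmassc (hs.momentum hm), mul_zero, zero_div, add_zero]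
  have hc : IsAdmissibleSolution γ (collision V).density (collision V).velocity _ _ :=
    isAdmissibleSolution_fan hσ (by linarith) hmassc (hs.momentum hm) isWedgeField_zero henc
  obtain ⟨v, hv, hvne⟩ := exists_seq_exactSolution isOpen_wedge (wedge_nonempty hν) ha₁ ha₂
  have hw := fun n => (hv n).isWedgeField ha₁ ha₂
  -- The fans are admissible because they dissipate more than the two shocks and the admissibility
  -- bound depends on the outer states only.
  have hsol : ∀ n, IsAdmissibleSolution γ (collision V).density (collision V).velocity _ _ :=
    fun n => isAdmissibleSolution_fan hν (by linarith) hmass hmom (hw n) (hlt.le.trans henc)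
  have hmore : ∀ n (L t : ℝ), 0 < L → 0 ≤ t → ν * t < L →
      DissipatesMore γ (fan (-ν) ν 1 r 1)
        (fanVelocity ν V fun z => if z ∈ wedge ν then v n z else (Real.sqrt (a₁ + a₂), 0))
        (fan (-(V / (m - 1))) (V / (m - 1)) 1 m 1) (fanVelocity (V / (m - 1)) V 0) L t := by
    intro n L t hL ht htL
    refine ⟨_, _, hasDissipationRate_fan hν (hw n) ht htL,
      hasDissipationRate_fan hσ isWedgeField_zero ht (lt_of_le_of_lt ?_ htL), ?_⟩
    · gcongr
    · exact mul_lt_mul_of_pos_left hlt (by positivity)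
  refine ⟨collision V, twoShockCondition_collision hV, _, _,
    isTwoShockSolution_collision hγ₁ hV hm hs, fun ρ v h => h.unique hγ₁ hV hm hs, hc, ?_,
    -ν, ν, r, a₁ + a₂, _, _, by linarith, by linarith, by linarith, hsol,
    fun n => hasFanForm_fan hν (hw n), fun i j hij => ?_, fun n L hL => ?_⟩
  · rintro ⟨-, Lstar, hL, hno⟩
    -- At `τ = 0` agreement up to time `τ` is agreement of the initial data, and at `t = 0` the fan
    -- lies in every box, so any `Lstar` is defeated.
    refine hno ⟨_, _, (hsol 0).toIsWeakSolution, 0, le_rfl, fun t ht => ?_,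
      fun L hL' => hmore 0 L 0 (hL.trans_le hL') le_rfl (by linarith)⟩
    obtain rfl : t = 0 := le_antisymm ht.2 ht.1
    filter_upwards [(hsol 0).initial, hc.initial] with x h h'
    exact ⟨h.1.trans h'.1.symm, h.2.trans h'.2.symm⟩
  · exact not_fanVelocity_ae_eq hν (fun z hz => if_pos hz) (fun z hz => if_pos hz)
      (hvne i j hij)
  -- Until the time `L / ν` the faster fan, and with it the slower shocks, remain in the box.
  · refine ⟨L / ν, by positivity, fun t ht => hmore n L t hL ht.1 ?_⟩
    rw [mul_comm]
    exact (lt_div_iff₀ hν).1 ht.2
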